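/- Let $n\in\{1,2\}$ and $\gamma\in\mathbb C$. For $\boldsymbol z=(z_1,\dots,z_{2n})$ with nonzero entries put $s_j:=(z_j-1/z_j)/2i$ and $E(\boldsymbol z):=-\sum_{j=1}^{2n}(z_j+1/z_j)-4i\gamma n$. On $(\mathbb C^2)^{\otimes 2n}$, with basis $|\boldsymbol a\rangle$, $\boldsymbol a\in\{\uparrow,\downarrow\}^{2n}$, let $\Pi_{j,j+1}$ exchange the factors $j,j+1$ and let $Y_{j,j+1}(\lambda):=(\lambda\Pi_{j,j+1}-2\gamma)/(\lambda-2\gamma)$. Define vectors $|\boldsymbol zP\rangle$, $P\in S_{2n}$, by $$|\boldsymbol z\rangle:=\frac{(-1)^{n(n-1)/2}}{2^n}\bigotimes_{j=1}^n\big[|\!\downarrow\rangle_{2j-1}|\!\uparrow\rangle_{2j}-|\!\uparrow\rangle_{2j-1}|\!\downarrow\rangle_{2j}\big],\qquad |\boldsymbol zP\Pi_{j,j+1}\rangle=Y_{j,j+1}(s_{P(j)}-s_{P(j+1)})\,|\boldsymbol zP\rangle ,$$ and the Bethe wave function by $$\phi(\boldsymbol x;\boldsymbol a|\boldsymbol z):=\sum_{P\in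 S_{2n}}\mathrm{sign}(PQ)\,\langle \boldsymbol aQ|\boldsymbol zP\rangle\prod_{j=1}^{2n}z_{P(j)}^{x_{Q(j)}},$$ where $\boldsymbol x\in\mathbb Z^{2n}$ and $Q\in S_{2n}$ is any permutation with $x_{Q(1)}\le\dots\le x_{Q(2n)}$, and $(\boldsymbol aQ)_j=a_{Q(j)}$. There is $r_0\in(0,1]$ depending only on $n$ and $\gamma$ such that for every $r\in(0,r_0)$ the following holds. Whenever $j<k$ and $|z_k|=r^{2n-k}$, all poles of $1/(s_j-s_k-2\gamma)$ with respect to $z_j$ lie outside the circle $|z_j|=r^{2n-j}$. If $|z_j|=r^{2n-j}$ for all $j$, the family $|\boldsymbol zP\rangle$ exists and is unique. Moreover, for all integers $y_1<\dots<y_n$: (i) The Schrödinger equation $i\partial_t\psi_t=H_{2n}\psi_t$ with $$H_{2n}=-\sum_{j=1}^{2n}(\Delta_j^++\Delta_j^-)+4i\gamma\sum_{1\le j<k\le 2n}\delta_{x_j,x_k}-4i\gamma n$$ (where $\Delta_j^\pm$ shifts $x_j$ by $\pm1$) and the initial condition $$\psi_0(\boldsymbol x;\boldsymbol a)=\mathrm{sign}(Q)(-1)^{n(n-1)/2}\prod_{j=1}^n\delta_{x_{Q(2j-1)},y_j}\delta_{x_{Q(2j)},y_j}\big(\delta_{a_{Q(2j-1)},\downarrow}\delta_{a_{Q(2j)},\uparrow}-\delta_{a_{Q(2j-1)},\uparrow}\delta_{a_{Q(2j)},\downarrow}\big)$$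 has a solution for all $t\in\mathbb R$ that is bounded in $(\boldsymbol x,\boldsymbol a)$ locally uniformly in $t$. Every such solution, on any time interval containing $0$, is given by $$\psi_t(\boldsymbol x;\boldsymbol a)=\oint dz^{2n}\,e^{-iE(\boldsymbol z)t}\,\phi(\boldsymbol x;\boldsymbol a|\boldsymbol z)\prod_{j=1}^n z_{2j-1}^{-y_j}z_{2j}^{-y_j},\qquad \oint dz^{2n}:=\prod_{j=1}^{2n}\oint_{|z_j|=r^{2n-j}}\frac{dz_j}{2\pi i z_j},$$ with an integrand that is integrable on the product of the circles. (ii) Let $\gamma\ge0$ be real, and write $\psi_t(\boldsymbol x;\boldsymbol a|\boldsymbol y)$ for the contour integral in (i). For fermions on $\mathbb Z$ with annihilation operators $a_x$ let $n_x=a_x^\dagger a_x$, $H=-\sum_x(a_x^\dagger a_{x+1}+a_{x+1}^\dagger a_x)$, $L_x=\sqrt{4\gamma}\,n_x$, $\mathcal L[\rho]=-i[H,\rho]+\sum_x\big(L_x\rho L_x^\dagger-\tfrac12\{L_x^\dagger L_x,\rho\}\big)$ and $|\boldsymbol x\rangle=a_{x_1}^\dagger\cdots a_{x_n}^\dagger|0\rangle$.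 Then $\partial_t\rho_t=\mathcal L[\rho_t]$, $\rho_0=|\boldsymbol y\rangle\langle\boldsymbol y|$, understood for the matrix elements in the occupation number basis, has a solution for all $t\in\mathbb R$ whose matrix elements are bounded locally uniformly in $t$. Every such solution, on any time interval containing $0$, gives the Green's function $$\langle x_1,\dots,x_n|\rho_t|x_{n+1},\dots,x_{2n}\rangle=\prod_{j=1}^n(-1)^{x_{n+j}-y_j}\;\psi_t(\boldsymbol x;\underbrace{\downarrow,\dots,\downarrow}_n,\underbrace{\uparrow,\dots,\uparrow}_n|\boldsymbol y)$$ for all $\boldsymbol x=(x_1,\dots,x_{2n})\in\mathbb Z^{2n}$. -/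

import Mathlib

open scoped ComplexConjugate

noncomputable section

namespace DephasingChain

/-! ## Wave functions with sites and spins, and the Hubbard Hamiltonian -/

/-- The spin label of a particle. -/
inductive Spin where
  | up : Spin
  | down : Spin
deriving DecidableEq

/-- Positions of `N` particles on the infinite chain. -/
abbrev Sites (N : ℕ) := Fin N → ℤ

/-- Spin labels of `N` particles. -/
abbrev Spins (N : ℕ) := Fin N → Spin

/-- A wave function of `N` particles in first quantization. -/
abbrev Wave (N : ℕ) := Sites N → Spins N → ℂ

/-- The (0-based) index of the first member `2j-1` of the `j`-th pair. -/
def pairFst {n : ℕ} (j : Fin n) : Fin (2 * n) := ⟨2 * j.val, by omega⟩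

/-- The (0-based) index of the second member `2j` of the `j`-th pair. -/
def pairSnd {n : ℕ} (j : Fin n) : Fin (2 * n) := ⟨2 * j.val + 1, by omega⟩

/-- The `2n`-particle Hubbard Hamiltonian with interaction strength `4 i γ`:
`H = -∑_j (Δ_j⁺ + Δ_j⁻) + 4iγ ∑_{j<k} δ_{x_j,x_k} - 4iγn`. -/
def hubbardH (n : ℕ) (γ : ℂ) (f : Wave (2 * n)) : Wave (2 * n) := fun x a =>
  -(∑ j : Fin (2 * n), (f (x + Pi.single j 1) a + f (x - Pi.single j 1) a))
    + 4 * Complex.I * γ *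
        (∑ j : Fin (2 * n), ∑ k : Fin (2 * n), if j < k ∧ x j = x k then 1 else 0) * f x a
    - 4 * Complex.I * γ * n * f x a

/-- `δ_{a,↓} δ_{b,↑} - δ_{a,↑} δ_{b,↓}`. -/
def singletCoeff (a b : Spin) : ℂ :=
  (if a = Spin.down ∧ b = Spin.up then 1 else 0)
    - (if a = Spin.up ∧ b = Spin.down then 1 else 0)

/-- The sign of a permutation as a complex number. -/
def csign {N : ℕ} (P : Equiv.Perm (Fin N)) : ℂ := ((Equiv.Perm.sign P : ℤ) : ℂ)

/-- The initial wave function: `n` doubly occupied singlet sites `y_1, …, y_n`, evaluated at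
`(x; a)` with the help of a permutation `Q` that sorts `x`. -/
def doublonState {n : ℕ} (y : Fin n → ℤ) (Q : Equiv.Perm (Fin (2 * n)))
    (x : Sites (2 * n)) (a : Spins (2 * n)) : ℂ :=
  csign Q * (-1) ^ (n * (n - 1) / 2) *
    ∏ j : Fin n,
      ((if x (Q (pairFst j)) = y j then 1 else 0) * (if x (Q (pairSnd j)) = y j then 1 else 0) *
        singletCoeff (a (Q (pairFst j))) (a (Q (pairSnd j))))

/-- `ψ` solves, on the time interval `J`, the Schrödinger equation `i ∂_t ψ = H ψ` with the
doublon initial condition; as always on an infinite lattice, the growth at infinity has to be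
limited, here by asking that `ψ` is bounded, locally uniformly in time. -/
structure IsSchrodingerSolution {n : ℕ} (γ : ℂ) (y : Fin n → ℤ) (J : Set ℝ)
    (ψ : ℝ → Wave (2 * n)) : Prop where
  equation : ∀ t ∈ J, ∀ x a,
    HasDerivWithinAt (fun s => ψ s x a) (-Complex.I * hubbardH n γ (ψ t) x a) J t
  initial : ∀ x a, ∀ Q : Equiv.Perm (Fin (2 * n)), Monotone (x ∘ Q) →
    ψ 0 x a = doublonState y Q x a
  bounded : ∀ τ : ℝ, ∃ C : ℝ, ∀ t ∈ J, |t| ≤ τ → ∀ x a, ‖ψ t x a‖ ≤ C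

/-! ## The Bethe wave function -/

/-- Vectors of the auxiliary spin space of `N` spins, by their components `⟨a|v⟩`. -/
abbrev SpinVector (N : ℕ) := Spins N → ℂ

/-- `s(z) = (z - 1/z) / 2i`. -/
def sParam (z : ℂ) : ℂ := (z - 1 / z) / (2 * Complex.I)

/-- The Yang operator `Y_{j,k}(l) = (l Π_{j,k} - 2γ) / (l - 2γ)`, where the transposition
`Π_{j,k}` exchanges the tensor factors `j` and `k`. -/
def yang {N : ℕ} (γ : ℂ) (j k : Fin N) (l : ℂ) (v : SpinVector N) : SpinVector N := fun a =>
  (l * v (a ∘ Equiv.swap j k) - 2 * γ * v a) / (l - 2 * γ)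

/-- The vector `|z⟩`: the normalized product of singlets of the pairs `(2j-1, 2j)`. -/
def singletVector (n : ℕ) : SpinVector (2 * n) := fun a =>
  (-1) ^ (n * (n - 1) / 2) / 2 ^ n * ∏ j : Fin n, singletCoeff (a (pairFst j)) (a (pairSnd j))

/-- The family `P ↦ |zP⟩` is generated from the singlet vector `|z⟩` by the relations
`|zPΠ_{j,j+1}⟩ = Y_{j,j+1}(s_{P(j)} - s_{P(j+1)}) |zP⟩`. -/
structure IsScatteringFamily {n : ℕ} (γ : ℂ) (z : Fin (2 * n) → ℂ)
    (A : Equiv.Perm (Fin (2 * n)) → SpinVector (2 * n)) : Prop where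
  base : A 1 = singletVector n
  step : ∀ (P : Equiv.Perm (Fin (2 * n))) (j k : Fin (2 * n)), j.val + 1 = k.val →
    A (P * Equiv.swap j k) = yang γ j k (sParam (z (P j)) - sParam (z (P k))) (A P)

/-- The vectors `|zP⟩` (used only where the family that the relations generate exists
and is unique). -/
def scattering {n : ℕ} (γ : ℂ) (z : Fin (2 * n) → ℂ) :
    Equiv.Perm (Fin (2 * n)) → SpinVector (2 * n) :=
  Classical.epsilon (fun A => IsScatteringFamily γ z A)

/-- The Bethe wave function
`φ(x;a|z) = ∑_P sign(PQ) ⟨aQ|zP⟩ ∏_j z_{P(j)}^{x_{Q(j)}}`, where `Q` sorts `x`. -/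
def betheWave {n : ℕ} (γ : ℂ) (z : Fin (2 * n) → ℂ) (Q : Equiv.Perm (Fin (2 * n)))
    (x : Sites (2 * n)) (a : Spins (2 * n)) : ℂ :=
  ∑ P : Equiv.Perm (Fin (2 * n)),
    csign (P * Q) * scattering γ z P (a ∘ Q) * ∏ j : Fin (2 * n), z (P j) ^ x (Q j)

/-- `E(z) = -2 ∑_j (z_j + 1/z_j)/2 - 4iγn`. -/
def energy {n : ℕ} (γ : ℂ) (z : Fin (2 * n) → ℂ) : ℂ :=
  -2 * (∑ j : Fin (2 * n), (z j + 1 / z j) / 2) - 4 * Complex.I * γ * n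

/-! ## The contour integral -/

/-- The radii `|z_j| = r^{2n-j}`, `j = 1, …, 2n` (the index below is 0-based). -/
def radius (n : ℕ) (r : ℝ) : Fin (2 * n) → ℝ := fun j => r ^ (2 * n - 1 - j.val)

/-- For `j < k` the poles of `1 / (s_j - s_k - 2γ)` in the variable `z_j` lie outside the
`z_j`-contour, whenever `z_k` is on its contour. -/
def PolesOutside (n : ℕ) (γ : ℂ) (r : ℝ) : Prop :=
  ∀ j k : Fin (2 * n), j < k → ∀ z w : ℂ, ‖z‖ = radius n r k → w ≠ 0 → ‖w‖ ≤ radius n r j →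
    sParam w - sParam z - 2 * γ ≠ 0

/-- The integrand, including the factor `∏_j 1/z_j` of the measure `∏_j dz_j / (2πi z_j)`. -/
def contourIntegrand {n : ℕ} (γ : ℂ) (y : Fin n → ℤ) (t : ℝ) (Q : Equiv.Perm (Fin (2 * n)))
    (x : Sites (2 * n)) (a : Spins (2 * n)) (z : Fin (2 * n) → ℂ) : ℂ :=
  (∏ j : Fin (2 * n), (z j)⁻¹) *
    (Complex.exp (-Complex.I * energy γ z * t) * betheWave γ z Q x a *
      ∏ j : Fin n, (z (pairFst j) ^ (-y j) * z (pairSnd j) ^ (-y j)))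

/-- The `2n`-fold contour integral
`∮ dz^{2n} e^{-iE(z)t} φ(x;a|z) ∏_j z_{2j-1}^{-y_j} z_{2j}^{-y_j}`
with `∮ dz^{2n} = ∏_j ∮_{|z_j| = r^{2n-j}} dz_j / (2πi z_j)`. -/
def contourFormula {n : ℕ} (γ : ℂ) (r : ℝ) (y : Fin n → ℤ) (t : ℝ)
    (Q : Equiv.Perm (Fin (2 * n))) (x : Sites (2 * n)) (a : Spins (2 * n)) : ℂ :=
  ((2 * Real.pi * Complex.I) ^ (2 * n))⁻¹ *
    torusIntegral (contourIntegrand γ y t Q x a) 0 (radius n r)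

/-! ## The chain with dephasing, in second quantization -/

/-- Vectors of the fermionic Fock space over `ℤ`, by their components in the occupation number
basis (a basis vector is labelled by the finite set of occupied sites). -/
abbrev FockVector := Finset ℤ → ℂ

/-- Operators on Fock space, by their matrix elements `⟨S|A|T⟩`. -/
abbrev FockOp := Finset ℤ → Finset ℤ → ℂ

/-- Product of operators. -/
def FockOp.comp (A B : FockOp) : FockOp := fun S T => ∑' U, A S U * B U T

/-- Adjoint of an operator. -/
def FockOp.adj (A : FockOp) : FockOp := fun S T => conj (A T S)

/-- Action of an operator on a vector. -/
def FockOp.app (A : FockOp) (v : FockVector) : FockVector := fun S => ∑' U, A S U * v U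

/-- The annihilation operator `a_x`. -/
def annih (x : ℤ) : FockOp := fun S T =>
  if x ∈ T ∧ S = T.erase x then (-1) ^ (T.filter (fun u => u < x)).card else 0

/-- The creation operator `a_x†`. -/
def creat (x : ℤ) : FockOp := FockOp.adj (annih x)

/-- The number operator `n_x = a_x† a_x`. -/
def numOp (x : ℤ) : FockOp := FockOp.comp (creat x) (annih x)

/-- The tight-binding Hamiltonian `H = -∑_x (a_x† a_{x+1} + a_{x+1}† a_x)`. -/
def tightBinding : FockOp := fun S T =>
  -∑' x : ℤ, (FockOp.comp (creat x) (annih (x + 1)) S T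
    + FockOp.comp (creat (x + 1)) (annih x) S T)

/-- The Lindblad operator `L_x = √(4g) n_x`. -/
def lindbladOp (g : ℝ) (x : ℤ) : FockOp := fun S T => (Real.sqrt (4 * g) : ℂ) * numOp x S T

/-- The Liouvillian
`𝓛[ρ] = -i [H, ρ] + ∑_x (L_x ρ L_x† - ½ {L_x† L_x, ρ})`. -/
def liouvillian (g : ℝ) (ρ : FockOp) : FockOp := fun S T =>
  -Complex.I * (FockOp.comp tightBinding ρ S T - FockOp.comp ρ tightBinding S T)
    + ∑' x : ℤ,
      (FockOp.comp (FockOp.comp (lindbladOp g x) ρ) (FockOp.adj (lindbladOp g x)) S T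
        - 1 / 2 *
          (FockOp.comp (FockOp.comp (FockOp.adj (lindbladOp g x)) (lindbladOp g x)) ρ S T
            + FockOp.comp ρ (FockOp.comp (FockOp.adj (lindbladOp g x)) (lindbladOp g x)) S T))

/-- The vacuum. -/
def vacuum : FockVector := fun S => if S = ∅ then 1 else 0

/-- `a_{x_1}† ⋯ a_{x_m}† |0⟩` for a list of sites. -/
def ketList : List ℤ → FockVector
  | [] => vacuum
  | x :: l => FockOp.app (creat x) (ketList l)

/-- `|x⟩ = a_{x_1}† ⋯ a_{x_n}† |0⟩`. -/
def ket {n : ℕ} (x : Fin n → ℤ) : FockVector := ketList (List.ofFn x)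

/-- `⟨x| ρ |x'⟩`. -/
def matrixElement {n : ℕ} (ρ : FockOp) (x x' : Fin n → ℤ) : ℂ :=
  ∑' S, ∑' T, conj (ket x S) * ρ S T * ket x' T

/-- `ρ_t = e^{𝓛t}[|y⟩⟨y|]` for `t` in the time interval `J`: the matrix elements of `ρ` solve
the master equation `dρ/dt = 𝓛[ρ]` with `ρ_0 = |y⟩⟨y|`, and they are bounded, locally uniformly
in time (which holds for every locally bounded curve of trace class operators). -/
structure IsMasterSolution {n : ℕ} (g : ℝ) (y : Fin n → ℤ) (J : Set ℝ) (ρ : ℝ → FockOp) :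
    Prop where
  equation : ∀ t ∈ J, ∀ S T,
    HasDerivWithinAt (fun s => ρ s S T) (liouvillian g (ρ t) S T) J t
  initial : ∀ S T, ρ 0 S T = ket y S * conj (ket y T)
  bounded : ∀ τ : ℝ, ∃ C : ℝ, ∀ t ∈ J, |t| ≤ τ → ∀ S T, ‖ρ t S T‖ ≤ C

/-- The first `n` of `2n` positions. -/
def firstHalf {n : ℕ} (x : Sites (2 * n)) : Fin n → ℤ := fun j => x ⟨j.val, by omega⟩

/-- The last `n` of `2n` positions. -/
def secondHalf {n : ℕ} (x : Sites (2 * n)) : Fin n → ℤ := fun j => x ⟨n + j.val, by omega⟩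

/-- The spin labels `(↓, …, ↓, ↑, …, ↑)`, with `n` labels of each kind. -/
def halfDownHalfUp (n : ℕ) : Spins (2 * n) := fun i =>
  if i.val < n then Spin.down else Spin.up

end DephasingChain

end

/-!
The two parts of the theorem concern the same linear evolution, and each is solved by uniqueness:
the contour integral satisfies the equation and the initial condition, and there is at most one
bounded solution.

*The Bethe wave functions.* The recursion for the vectors `|zP⟩` is consistent because Yang
operators satisfy inversion, distant commutation and the Yang–Baxter equation: every way of removing
the descents of a permutation leads to the same vector (`ScatRel.unique`,
`existsUnique_scatteringFamily`). For `r < (4‖γ‖ + 4)⁻¹` the circles are so strongly nested that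
`‖s_j - s_k‖ > 2‖γ‖` for `j < k`, even for `z_j` anywhere in its punctured disc (`Nested`,
`polesOutside`); hence the amplitudes `1 / (s_j - s_k - 2γ)` are holomorphic in `z_j`. The wave
function does not depend on the sorting permutation (`betheWave_indep`). On sorted positions the
free Hamiltonian acts as on plane waves, except where it breaks the order; the contact condition
(`betheWave_contact`) turns these terms into the interaction, so that the wave function is an
eigenfunction with eigenvalue `E(z)` (`hubbardH_betheFn`).

*The initial condition* is the heart of the proof. Two mechanisms make a torus mean vanish: a
variable that enters only as a nonzero power, or Cauchy's theorem in a variable without a pole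
inside its circle. If the kernel `1 / (s_i - s_k - 2γ)` is multiplied by `z_i^e z_k^e`, then for
`e < 0` it may be replaced by a multiple with enough zeros at `z_i = 0`
(`torusMean_ker_eq_zero`). For two pairs the 24 permutations are the shuffles of the pairs
`{1, 2}` and `{3, 4}` with their internal orders; the singlet vector and one more vector span the
spin space that occurs, and a reversed pair contributes only a scalar (`betheWave_four`). If a
variable of the second pair overtakes one or both variables of the first, the amplitude is split
into partial fractions with respect to the overtaking variable. This creates poles `1 / (s_p - s_q)`
at coinciding inner variables, but their numerators vanish in the sum over the permutations
(`theta_null`, `theta_ker_null`, `crossSum_null`, `crossSum_ker_null`). What survives is the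
symmetrized monomial of the two pairs, whose mean is the initial state (`torusMean_betheWave`).

*Existence and uniqueness.* The integrand shows only that the contour integral grows at most
exponentially in the positions. Bounded solutions and the contour integral therefore are compared
in a weighted space on which the Hamiltonian is bounded (`evolution_unique`). A bounded solution
exists, as the exponential of a bounded generator on the bounded functions (`evolution_exists`), so
that the contour integral itself is bounded.

*The dephasing chain.* In the occupation number basis hopping on the chain produces no sign, and the
Liouvillian acts on the sector of `n` particles as the Hubbard Hamiltonian for `2n` particles, of
which the row positions carry spin `↓` and the column positions spin `↑`. A staggered sign
in the column positions accounts for the minus sign in the commutator (`liouvillian_apply`,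
`liouvillian_toFock_greenFn`). Uniqueness holds in this sector
(`IsMasterSolution.eq_greenFn`), and antisymmetry extends the formula to positions in any order
(`IsMasterSolution.matrixElement_eq`).
-/

noncomputable section

namespace DephasingChain

open Set Filter Topology MeasureTheory Equiv Metric

/-! ### Permutations and descents -/

/-- `∑_i i P(i)`, a measure of sortedness which grows whenever a descent of `P` is removed. -/
def permWeight {N : ℕ} (P : Perm (Fin N)) : ℕ := ∑ i, i.val * (P i).val

theorem permWeight_le {N : ℕ} (P : Perm (Fin N)) : permWeight P ≤ N * (N * N) := by
  calc permWeight P ≤ ∑ _i : Fin N, N * N :=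
        Finset.sum_le_sum fun i _ => Nat.mul_le_mul i.2.le (P i).2.le
    _ = N * (N * N) := by simp

theorem permWeight_lt_mul_swap {N : ℕ} (P : Perm (Fin N)) {j k : Fin N} (hjk : j < k)
    (h : P k < P j) : permWeight P < permWeight (P * swap j k) := by
  have hne : j ≠ k := hjk.ne
  have h1 : ∀ R : Perm (Fin N), permWeight R = j.val * (R j).val + k.val * (R k).val
      + ∑ i ∈ (Finset.univ.erase j).erase k, i.val * (R i).val := by
    intro R
    unfold permWeight
    rw [← Finset.add_sum_erase _ _ (Finset.mem_univ j),
      ← Finset.add_sum_erase (Finset.univ.erase j) _ (a := k) (by simp [hne.symm])]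
    ring
  rw [h1 P, h1 (P * swap j k)]
  have h2 : ∑ i ∈ (Finset.univ.erase j).erase k, i.val * ((P * swap j k) i).val
      = ∑ i ∈ (Finset.univ.erase j).erase k, i.val * (P i).val := by
    refine Finset.sum_congr rfl fun i hi => ?_
    simp only [Finset.mem_erase, Finset.mem_univ, and_true] at hi
    rw [Perm.mul_apply, swap_apply_of_ne_of_ne hi.2 hi.1]
  rw [h2]
  simp only [Perm.mul_apply, swap_apply_left, swap_apply_right]
  have h3 : j.val < k.val := hjk
  have h4 : (P k).val < (P j).val := h
  nlinarith

/-- A permutation without descents is the identity. -/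
theorem exists_descent {N : ℕ} {P : Perm (Fin N)} (hP : P ≠ 1) :
    ∃ j k : Fin N, j.val + 1 = k.val ∧ P k < P j := by
  by_contra hcon
  push Not at hcon
  apply hP
  have hmono : Monotone P := by
    rcases N with _ | N
    · intro i; exact i.elim0
    · refine Fin.monotone_iff_le_succ.2 fun i => hcon _ _ ?_
      simp
  have hs : StrictMono P := hmono.strictMono_of_injective P.injective
  let e : Fin N ≃o Fin N := hs.orderIsoOfSurjective P P.surjective
  ext i
  have h : e i = i := by rw [Subsingleton.elim e (OrderIso.refl _)]; rfl
  exact congrArg Fin.val h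

/-- Induction over a symmetric group by removing descents. -/
theorem perm_descent_induction {N : ℕ} {C : Perm (Fin N) → Prop}
    (step : ∀ P, (∀ j k : Fin N, j.val + 1 = k.val → P k < P j → C (P * swap j k)) → C P)
    (P : Perm (Fin N)) : C P := by
  suffices H : ∀ m, ∀ P : Perm (Fin N), N * (N * N) - permWeight P = m → C P from H _ P rfl
  intro m
  induction m using Nat.strong_induction_on with
  | _ m ih =>
    intro P hm
    refine step P fun j k hjk hd => ih _ ?_ _ rfl
    have h1 := permWeight_lt_mul_swap P (j := j) (k := k) (Fin.lt_def.2 (by omega)) hd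
    have h2 := permWeight_le (P * swap j k)
    omega

/-! ### The Yang operators -/

section Yang

variable {N : ℕ} {γ : ℂ}

theorem yang_inv {j k : Fin N} {l : ℂ} (h1 : l - 2 * γ ≠ 0) (h2 : -l - 2 * γ ≠ 0)
    (v : SpinVector N) : yang γ j k (-l) (yang γ j k l v) = v := by
  funext a
  have hs : (a ∘ swap j k) ∘ swap j k = a := by
    funext i; simp
  simp only [yang, hs]
  field_simp
  ring

theorem yang_comm {j k j' k' : Fin N} (h : Commute (swap j k) (swap j' k')) (l l' : ℂ)
    (v : SpinVector N) : yang γ j k l (yang γ j' k' l' v) = yang γ j' k' l' (yang γ j k l v) := by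
  funext a
  have hs : (a ∘ swap j k) ∘ swap j' k' = (a ∘ swap j' k') ∘ swap j k := by
    funext x
    exact congrArg a (congrArg (fun e : Perm (Fin N) => e x) h.eq)
  simp only [yang, hs]
  field_simp
  ring

/-- The Yang–Baxter equation. -/
theorem yang_baxter {i j k : Fin N} (hij : i ≠ j) (hjk : j ≠ k) (hik : i ≠ k) {l m : ℂ}
    (hl : l - 2 * γ ≠ 0) (hm : m - 2 * γ ≠ 0) (hlm : l + m - 2 * γ ≠ 0) (v : SpinVector N) :
    yang γ i j l (yang γ j k (l + m) (yang γ i j m v))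
      = yang γ j k m (yang γ i j (l + m) (yang γ j k l v)) := by
  funext a
  have hs : ∀ b : Spins N, (b ∘ swap i j) ∘ swap i j = b := fun b => by funext i; simp
  have hs' : ∀ b : Spins N, (b ∘ swap j k) ∘ swap j k = b := fun b => by funext i; simp
  have hb : ((a ∘ swap i j) ∘ swap j k) ∘ swap i j = ((a ∘ swap j k) ∘ swap i j) ∘ swap j k := by
    have h1 : swap i j * (swap j k * swap i j) = swap j k * (swap i j * swap j k) := by
      ext x
      simp only [Perm.mul_apply]
      rcases eq_or_ne x i with rfl | hxi
      · simp [swap_apply_of_ne_of_ne, hij, hik, hjk.symm, hik.symm]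
      rcases eq_or_ne x j with rfl | hxj
      · simp [swap_apply_of_ne_of_ne, hij, hik, hjk.symm, hik.symm]
      rcases eq_or_ne x k with rfl | hxk
      · simp [swap_apply_of_ne_of_ne, hij, hik, hjk.symm, hik.symm]
      simp [swap_apply_of_ne_of_ne, hxi, hxj, hxk]
    funext x
    exact congrArg a (congrArg (fun e : Perm (Fin N) => e x) h1)
  simp only [yang, hs, hs', hb]
  field_simp
  ring

end Yang

/-! ### The scattering family -/

/-- `ScatRel γ s b P v`: the vector `v` arises at `P` from `b` at the identity by Yang operators
along some way that only creates inversions. -/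
inductive ScatRel {N : ℕ} (γ : ℂ) (s : Fin N → ℂ) (b : SpinVector N) :
    Perm (Fin N) → SpinVector N → Prop where
  | one : ScatRel γ s b 1 b
  | step {P : Perm (Fin N)} {v : SpinVector N} (j k : Fin N) : ScatRel γ s b P v →
      j.val + 1 = k.val → P j < P k →
      ScatRel γ s b (P * swap j k) (yang γ j k (s (P j) - s (P k)) v)

section Scattering

variable {N : ℕ} {γ : ℂ} {s : Fin N → ℂ} {b : SpinVector N}

theorem ScatRel.step_descent {P : Perm (Fin N)} {v : SpinVector N} {j k : Fin N}
    (hjk : j.val + 1 = k.val) (hd : P k < P j) (h : ScatRel γ s b (P * swap j k) v) :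
    ScatRel γ s b P (yang γ j k (s (P k) - s (P j)) v) := by
  have := h.step j k hjk (by simpa using hd)
  simpa [mul_assoc] using this

theorem ScatRel.exists (γ : ℂ) (s : Fin N → ℂ) (b : SpinVector N) (P : Perm (Fin N)) :
    ∃ v, ScatRel γ s b P v := by
  induction P using perm_descent_induction with
  | step P ih =>
    rcases eq_or_ne P 1 with rfl | hP
    · exact ⟨b, .one⟩
    · obtain ⟨j, k, hjk, hd⟩ := exists_descent hP
      obtain ⟨v, hv⟩ := ih j k hjk hd
      exact ⟨_, hv.step_descent hjk hd⟩

theorem ScatRel.cases' {P : Perm (Fin N)} {v : SpinVector N} (h : ScatRel γ s b P v) :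
    (P = 1 ∧ v = b) ∨ ∃ (j k : Fin N) (u : SpinVector N), j.val + 1 = k.val ∧ P k < P j ∧
      ScatRel γ s b (P * swap j k) u ∧ v = yang γ j k (s (P k) - s (P j)) u := by
  cases h with
  | one => exact .inl ⟨rfl, rfl⟩
  | step j k h hjk hd => exact .inr ⟨j, k, _, hjk, by simpa using hd, by simpa [mul_assoc] using h,
      by simp⟩

/-- The diamond lemma: all ways that only create inversions lead to the same vector, by the
commutation of distant Yang operators and the Yang–Baxter equation. -/
theorem ScatRel.unique (hs : ∀ i j, i ≠ j → s i - s j ≠ 2 * γ) (P : Perm (Fin N)) :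
    ∀ u v, ScatRel γ s b P u → ScatRel γ s b P v → u = v := by
  induction P using perm_descent_induction with
  | step P ih =>
  intro u v hu hv
  rcases hu.cases' with ⟨rfl, rfl⟩ | ⟨j, k, u', hjk, hd, hu', rfl⟩
  · rcases hv.cases' with ⟨-, rfl⟩ | ⟨j, k, v', hjk, hd, -, -⟩
    · rfl
    · simp only [Perm.one_apply, Fin.lt_def] at hd; omega
  rcases hv.cases' with ⟨rfl, rfl⟩ | ⟨j', k', v', hjk', hd', hv', rfl⟩
  · simp only [Perm.one_apply, Fin.lt_def] at hd; omega
  -- two descents at distance one, in this order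
  have key : ∀ (i j k : Fin N) (u v : SpinVector N), i.val + 1 = j.val → j.val + 1 = k.val →
      P j < P i → P k < P j → ScatRel γ s b (P * swap i j) u → ScatRel γ s b (P * swap j k) v →
      yang γ i j (s (P j) - s (P i)) u = yang γ j k (s (P k) - s (P j)) v := by
    intro i j k u v hij hjk hd1 hd2 hu hv
    have nij : i ≠ j := by rintro rfl; omega
    have njk : j ≠ k := by rintro rfl; omega
    have nik : i ≠ k := by rintro rfl; omega
    obtain ⟨w, hw⟩ := ScatRel.exists γ s b (P * swap i j * swap j k * swap i j)
    have e1 : (swap i j) k = k := swap_apply_of_ne_of_ne nik.symm njk.symm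
    have e2 : (swap j k) i = i := swap_apply_of_ne_of_ne nij nik
    have hb : P * swap i j * swap j k * swap i j = P * swap j k * swap i j * swap j k := by
      ext x
      simp only [Perm.mul_apply]
      rcases eq_or_ne x i with rfl | hxi
      · simp [e1, e2]
      rcases eq_or_ne x j with rfl | hxj
      · simp [e1, e2]
      rcases eq_or_ne x k with rfl | hxk
      · simp [e1, e2]
      simp [swap_apply_of_ne_of_ne, hxi, hxj, hxk]
    have hw1 : ScatRel γ s b (P * swap i j * swap j k)
        (yang γ i j (s (P k) - s (P j)) w) := by
      have := ScatRel.step_descent (P := P * swap i j * swap j k) hij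
        (by simpa [e1, e2] using hd2) hw
      simpa [e1, e2] using this
    have hw2 : ScatRel γ s b (P * swap i j)
        (yang γ j k (s (P k) - s (P i)) (yang γ i j (s (P k) - s (P j)) w)) := by
      have := ScatRel.step_descent (P := P * swap i j) hjk
        (by simpa [e1, e2] using hd2.trans hd1) hw1
      simpa [e1, e2] using this
    rw [hb] at hw
    have hw3 : ScatRel γ s b (P * swap j k * swap i j)
        (yang γ j k (s (P j) - s (P i)) w) := by
      have := ScatRel.step_descent (P := P * swap j k * swap i j) hjk
        (by simpa [e1, e2] using hd1) hw
      simpa [e1, e2] using this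
    have hw4 : ScatRel γ s b (P * swap j k)
        (yang γ i j (s (P k) - s (P i)) (yang γ j k (s (P j) - s (P i)) w)) := by
      have := ScatRel.step_descent (P := P * swap j k) hij
        (by simpa [e1, e2] using hd2.trans hd1) hw3
      simpa [e1, e2] using this
    rw [ih i j hij hd1 _ _ hu hw2, ih j k hjk hd2 _ _ hv hw4]
    have h0 : s (P k) - s (P i) = (s (P j) - s (P i)) + (s (P k) - s (P j)) := by ring
    have inj : ∀ {x y : Fin N}, x ≠ y → P x ≠ P y := fun h h' => h (P.injective h')
    rw [h0]
    refine yang_baxter nij njk nik (sub_ne_zero.2 (hs _ _ (inj nij.symm)))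
      (sub_ne_zero.2 (hs _ _ (inj njk.symm))) ?_ w
    rw [← h0]
    exact sub_ne_zero.2 (hs _ _ (inj nik.symm))
  have far : ∀ (j k j' k' : Fin N) (u v : SpinVector N), j.val + 1 = k.val →
      j'.val + 1 = k'.val → k.val < j'.val → P k < P j → P k' < P j' →
      ScatRel γ s b (P * swap j k) u → ScatRel γ s b (P * swap j' k') v →
      yang γ j k (s (P k) - s (P j)) u = yang γ j' k' (s (P k') - s (P j')) v := by
    intro j k j' k' u v hjk hjk' hfar hd hd' hu hv
    have n1 : j ≠ j' := by rintro rfl; omega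
    have n2 : j ≠ k' := by rintro rfl; omega
    have n3 : k ≠ j' := by rintro rfl; omega
    have n4 : k ≠ k' := by rintro rfl; omega
    have n5 : j ≠ k := by rintro rfl; omega
    have n6 : j' ≠ k' := by rintro rfl; omega
    have hc : Commute (swap j k) (swap j' k') :=
      (Perm.disjoint_swap_swap (by simp [n1, n2, n3, n4, n5, n6])).commute
    obtain ⟨w, hw⟩ := ScatRel.exists γ s b (P * swap j k * swap j' k')
    have e1 : swap j k j' = j' := swap_apply_of_ne_of_ne n1.symm n3.symm
    have e2 : swap j k k' = k' := swap_apply_of_ne_of_ne n2.symm n4.symm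
    have e3 : swap j' k' j = j := swap_apply_of_ne_of_ne n1 n2
    have e4 : swap j' k' k = k := swap_apply_of_ne_of_ne n3 n4
    have h1 : ScatRel γ s b (P * swap j k) (yang γ j' k' (s (P k') - s (P j')) w) := by
      have := ScatRel.step_descent (P := P * swap j k) hjk' (by simpa [e1, e2] using hd') hw
      simpa [e1, e2] using this
    have h2 : ScatRel γ s b (P * swap j' k') (yang γ j k (s (P k) - s (P j)) w) := by
      rw [mul_assoc, hc.eq, ← mul_assoc] at hw
      have := ScatRel.step_descent (P := P * swap j' k') hjk (by simpa [e3, e4] using hd) hw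
      simpa [e3, e4] using this
    rw [ih j k hjk hd _ _ hu h1, ih j' k' hjk' hd' _ _ hv h2]
    exact yang_comm hc _ _ w
  rcases lt_trichotomy j.val j'.val with hlt | heq | hgt
  · rcases Nat.lt_or_ge k.val j'.val with hfar | hnear
    · exact far j k j' k' u' v' hjk hjk' hfar hd hd' hu' hv'
    · obtain rfl : k = j' := Fin.ext (by omega)
      exact key j k k' u' v' hjk hjk' hd hd' hu' hv'
  · obtain rfl : j = j' := Fin.ext heq
    obtain rfl : k = k' := Fin.ext (by omega)
    rw [ih j k hjk hd _ _ hu' hv']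
  · rcases Nat.lt_or_ge k'.val j.val with hfar | hnear
    · exact (far j' k' j k v' u' hjk' hjk hfar hd' hd hv' hu').symm
    · obtain rfl : k' = j := Fin.ext (by omega)
      exact (key j' k' k v' u' hjk' hjk hd' hd hv' hu').symm

end Scattering

/-- The rapidity differences avoid the singularities of the Yang operators. -/
def Admissible {N : ℕ} (γ : ℂ) (z : Fin N → ℂ) : Prop :=
  ∀ i j, i ≠ j → sParam (z i) - sParam (z j) ≠ 2 * γ

theorem Admissible.ne_zero {N : ℕ} {γ : ℂ} {z : Fin N → ℂ} (hz : Admissible γ z) {i j : Fin N}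
    (hij : i ≠ j) : sParam (z i) - sParam (z j) - 2 * γ ≠ 0 := sub_ne_zero.2 (hz i j hij)

theorem existsUnique_scatteringFamily {n : ℕ} {γ : ℂ} {z : Fin (2 * n) → ℂ}
    (hz : Admissible γ z) : ∃! A, IsScatteringFamily γ z A := by
  choose A hA using ScatRel.exists γ (fun i => sParam (z i)) (singletVector n)
  have hdesc : ∀ (P : Perm (Fin (2 * n))) (j k : Fin (2 * n)), j.val + 1 = k.val → P j < P k →
      A (P * swap j k) = yang γ j k (sParam (z (P j)) - sParam (z (P k))) (A P) :=
    fun P j k hjk hlt => ScatRel.unique hz _ _ _ (hA _) ((hA P).step j k hjk hlt)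
  refine ⟨A, ⟨ScatRel.unique hz _ _ _ (hA 1) .one, fun P j k hjk => ?_⟩, fun B hB => ?_⟩
  · have hne : j ≠ k := by rintro rfl; omega
    have hP : P j ≠ P k := fun h => hne (P.injective h)
    rcases lt_or_gt_of_ne hP with hlt | hgt
    · exact hdesc P j k hjk hlt
    · have h := hdesc (P * swap j k) j k hjk (by simpa using hgt)
      simp only [mul_assoc, swap_mul_self, mul_one, Perm.mul_apply, swap_apply_left,
        swap_apply_right] at h
      rw [h, ← neg_sub (sParam (z (P k))), yang_inv (hz.ne_zero hP.symm)]
      rw [neg_sub]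
      exact hz.ne_zero hP
  · funext P
    induction P using perm_descent_induction with
    | step P ih =>
      rcases eq_or_ne P 1 with rfl | hP
      · rw [hB.base]
        exact ScatRel.unique hz _ _ _ .one (hA 1)
      · obtain ⟨j, k, hjk, hd⟩ := exists_descent hP
        have h1 := hB.step (P * swap j k) j k hjk
        have h2 := hdesc (P * swap j k) j k hjk (by simpa using hd)
        rw [mul_assoc, swap_mul_self, mul_one] at h1 h2
        rw [h1, h2, ih j k hjk hd]

theorem scattering_isScatteringFamily {n : ℕ} {γ : ℂ} {z : Fin (2 * n) → ℂ}
    (hz : Admissible γ z) : IsScatteringFamily γ z (scattering γ z) :=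
  Classical.epsilon_spec (existsUnique_scatteringFamily hz).exists

/-! ### The Bethe wave function -/

theorem csign_mul {N : ℕ} (P Q : Perm (Fin N)) : csign (P * Q) = csign P * csign Q := by
  simp [csign]

theorem csign_mul_self {N : ℕ} (P : Perm (Fin N)) : csign P * csign P = 1 := by
  rcases Int.units_eq_one_or (Perm.sign P) with h | h <;> simp [csign, h]

theorem csign_swap {N : ℕ} {j k : Fin N} (h : j ≠ k) : csign (swap j k) = -1 := by
  simp [csign, Perm.sign_swap h]

theorem csign_one {N : ℕ} : csign (1 : Perm (Fin N)) = 1 := by simp [csign]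

/-- A sum over a symmetric group vanishes if the terms cancel in pairs `P`, `P Π`. -/
theorem sum_perm_eq_zero {N : ℕ} (s : Perm (Fin N)) (f : Perm (Fin N) → ℂ)
    (h : ∀ P, f P + f (P * s) = 0) : ∑ P, f P = 0 := by
  have h1 : ∑ P, f (P * s) = ∑ P, f P := Equiv.sum_comp (Equiv.mulRight s) f
  have h2 : ∑ P, (f P + f (P * s)) = 0 := Finset.sum_eq_zero fun P _ => h P
  rw [Finset.sum_add_distrib, h1] at h2
  linear_combination h2 / 2

/-- The product of plane waves that belongs to `P`. -/
def planeWave {N : ℕ} (z : Fin N → ℂ) (P : Perm (Fin N)) (x : Sites N) : ℂ :=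
  ∏ j, z (P j) ^ x j

theorem planeWave_add_single {N : ℕ} {z : Fin N → ℂ} (h0 : ∀ j, z j ≠ 0) (P : Perm (Fin N))
    (x : Sites N) (j : Fin N) (m : ℤ) :
    planeWave z P (x + Pi.single j m) = z (P j) ^ m * planeWave z P x := by
  simp only [planeWave, Pi.add_apply]
  rw [← Finset.mul_prod_erase _ _ (Finset.mem_univ j),
    ← Finset.mul_prod_erase Finset.univ (fun i => z (P i) ^ x i) (Finset.mem_univ j)]
  rw [Pi.single_eq_same, zpow_add₀ (h0 _)]
  have : ∏ i ∈ Finset.univ.erase j, z (P i) ^ (x i + (Pi.single j m : Fin N → ℤ) i)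
      = ∏ i ∈ Finset.univ.erase j, z (P i) ^ x i := by
    refine Finset.prod_congr rfl fun i hi => ?_
    rw [Pi.single_eq_of_ne (Finset.ne_of_mem_erase hi), add_zero]
  rw [this]
  ring

theorem planeWave_sub_single {N : ℕ} {z : Fin N → ℂ} (h0 : ∀ j, z j ≠ 0) (P : Perm (Fin N))
    (x : Sites N) (j : Fin N) :
    planeWave z P (x - Pi.single j 1) = (z (P j))⁻¹ * planeWave z P x := by
  have : x - Pi.single j 1 = x + Pi.single j (-1) := by
    rw [Pi.single_neg, sub_eq_add_neg]
  rw [this, planeWave_add_single h0, zpow_neg_one]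

theorem planeWave_mul {N : ℕ} (z : Fin N → ℂ) (P σ : Perm (Fin N)) (x : Sites N) :
    planeWave z (P * σ) (x ∘ σ) = planeWave z P x := by
  simp only [planeWave, Perm.mul_apply, Function.comp_apply]
  exact Equiv.prod_comp σ (fun i => z (P i) ^ x i)

theorem comp_swap_of_eq {N : ℕ} {α : Type*} {x : Fin N → α} {j k : Fin N} (h : x j = x k) :
    x ∘ swap j k = x := by
  funext i
  rcases eq_or_ne i j with rfl | hj
  · simp [h]
  rcases eq_or_ne i k with rfl | hk
  · simp [h]
  simp [swap_apply_of_ne_of_ne hj hk]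

section Bethe

variable {n : ℕ} {γ : ℂ} {z : Fin (2 * n) → ℂ}

theorem betheWave_comp (Q σ : Perm (Fin (2 * n))) (x : Sites (2 * n)) (a : Spins (2 * n)) :
    betheWave γ z Q (x ∘ σ) (a ∘ σ) = csign σ * betheWave γ z (σ * Q) x a := by
  simp only [betheWave, Finset.mul_sum, csign_mul, Function.comp_apply, Perm.mul_apply]
  refine Finset.sum_congr rfl fun P _ => ?_
  have : (a ∘ σ) ∘ Q = a ∘ (σ * Q : Perm (Fin (2 * n))) := by funext i; rfl
  rw [this]
  linear_combination (-(csign P * csign Q * scattering γ z P (a ∘ (σ * Q : Perm (Fin (2 * n)))) *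
    ∏ j, z (P j) ^ x (σ (Q j)))) * csign_mul_self σ

theorem betheWave_one_comp (Q : Perm (Fin (2 * n))) (x : Sites (2 * n)) (a : Spins (2 * n)) :
    betheWave γ z Q x a = csign Q * betheWave γ z 1 (x ∘ Q) (a ∘ Q) := by
  rw [betheWave_comp, mul_one, ← mul_assoc, csign_mul_self, one_mul]

theorem betheWave_one (x : Sites (2 * n)) (a : Spins (2 * n)) :
    betheWave γ z 1 x a = ∑ P, csign P * scattering γ z P a * planeWave z P x := by
  simp [betheWave, planeWave]

variable (hz : Admissible γ z)
include hz

theorem scattering_mul_swap (P : Perm (Fin (2 * n))) {j k : Fin (2 * n)}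
    (hjk : j.val + 1 = k.val) (a : Spins (2 * n)) :
    scattering γ z (P * swap j k) a =
      ((sParam (z (P j)) - sParam (z (P k))) * scattering γ z P (a ∘ swap j k)
        - 2 * γ * scattering γ z P a) / (sParam (z (P j)) - sParam (z (P k)) - 2 * γ) := by
  rw [(scattering_isScatteringFamily hz).step P j k hjk]
  rfl

/-- Two choices of the sorting permutation that differ by an adjacent transposition within a tie
give the same value. -/
theorem betheWave_mul_swap_of_tie (Q : Perm (Fin (2 * n))) (x : Sites (2 * n))
    (a : Spins (2 * n)) {j k : Fin (2 * n)} (hjk : j.val + 1 = k.val) (h : x (Q j) = x (Q k)) :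
    betheWave γ z (Q * swap j k) x a = betheWave γ z Q x a := by
  have hne : j ≠ k := by rintro rfl; omega
  have hx : (x ∘ Q) ∘ swap j k = x ∘ Q := comp_swap_of_eq h
  rw [betheWave_one_comp, betheWave_one_comp Q, csign_mul, csign_swap hne]
  have e1 : x ∘ (Q * swap j k : Perm (Fin (2 * n))) = x ∘ Q := hx
  have e2 : a ∘ (Q * swap j k : Perm (Fin (2 * n))) = (a ∘ Q) ∘ swap j k := rfl
  rw [e1, e2, betheWave_one, betheWave_one, ← sub_eq_zero]
  generalize a ∘ Q = b
  suffices H : ∑ P, (csign P * (scattering γ z P b + scattering γ z P (b ∘ swap j k))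
      * planeWave z P (x ∘ Q)) = 0 by
    simp only [mul_add, add_mul, Finset.sum_add_distrib] at H
    linear_combination (-csign Q) * H
  refine sum_perm_eq_zero (swap j k) _ fun P => ?_
  have hpw : planeWave z (P * swap j k) (x ∘ Q) = planeWave z P (x ∘ Q) := by
    conv_lhs => rw [← hx]
    rw [planeWave_mul]
  have hb : (b ∘ swap j k) ∘ swap j k = b := by funext i; simp
  rw [hpw, scattering_mul_swap hz P hjk, scattering_mul_swap hz P hjk, hb, csign_mul,
    csign_swap hne]
  have hd := hz.ne_zero (fun h => hne (P.injective h))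
  field_simp
  ring

theorem betheWave_mul_of_stabilizer (Q : Perm (Fin (2 * n))) (x : Sites (2 * n))
    (a : Spins (2 * n)) (hQ : Monotone (x ∘ Q)) (σ : Perm (Fin (2 * n)))
    (hσ : ∀ i, x (Q (σ i)) = x (Q i)) :
    betheWave γ z (Q * σ) x a = betheWave γ z Q x a := by
  induction σ using perm_descent_induction with
  | step σ ih =>
    rcases eq_or_ne σ 1 with rfl | h1
    · rw [mul_one]
    obtain ⟨j, k, hjk, hd⟩ := exists_descent h1
    have htie : x (Q j) = x (Q k) := by
      refine le_antisymm (hQ (Fin.le_def.2 (by omega))) ?_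
      rw [← hσ j, ← hσ k]
      exact hQ hd.le
    rw [← ih j k hjk hd, ← mul_assoc, betheWave_mul_swap_of_tie hz _ _ _ hjk]
    · simpa [hσ] using htie
    · intro i
      rw [Perm.mul_apply, hσ]
      exact congrFun (comp_swap_of_eq (x := x ∘ Q) htie) i

/-- The Bethe wave function does not depend on the choice of the sorting permutation. -/
theorem betheWave_indep {Q Q' : Perm (Fin (2 * n))} {x : Sites (2 * n)} (a : Spins (2 * n))
    (hQ : Monotone (x ∘ Q)) (hQ' : Monotone (x ∘ Q')) :
    betheWave γ z Q' x a = betheWave γ z Q x a := by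
  have h := Tuple.unique_monotone hQ hQ'
  have := betheWave_mul_of_stabilizer hz Q x a hQ (Q⁻¹ * Q') fun i => by
    simpa using (congrFun h i).symm
  simpa using this

/-- Contact condition: at `x_j = x_{j+1}` the free continuation of the Bethe wave function from
the sorted sector compensates the interaction. -/
theorem betheWave_contact (h0 : ∀ j, z j ≠ 0) (x : Sites (2 * n)) (a : Spins (2 * n))
    {j k : Fin (2 * n)} (hjk : j.val + 1 = k.val) (hx : x j = x k) :
    betheWave γ z 1 (x + Pi.single k 1) (a ∘ swap j k) + betheWave γ z 1 (x + Pi.single j 1) a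
      + betheWave γ z 1 (x - Pi.single j 1) (a ∘ swap j k)
      + betheWave γ z 1 (x - Pi.single k 1) a
      = -(4 * Complex.I * γ * betheWave γ z 1 x a) := by
  have hne : j ≠ k := by rintro rfl; omega
  simp only [betheWave_one, planeWave_add_single h0, planeWave_sub_single h0]
  rw [← sub_eq_zero, sub_neg_eq_add, Finset.mul_sum, ← Finset.sum_add_distrib,
    ← Finset.sum_add_distrib, ← Finset.sum_add_distrib, ← Finset.sum_add_distrib]
  refine sum_perm_eq_zero (swap j k) _ fun P => ?_
  have hpw : planeWave z (P * swap j k) x = planeWave z P x := by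
    conv_lhs => rw [← comp_swap_of_eq hx]
    rw [planeWave_mul]
  have hb : (a ∘ swap j k) ∘ swap j k = a := by funext i; simp
  rw [hpw, scattering_mul_swap hz P hjk, scattering_mul_swap hz P hjk, hb, csign_mul,
    csign_swap hne]
  have hd := hz.ne_zero (fun h => hne (P.injective h))
  have hu := h0 (P j)
  have hv := h0 (P k)
  simp only [Perm.mul_apply, swap_apply_left, swap_apply_right, zpow_one]
  generalize hD : sParam (z (P j)) - sParam (z (P k)) = l at hd
  have hl : z (P j) - (z (P j))⁻¹ - (z (P k) - (z (P k))⁻¹) = 2 * Complex.I * l := by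
    rw [← hD, sParam, sParam]
    field_simp
  generalize z (P j) = u at *
  generalize z (P k) = v at *
  generalize scattering γ z P a = A
  generalize scattering γ z P (a ∘ swap j k) = B
  generalize planeWave z P x = M
  generalize csign P = c
  have key : ((v + u⁻¹) * B + (u + v⁻¹ + 4 * Complex.I * γ) * A) * (l - 2 * γ)
      = (u + v⁻¹) * (l * A - 2 * γ * B) + (v + u⁻¹ + 4 * Complex.I * γ) * (l * B - 2 * γ * A) := by
    linear_combination 2 * γ * (B - A) * hl
  have key' : (v + u⁻¹) * B + (u + v⁻¹ + 4 * Complex.I * γ) * A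
      = (u + v⁻¹) * ((l * A - 2 * γ * B) / (l - 2 * γ))
        + (v + u⁻¹ + 4 * Complex.I * γ) * ((l * B - 2 * γ * A) / (l - 2 * γ)) := by
    rw [← mul_div_assoc, ← mul_div_assoc, ← add_div, ← key, mul_div_assoc, div_self hd, mul_one]
  linear_combination c * M * key'

end Bethe

/-! ### The eigenvalue equation -/

/-- Total antisymmetry under simultaneous permutations of positions and spins. -/
def Antisymm {N : ℕ} (f : Wave N) : Prop :=
  ∀ (σ : Perm (Fin N)) (x : Sites N) (a : Spins N), f (x ∘ σ) (a ∘ σ) = csign σ * f x a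

theorem Antisymm.eq_zero {N : ℕ} {f : Wave N} (hf : Antisymm f) {x : Sites N} {a : Spins N}
    {i j : Fin N} (hij : i ≠ j) (hx : x i = x j) (ha : a i = a j) : f x a = 0 := by
  have h := hf (swap i j) x a
  rw [comp_swap_of_eq hx, comp_swap_of_eq ha, csign_swap hij] at h
  linear_combination h / 2

/-- There are only two spin labels, so at most two particles share a site. -/
theorem Antisymm.eq_zero_of_triple {N : ℕ} {f : Wave N} (hf : Antisymm f) {x : Sites N}
    (a : Spins N) {i j k : Fin N} (hij : i ≠ j) (hjk : j ≠ k) (hik : i ≠ k) (h1 : x i = x j)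
    (h2 : x j = x k) : f x a = 0 := by
  by_cases e1 : a i = a j
  · exact hf.eq_zero hij h1 e1
  by_cases e2 : a j = a k
  · exact hf.eq_zero hjk h2 e2
  refine hf.eq_zero hik (h1.trans h2) ?_
  generalize a i = p at *
  generalize a j = q at *
  generalize a k = r at *
  cases p <;> cases q <;> cases r <;> simp_all

theorem two_mul_sum_lt {N : ℕ} (x : Sites N) :
    2 * (∑ j : Fin N, ∑ k : Fin N, if j < k ∧ x j = x k then (1 : ℂ) else 0)
      = ∑ j : Fin N, ∑ k : Fin N, if j ≠ k ∧ x j = x k then (1 : ℂ) else 0 := by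
  have h1 : (∑ j : Fin N, ∑ k : Fin N, if j < k ∧ x j = x k then (1 : ℂ) else 0)
      = ∑ j : Fin N, ∑ k : Fin N, if k < j ∧ x j = x k then (1 : ℂ) else 0 := by
    rw [Finset.sum_comm]
    simp only [eq_comm]
  rw [two_mul]
  nth_rewrite 2 [h1]
  rw [← Finset.sum_add_distrib]
  refine Finset.sum_congr rfl fun j _ => ?_
  rw [← Finset.sum_add_distrib]
  refine Finset.sum_congr rfl fun k _ => ?_
  by_cases hx : x j = x k
  · rcases lt_trichotomy j k with h | h | h
    · simp [hx, h, h.ne, h.not_gt]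
    · simp [h]
    · simp [hx, h, h.ne', h.not_gt]
  · simp [hx]

theorem sum_lt_comp {N : ℕ} (x : Sites N) (σ : Perm (Fin N)) :
    (∑ j : Fin N, ∑ k : Fin N, if j < k ∧ (x ∘ σ) j = (x ∘ σ) k then (1 : ℂ) else 0)
      = ∑ j : Fin N, ∑ k : Fin N, if j < k ∧ x j = x k then (1 : ℂ) else 0 := by
  have h : (∑ j : Fin N, ∑ k : Fin N, if j ≠ k ∧ (x ∘ σ) j = (x ∘ σ) k then (1 : ℂ) else 0)
      = ∑ j : Fin N, ∑ k : Fin N, if j ≠ k ∧ x j = x k then (1 : ℂ) else 0 := by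
    refine Eq.trans ?_ (Equiv.sum_comp σ fun j =>
      ∑ k : Fin N, if j ≠ k ∧ x j = x k then (1 : ℂ) else 0)
    refine Finset.sum_congr rfl fun j _ => ?_
    refine Eq.trans ?_ (Equiv.sum_comp σ fun k =>
      if σ j ≠ k ∧ x (σ j) = x k then (1 : ℂ) else 0)
    simp
  rw [← two_mul_sum_lt, ← two_mul_sum_lt] at h
  exact mul_left_cancel₀ two_ne_zero h

theorem comp_add_single {N : ℕ} (x : Sites N) (σ : Perm (Fin N)) (j : Fin N) (m : ℤ) :
    x ∘ σ + Pi.single j m = (x + Pi.single (σ j) m) ∘ σ := by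
  funext i
  simp [Pi.single_apply]

theorem comp_sub_single {N : ℕ} (x : Sites N) (σ : Perm (Fin N)) (j : Fin N) (m : ℤ) :
    x ∘ σ - Pi.single j m = (x - Pi.single (σ j) m) ∘ σ := by
  funext i
  simp [Pi.single_apply]

theorem Antisymm.hubbardH {n : ℕ} {γ : ℂ} {f : Wave (2 * n)} (hf : Antisymm f) :
    Antisymm (hubbardH n γ f) := by
  intro σ x a
  have h1 : ∑ j, (f (x ∘ σ + Pi.single j 1) (a ∘ σ) + f (x ∘ σ - Pi.single j 1) (a ∘ σ))
      = csign σ * ∑ j, (f (x + Pi.single j 1) a + f (x - Pi.single j 1) a) := by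
    refine Eq.trans ?_ (congrArg (csign σ * ·) (Equiv.sum_comp σ fun j =>
      f (x + Pi.single j 1) a + f (x - Pi.single j 1) a))
    simp only [Finset.mul_sum]
    refine Finset.sum_congr rfl fun j _ => ?_
    rw [comp_add_single, comp_sub_single, hf, hf, mul_add]
  simp only [DephasingChain.hubbardH]
  rw [h1, sum_lt_comp, hf]
  ring

section Eigen

variable {n : ℕ} {γ : ℂ} {z : Fin (2 * n) → ℂ}

/-- The Bethe wave function with a definite choice of the sorting permutation. -/
def betheFn (γ : ℂ) (z : Fin (2 * n) → ℂ) : Wave (2 * n) := fun x a =>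
  betheWave γ z (Tuple.sort x) x a

theorem betheFn_eq (hz : Admissible γ z) {Q : Perm (Fin (2 * n))} {x : Sites (2 * n)}
    (a : Spins (2 * n)) (hQ : Monotone (x ∘ Q)) : betheFn γ z x a = betheWave γ z Q x a :=
  betheWave_indep hz a hQ (Tuple.monotone_sort x)

theorem antisymm_betheFn (hz : Admissible γ z) : Antisymm (betheFn γ z) := by
  intro σ x a
  rw [betheFn, betheWave_comp, betheFn_eq hz (Q := σ * Tuple.sort (x ∘ σ)) a]
  exact Tuple.monotone_sort (x ∘ σ)

theorem free_eigen (h0 : ∀ j, z j ≠ 0) (x : Sites (2 * n)) (a : Spins (2 * n)) :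
    ∑ j, (betheWave γ z 1 (x + Pi.single j 1) a + betheWave γ z 1 (x - Pi.single j 1) a)
      = (∑ j, (z j + 1 / z j)) * betheWave γ z 1 x a := by
  simp only [betheWave_one, planeWave_add_single h0, planeWave_sub_single h0, Finset.mul_sum,
    ← Finset.sum_add_distrib]
  rw [Finset.sum_comm]
  refine Finset.sum_congr rfl fun P _ => ?_
  rw [← Equiv.sum_comp P (fun j => z j + 1 / z j), Finset.sum_mul]
  refine Finset.sum_congr rfl fun j _ => ?_
  rw [zpow_one, one_div]
  ring

theorem monotone_add_single {N : ℕ} {x : Sites N} (hx : Monotone x) (j : Fin N)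
    (h : ∀ k, j < k → x j < x k) : Monotone (x + Pi.single j 1) := by
  intro i k hik
  rcases hik.eq_or_lt with rfl | hlt
  · rfl
  have := hx hik
  simp only [Pi.add_apply, Pi.single_apply]
  split_ifs with h1 h2 h2
  · omega
  · subst h1
    have := h k hlt
    omega
  · omega
  · omega

theorem monotone_sub_single {N : ℕ} {x : Sites N} (hx : Monotone x) (j : Fin N)
    (h : ∀ k, k < j → x k < x j) : Monotone (x - Pi.single j 1) := by
  intro i k hik
  rcases hik.eq_or_lt with rfl | hlt
  · rfl
  have := hx hik
  simp only [Pi.sub_apply, Pi.single_apply]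
  split_ifs with h1 h2 h2
  · omega
  · omega
  · subst h2
    have := h i hlt
    omega
  · omega

theorem sum_pair_ite {N : ℕ} (j k : Fin N) (hjk : j.val + 1 = k.val) (x : Sites N)
    (hx : x j = x k) (f : Fin N → ℂ) :
    (∑ l, if j.val + 1 = l.val ∧ x j = x l then f l else 0) = f k := by
  rw [Finset.sum_eq_single k]
  · simp [hjk, hx]
  · intro l _ hl
    rw [if_neg]
    rintro ⟨h1, -⟩
    exact hl (Fin.ext (by omega))
  · simp

theorem sum_pair_ite' {N : ℕ} (j k : Fin N) (hjk : j.val + 1 = k.val) (x : Sites N)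
    (hx : x j = x k) (f : Fin N → ℂ) :
    (∑ l : Fin N, if l.val + 1 = k.val ∧ x l = x k then f l else 0) = f j := by
  rw [Finset.sum_eq_single j]
  · simp [hjk, hx]
  · intro l _ hl
    rw [if_neg]
    rintro ⟨h1, -⟩
    exact hl (Fin.ext (by omega))
  · simp

theorem betheFn_add_single (hz : Admissible γ z) {x : Sites (2 * n)} (hx : Monotone x)
    (hx3 : ∀ i j k : Fin (2 * n), i < j → j < k → x i = x j → x j = x k → False)
    (a : Spins (2 * n)) (j : Fin (2 * n)) :
    betheFn γ z (x + Pi.single j 1) a = betheWave γ z 1 (x + Pi.single j 1) a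
      + ∑ k : Fin (2 * n), if j.val + 1 = k.val ∧ x j = x k then
          -(betheWave γ z 1 (x + Pi.single k 1) (a ∘ swap j k)
            + betheWave γ z 1 (x + Pi.single j 1) a) else 0 := by
  by_cases h : ∃ k : Fin (2 * n), j.val + 1 = k.val ∧ x j = x k
  · obtain ⟨k, hjk, hxjk⟩ := h
    have hlt : j < k := Fin.lt_def.2 (by omega)
    rw [sum_pair_ite j k hjk x hxjk]
    have hc : (x + Pi.single j 1) ∘ swap j k = x + Pi.single k 1 := by
      have := comp_add_single x (swap j k) k 1
      rw [comp_swap_of_eq hxjk, swap_apply_right] at this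
      exact this.symm
    have hm : Monotone ((x + Pi.single j 1) ∘ swap j k) := by
      rw [hc]
      refine monotone_add_single hx k fun l hkl => lt_of_le_of_ne (hx hkl.le) fun h => ?_
      exact hx3 j k l hlt hkl hxjk h
    rw [betheFn_eq hz a hm, betheWave_one_comp, hc, csign_swap hlt.ne]
    ring
  · push Not at h
    rw [Finset.sum_eq_zero fun k _ => if_neg fun hk => h k hk.1 hk.2, add_zero]
    refine betheFn_eq hz a (Q := 1) (monotone_add_single hx j fun k hjk => ?_)
    have hlt : j.val + 1 < 2 * n := by
      have := k.2
      have : j.val < k.val := hjk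
      omega
    have h1 := h ⟨j.val + 1, hlt⟩ rfl
    have h2 : x j ≤ x ⟨j.val + 1, hlt⟩ := hx (Fin.le_def.2 (Nat.le_succ _))
    have h3 : x ⟨j.val + 1, hlt⟩ ≤ x k := hx (Fin.le_def.2 hjk)
    omega

theorem betheFn_sub_single (hz : Admissible γ z) {x : Sites (2 * n)} (hx : Monotone x)
    (hx3 : ∀ i j k : Fin (2 * n), i < j → j < k → x i = x j → x j = x k → False)
    (a : Spins (2 * n)) (k : Fin (2 * n)) :
    betheFn γ z (x - Pi.single k 1) a = betheWave γ z 1 (x - Pi.single k 1) a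
      + ∑ j : Fin (2 * n), if j.val + 1 = k.val ∧ x j = x k then
          -(betheWave γ z 1 (x - Pi.single j 1) (a ∘ swap j k)
            + betheWave γ z 1 (x - Pi.single k 1) a) else 0 := by
  by_cases h : ∃ j : Fin (2 * n), j.val + 1 = k.val ∧ x j = x k
  · obtain ⟨j, hjk, hxjk⟩ := h
    have hlt : j < k := Fin.lt_def.2 (by omega)
    rw [sum_pair_ite' j k hjk x hxjk]
    have hc : (x - Pi.single k 1) ∘ swap j k = x - Pi.single j 1 := by
      have := comp_sub_single x (swap j k) j 1
      rw [comp_swap_of_eq hxjk, swap_apply_left] at this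
      exact this.symm
    have hm : Monotone ((x - Pi.single k 1) ∘ swap j k) := by
      rw [hc]
      refine monotone_sub_single hx j fun l hkl => lt_of_le_of_ne (hx hkl.le) fun h => ?_
      exact hx3 l j k hkl hlt h hxjk
    rw [betheFn_eq hz a hm, betheWave_one_comp, hc, csign_swap hlt.ne]
    ring
  · push Not at h
    rw [Finset.sum_eq_zero fun j _ => if_neg fun hk => h j hk.1 hk.2, add_zero]
    refine betheFn_eq hz a (Q := 1) (monotone_sub_single hx k fun j hjk => ?_)
    have hv : j.val < k.val := hjk
    have hlt : k.val - 1 < 2 * n := by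
      have := k.2
      omega
    have h1 := h ⟨k.val - 1, hlt⟩ (by simp; omega)
    have h2 : x ⟨k.val - 1, hlt⟩ ≤ x k := hx (Fin.le_def.2 (by simp))
    have h3 : x j ≤ x ⟨k.val - 1, hlt⟩ := hx (Fin.le_def.2 (by simp; omega))
    omega

theorem sum_lt_eq_sum_succ {N : ℕ} {x : Sites N} (hx : Monotone x)
    (hx3 : ∀ i j k : Fin N, i < j → j < k → x i = x j → x j = x k → False) :
    (∑ j : Fin N, ∑ k : Fin N, if j < k ∧ x j = x k then (1 : ℂ) else 0)
      = ∑ j : Fin N, ∑ k : Fin N, if j.val + 1 = k.val ∧ x j = x k then (1 : ℂ) else 0 := by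
  refine Finset.sum_congr rfl fun j _ => Finset.sum_congr rfl fun k _ => if_congr ?_ rfl rfl
  refine ⟨fun ⟨h1, h2⟩ => ⟨?_, h2⟩, fun ⟨h1, h2⟩ => ⟨Fin.lt_def.2 (by omega), h2⟩⟩
  by_contra hne
  have hv : j.val < k.val := h1
  have hl : j.val + 1 < N := by have := k.2; omega
  have e1 : x j ≤ x ⟨j.val + 1, hl⟩ := hx (Fin.le_def.2 (Nat.le_succ _))
  have e2 : x ⟨j.val + 1, hl⟩ ≤ x k := hx (Fin.le_def.2 hv)
  exact hx3 j ⟨j.val + 1, hl⟩ k (Fin.lt_def.2 (by simp)) (Fin.lt_def.2 (by simp; omega))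
    (by omega) (by omega)

theorem hubbardH_betheFn_of_monotone (hz : Admissible γ z) (h0 : ∀ j, z j ≠ 0)
    {x : Sites (2 * n)} (hx : Monotone x)
    (hx3 : ∀ i j k : Fin (2 * n), i < j → j < k → x i = x j → x j = x k → False)
    (a : Spins (2 * n)) :
    hubbardH n γ (betheFn γ z) x a = energy γ z * betheFn γ z x a := by
  have hfree := free_eigen (γ := γ) h0 x a
  have hΦ : betheFn γ z x a = betheWave γ z 1 x a := betheFn_eq hz a (Q := 1) hx
  rw [hubbardH, sum_lt_eq_sum_succ hx hx3, hΦ]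
  simp only [betheFn_add_single hz hx hx3, betheFn_sub_single hz hx hx3]
  have hsum : ∑ j : Fin (2 * n), (∑ k : Fin (2 * n), (if j.val + 1 = k.val ∧ x j = x k then
          -(betheWave γ z 1 (x + Pi.single k 1) (a ∘ swap j k)
            + betheWave γ z 1 (x + Pi.single j 1) a) else 0))
      + ∑ k : Fin (2 * n), ∑ j : Fin (2 * n), (if j.val + 1 = k.val ∧ x j = x k then
          -(betheWave γ z 1 (x - Pi.single j 1) (a ∘ swap j k)
            + betheWave γ z 1 (x - Pi.single k 1) a) else 0)
      = 4 * Complex.I * γ * (∑ j : Fin (2 * n), ∑ k : Fin (2 * n),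
          if j.val + 1 = k.val ∧ x j = x k then (1 : ℂ) else 0) * betheWave γ z 1 x a := by
    refine (congrArg₂ (· + ·) rfl Finset.sum_comm).trans ?_
    rw [← Finset.sum_add_distrib, Finset.mul_sum, Finset.sum_mul]
    refine Finset.sum_congr rfl fun j _ => ?_
    rw [← Finset.sum_add_distrib, Finset.mul_sum, Finset.sum_mul]
    refine Finset.sum_congr rfl fun k _ => ?_
    split_ifs with h
    · linear_combination -(betheWave_contact hz h0 x a h.1 h.2)
    · ring
  have hE : energy γ z = -(∑ j, (z j + 1 / z j)) - 4 * Complex.I * γ * n := by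
    rw [energy, ← Finset.sum_div]
    ring
  simp only [Finset.sum_add_distrib] at hfree hsum ⊢
  rw [hE, Finset.sum_add_distrib]
  linear_combination -hfree - hsum

/-- The Bethe wave function is an eigenfunction of the Hubbard Hamiltonian. -/
theorem hubbardH_betheFn (hz : Admissible γ z) (h0 : ∀ j, z j ≠ 0) (x : Sites (2 * n))
    (a : Spins (2 * n)) :
    hubbardH n γ (betheFn γ z) x a = energy γ z * betheFn γ z x a := by
  have hA := antisymm_betheFn hz
  have hHA := hA.hubbardH (γ := γ)
  by_cases h3 : ∃ i j k : Fin (2 * n), i ≠ j ∧ j ≠ k ∧ i ≠ k ∧ x i = x j ∧ x j = x k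
  · obtain ⟨i, j, k, h1, h2, h3, h4, h5⟩ := h3
    rw [hA.eq_zero_of_triple a h1 h2 h3 h4 h5, hHA.eq_zero_of_triple a h1 h2 h3 h4 h5, mul_zero]
  · push Not at h3
    have hs := hubbardH_betheFn_of_monotone hz h0 (Tuple.monotone_sort x) (fun i j k h1 h2 h4 h5 =>
      h3 (Tuple.sort x i) (Tuple.sort x j) (Tuple.sort x k) (by simpa using h1.ne)
        (by simpa using h2.ne) (by simpa using (h1.trans h2).ne) h4 h5) (a ∘ Tuple.sort x)
    rw [hA, hHA] at hs
    have := csign_mul_self (Tuple.sort x)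
    linear_combination (csign (Tuple.sort x)) * hs
      - (hubbardH n γ (betheFn γ z) x a - energy γ z * betheFn γ z x a) * this

end Eigen

/-! ### Linear evolution equations on infinite index sets -/

/-- Uniqueness for evolution equations on an infinite index set, in a class of functions with
weighted bounds that the generator respects. Iterating the mean value inequality bounds a solution
with zero initial value by `C W (L|t|)^m / m!` for all `m`. -/
theorem evolution_unique {ι : Type*} {W : ι → ℝ} (hW : ∀ i, 0 ≤ W i) {L : ℝ}
    {G : (ι → ℂ) → ι → ℂ}
    (hG : ∀ f C, 0 ≤ C → (∀ i, ‖f i‖ ≤ C * W i) → ∀ i, ‖G f i‖ ≤ L * (C * W i))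
    (hL : 0 ≤ L) {J : Set ℝ} (hJ : J.OrdConnected) (h0 : (0 : ℝ) ∈ J) {u : ℝ → ι → ℂ}
    (heq : ∀ t ∈ J, ∀ i, HasDerivWithinAt (fun s => u s i) (G (u t) i) J t)
    (hinit : ∀ i, u 0 i = 0)
    (hb : ∀ τ : ℝ, ∃ C : ℝ, ∀ t ∈ J, |t| ≤ τ → ∀ i, ‖u t i‖ ≤ C * W i) :
    ∀ t ∈ J, ∀ i, u t i = 0 := by
  intro t ht
  obtain ⟨C, hC⟩ := hb |t|
  have hmem : ∀ s ∈ Icc (0 : ℝ) 1, s * t ∈ J := by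
    intro s hs
    have : s * t ∈ uIcc 0 t := by
      rcases le_total 0 t with h | h
      · rw [uIcc_of_le h]
        exact ⟨mul_nonneg hs.1 h, by nlinarith [hs.2]⟩
      · rw [uIcc_of_ge h]
        exact ⟨by nlinarith [hs.2], mul_nonpos_of_nonneg_of_nonpos hs.1 h⟩
    exact hJ.uIcc_subset h0 ht this
  have key : ∀ m : ℕ, ∀ s ∈ Icc (0 : ℝ) 1, ∀ i,
      ‖u (s * t) i‖ ≤ ((L * |t|) ^ m * max C 0 * s ^ m / m.factorial) * W i := by
    intro m
    induction m with
    | zero =>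
      intro s hs i
      have h1 : |s * t| ≤ |t| := by
        rw [abs_mul, abs_of_nonneg hs.1]
        exact mul_le_of_le_one_left (abs_nonneg _) hs.2
      refine (hC _ (hmem s hs) h1 i).trans ?_
      simpa using mul_le_mul_of_nonneg_right (le_max_left C 0) (hW i)
    | succ m ih =>
      intro s hs i
      have hder : ∀ s ∈ Icc (0 : ℝ) 1,
          HasDerivWithinAt (fun s => u (s * t) i) (t • G (u (s * t)) i) (Icc 0 1) s := by
        intro s hs
        have h1 := heq _ (hmem s hs) i
        have h2 : HasDerivWithinAt (fun s : ℝ => s * t) t (Icc 0 1) s := by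
          simpa using (hasDerivAt_mul_const t).hasDerivWithinAt
        exact h1.scomp s h2 hmem
      have hB : ∀ s : ℝ, HasDerivAt
          (fun s : ℝ => ((L * |t|) ^ (m + 1) * max C 0 * s ^ (m + 1) / (m + 1).factorial) * W i)
          (|t| * (L * (((L * |t|) ^ m * max C 0 * s ^ m / m.factorial) * W i))) s := by
        intro s
        have h := (((hasDerivAt_pow (m + 1) s).const_mul ((L * |t|) ^ (m + 1) * max C 0)).div_const
          ((m + 1).factorial : ℝ)).mul_const (W i)
        refine h.congr_deriv ?_
        rw [Nat.factorial_succ]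
        push_cast
        have : (m.factorial : ℝ) ≠ 0 := by positivity
        field_simp
        ring
      refine image_norm_le_of_norm_deriv_right_le_deriv_boundary'
        (f := fun s => u (s * t) i) (f' := fun s => t • G (u (s * t)) i)
        (fun s hs => (hder s hs).continuousWithinAt) ?_ ?_
        (fun s _ => (hB s).continuousAt.continuousWithinAt)
        (fun s _ => (hB s).hasDerivWithinAt) ?_ hs
      · intro s hs
        exact ((hder s (Ico_subset_Icc_self hs)).mono_of_mem_nhdsWithin
          (Icc_mem_nhdsGE_of_mem hs))
      · simp [hinit]
      · intro s hs
        rw [norm_smul, Real.norm_eq_abs]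
        refine mul_le_mul_of_nonneg_left ?_ (abs_nonneg t)
        have hs' := Ico_subset_Icc_self hs
        have hs0 := hs'.1
        exact hG _ _ (by positivity) (ih s hs') i
  intro i
  have hlim : Tendsto (fun m : ℕ => ((L * |t|) ^ m / m.factorial) * (max C 0 * W i)) atTop
      (𝓝 (0 * (max C 0 * W i))) :=
    (FloorSemiring.tendsto_pow_div_factorial_atTop _).mul_const _
  rw [zero_mul] at hlim
  have hle : ‖u t i‖ ≤ 0 := by
    refine ge_of_tendsto' hlim fun m => ?_
    have := key m 1 (by simp) i
    rw [one_mul, one_pow, mul_one] at this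
    refine this.trans (le_of_eq ?_)
    ring
  exact norm_le_zero_iff.1 hle

theorem exists_hasDerivAt_eq_apply {X : Type*} [NormedAddCommGroup X] [NormedSpace ℂ X]
    [CompleteSpace X] (T : X →L[ℂ] X) (v : X) :
    ∃ w : ℝ → X, w 0 = v ∧ ∀ t, HasDerivAt w (T (w t)) t := by
  refine ⟨fun s : ℝ => NormedSpace.exp (s • T) v, by simp, fun t => ?_⟩
  have h := hasDerivAt_exp_smul_const' (𝕂 := ℝ) T t
  exact ((ContinuousLinearMap.apply ℂ X v).restrictScalars ℝ).hasFDerivAt.comp_hasDerivAt t h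

/-- Existence of bounded solutions for a bounded generator, by the exponential series on the
Banach space of bounded functions. -/
theorem evolution_exists {ι : Type*} {L : ℝ} (hL : 0 ≤ L) (G : (ι → ℂ) →ₗ[ℂ] (ι → ℂ))
    (hG : ∀ f C, 0 ≤ C → (∀ i, ‖f i‖ ≤ C) → ∀ i, ‖G f i‖ ≤ L * C) (u₀ : ι → ℂ) {C₀ : ℝ}
    (hu₀ : ∀ i, ‖u₀ i‖ ≤ C₀) :
    ∃ u : ℝ → ι → ℂ, u 0 = u₀ ∧ (∀ t i, HasDerivAt (fun s => u s i) (G (u t) i) t) ∧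
      ∀ τ : ℝ, ∃ C : ℝ, ∀ t, |t| ≤ τ → ∀ i, ‖u t i‖ ≤ C := by
  classical
  let X := lp (fun _ : ι => ℂ) ⊤
  have hbd : ∀ (f : ι → ℂ) (C : ℝ), (∀ i, ‖f i‖ ≤ C) → Memℓp f ⊤ := fun f C h =>
    memℓp_infty ⟨C, by rintro _ ⟨i, rfl⟩; exact h i⟩
  have hGX : ∀ f : X, ∀ i, ‖G (f : ι → ℂ) i‖ ≤ L * ‖f‖ := fun f =>
    hG f ‖f‖ (norm_nonneg _) fun i => lp.norm_apply_le_norm ENNReal.top_ne_zero f i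
  let T₀ : X →ₗ[ℂ] X :=
    { toFun := fun f => ⟨G (f : ι → ℂ), hbd _ _ (hGX f)⟩
      map_add' := fun f g => Subtype.ext (G.map_add (f : ι → ℂ) g)
      map_smul' := fun c f => Subtype.ext (G.map_smul c (f : ι → ℂ)) }
  let T : X →L[ℂ] X := T₀.mkContinuous L fun f =>
    lp.norm_le_of_forall_le (mul_nonneg hL (norm_nonneg _)) (hGX f)
  let v₀ : X := ⟨u₀, hbd _ _ hu₀⟩
  have hT : ∀ (f : X) i, (T f : ι → ℂ) i = G (f : ι → ℂ) i := fun f i => rfl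
  obtain ⟨w, hw0, hder⟩ := exists_hasDerivAt_eq_apply T v₀
  refine ⟨fun t => (w t : X), ?_, fun t i => ?_, fun τ => ?_⟩
  · simp [hw0, v₀]
  · exact ((lp.evalCLM ℂ (fun _ : ι => ℂ) ⊤ i).restrictScalars ℝ).hasFDerivAt.comp_hasDerivAt
      t (hder t)
  · have hc : Continuous fun t : ℝ => ‖w t‖ :=
      (continuous_iff_continuousAt.2 fun t => (hder t).continuousAt).norm
    obtain ⟨C, hC⟩ := (isCompact_Icc (a := -τ) (b := τ)).exists_bound_of_continuousOn
      hc.continuousOn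
    refine ⟨C, fun t ht i => ?_⟩
    refine (lp.norm_apply_le_norm ENNReal.top_ne_zero _ i).trans ?_
    simpa using hC t (abs_le.1 ht)

/-! ### Means over tori -/

/-- The mean of `F` over the torus `|z_j| = ρ_j` with respect to the normalized measure
`∏_j dz_j / (2πi z_j)`. -/
def torusMean {N : ℕ} (ρ : Fin N → ℝ) (F : (Fin N → ℂ) → ℂ) : ℂ :=
  ((2 * Real.pi) ^ N : ℂ)⁻¹ *
    ∫ θ in Icc (0 : Fin N → ℝ) (fun _ => 2 * Real.pi), F (torusMap 0 ρ θ)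

/-- Continuity on the torus, in terms of the angles. -/
def TorusCont {N : ℕ} (ρ : Fin N → ℝ) (F : (Fin N → ℂ) → ℂ) : Prop :=
  Continuous fun θ : Fin N → ℝ => F (torusMap 0 ρ θ)

section TorusMean

variable {N : ℕ} {ρ : Fin N → ℝ} {F G : (Fin N → ℂ) → ℂ}

theorem torusMap_zero_apply (ρ : Fin N → ℝ) (θ : Fin N → ℝ) (j : Fin N) :
    torusMap 0 ρ θ j = circleMap 0 (ρ j) (θ j) := by
  simp [torusMap, circleMap]

theorem norm_torusMap (hρ : ∀ j, 0 < ρ j) (θ : Fin N → ℝ) (j : Fin N) :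
    ‖torusMap 0 ρ θ j‖ = ρ j := by
  rw [torusMap_zero_apply, norm_circleMap_zero, abs_of_pos (hρ j)]

theorem continuous_torusMap (ρ : Fin N → ℝ) : Continuous (torusMap (0 : Fin N → ℂ) ρ) := by
  refine continuous_pi fun j => ?_
  simp only [torusMap_zero_apply]
  fun_prop

theorem torusCont_const (c : ℂ) : TorusCont ρ fun _ => c := continuous_const

theorem TorusCont.add (hF : TorusCont ρ F) (hG : TorusCont ρ G) :
    TorusCont ρ fun z => F z + G z := Continuous.add hF hG

theorem TorusCont.sub (hF : TorusCont ρ F) (hG : TorusCont ρ G) :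
    TorusCont ρ fun z => F z - G z := Continuous.sub hF hG

theorem TorusCont.neg (hF : TorusCont ρ F) : TorusCont ρ fun z => -F z := Continuous.neg hF

theorem TorusCont.mul (hF : TorusCont ρ F) (hG : TorusCont ρ G) :
    TorusCont ρ fun z => F z * G z := Continuous.mul hF hG

theorem TorusCont.pow (hF : TorusCont ρ F) (m : ℕ) : TorusCont ρ fun z => F z ^ m :=
  Continuous.pow hF m

theorem TorusCont.sum {ι : Type*} {s : Finset ι} {f : ι → (Fin N → ℂ) → ℂ}
    (h : ∀ i ∈ s, TorusCont ρ (f i)) : TorusCont ρ fun z => ∑ i ∈ s, f i z :=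
  continuous_finsetSum s h

theorem TorusCont.prod {ι : Type*} {s : Finset ι} {f : ι → (Fin N → ℂ) → ℂ}
    (h : ∀ i ∈ s, TorusCont ρ (f i)) : TorusCont ρ fun z => ∏ i ∈ s, f i z :=
  continuous_finsetProd s h

theorem torusCont_apply (j : Fin N) : TorusCont ρ fun z => z j :=
  (continuous_apply j).comp (continuous_torusMap ρ)

theorem TorusCont.div (hF : TorusCont ρ F) (hG : TorusCont ρ G)
    (h : ∀ z : Fin N → ℂ, (∀ j, ‖z j‖ = ρ j) → G z ≠ 0) (hρ : ∀ j, 0 < ρ j) :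
    TorusCont ρ fun z => F z / G z :=
  Continuous.div hF hG fun θ => h _ (norm_torusMap hρ θ)

theorem TorusCont.inv (hG : TorusCont ρ G)
    (h : ∀ z : Fin N → ℂ, (∀ j, ‖z j‖ = ρ j) → G z ≠ 0) (hρ : ∀ j, 0 < ρ j) :
    TorusCont ρ fun z => (G z)⁻¹ :=
  Continuous.inv₀ hG fun θ => h _ (norm_torusMap hρ θ)

theorem ne_zero_of_norm_eq (hρ : ∀ j, 0 < ρ j) {z : Fin N → ℂ} (hz : ∀ j, ‖z j‖ = ρ j)
    (j : Fin N) : z j ≠ 0 := by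
  rw [← norm_pos_iff, hz]
  exact hρ j

theorem torusCont_zpow (hρ : ∀ j, 0 < ρ j) (j : Fin N) (m : ℤ) :
    TorusCont ρ fun z => z j ^ m :=
  Continuous.zpow₀ (torusCont_apply j) m fun θ =>
    .inl (ne_zero_of_norm_eq hρ (norm_torusMap hρ θ) j)

theorem TorusCont.integrableOn (hF : TorusCont ρ F) :
    IntegrableOn (fun θ => F (torusMap 0 ρ θ)) (Icc (0 : Fin N → ℝ) fun _ => 2 * Real.pi) :=
  hF.continuousOn.integrableOn_compact isCompact_Icc

theorem torusMean_add (hF : TorusCont ρ F) (hG : TorusCont ρ G) :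
    torusMean ρ (fun z => F z + G z) = torusMean ρ F + torusMean ρ G := by
  rw [torusMean, torusMean, torusMean, ← mul_add, integral_add hF.integrableOn hG.integrableOn]

theorem torusMean_const_mul (c : ℂ) (F : (Fin N → ℂ) → ℂ) :
    torusMean ρ (fun z => c * F z) = c * torusMean ρ F := by
  rw [torusMean, torusMean, integral_const_mul]
  ring

theorem torusMean_sum {ι : Type*} (s : Finset ι) {f : ι → (Fin N → ℂ) → ℂ}
    (h : ∀ i ∈ s, TorusCont ρ (f i)) :
    torusMean ρ (fun z => ∑ i ∈ s, f i z) = ∑ i ∈ s, torusMean ρ (f i) := by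
  simp only [torusMean, ← Finset.mul_sum]
  rw [integral_finsetSum s fun i hi => (h i hi).integrableOn]

theorem torusMean_congr (hρ : ∀ j, 0 < ρ j)
    (h : ∀ z : Fin N → ℂ, (∀ j, ‖z j‖ = ρ j) → F z = G z) : torusMean ρ F = torusMean ρ G := by
  rw [torusMean, torusMean]
  congr 2
  funext θ
  exact h _ (norm_torusMap hρ θ)

theorem TorusCont.congr (hF : TorusCont ρ F) (hρ : ∀ j, 0 < ρ j)
    (h : ∀ z : Fin N → ℂ, (∀ j, ‖z j‖ = ρ j) → F z = G z) : TorusCont ρ G := by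
  have : (fun θ : Fin N → ℝ => G (torusMap 0 ρ θ)) = fun θ => F (torusMap 0 ρ θ) :=
    funext fun θ => (h _ (norm_torusMap hρ θ)).symm
  rw [TorusCont, this]
  exact hF

theorem torusMean_const (c : ℂ) : torusMean ρ (fun _ => c) = c := by
  have hpi : (Real.pi : ℂ) ≠ 0 := by exact_mod_cast Real.pi_ne_zero
  rw [torusMean, setIntegral_const, measureReal_def, Real.volume_Icc_pi_toReal]
  · simp only [Pi.zero_apply, sub_zero, Finset.prod_const, Finset.card_univ, Fintype.card_fin,
      Complex.real_smul]
    push_cast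
    field_simp
  · intro i
    simp [Real.pi_pos.le]

theorem norm_torusMean_le {C : ℝ} (hρ : ∀ j, 0 < ρ j)
    (h : ∀ z : Fin N → ℂ, (∀ j, ‖z j‖ = ρ j) → ‖F z‖ ≤ C) : ‖torusMean ρ F‖ ≤ C := by
  have h1 := norm_setIntegral_le_of_norm_le_const (μ := volume)
    (s := Icc (0 : Fin N → ℝ) fun _ => 2 * Real.pi) (f := fun θ => F (torusMap 0 ρ θ)) (C := C)
    isCompact_Icc.measure_lt_top fun θ _ => h _ (norm_torusMap hρ θ)
  rw [measureReal_def, Real.volume_Icc_pi_toReal fun i => by simp [Real.pi_pos.le]] at h1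
  simp only [Pi.zero_apply, sub_zero, Finset.prod_const, Finset.card_univ, Fintype.card_fin] at h1
  rw [torusMean, norm_mul, norm_inv, norm_pow, norm_mul, Complex.norm_real, Complex.norm_ofNat,
    Real.norm_of_nonneg Real.pi_pos.le]
  rw [inv_mul_le_iff₀ (by positivity)]
  linarith

/-- If the mean over one of the circles vanishes for all values of the other variables, then the
mean over the torus vanishes. -/
theorem torusMean_eq_zero_of_circle (hρ : ∀ j, 0 < ρ j) (hF : TorusCont ρ F) (i : Fin N)
    (h : ∀ z : Fin N → ℂ, (∀ j, ‖z j‖ = ρ j) →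
      (∮ w in C(0, ρ i), w⁻¹ * F (Function.update z i w)) = 0) :
    torusMean ρ F = 0 := by
  obtain ⟨N, rfl⟩ : ∃ M, N = M + 1 := ⟨N - 1, by have := i.2; omega⟩
  rw [torusMean, mul_eq_zero]
  right
  set e : ℝ × (Fin N → ℝ) ≃ᵐ (Fin (N + 1) → ℝ) :=
    (MeasurableEquiv.piFinSuccAbove (fun _ => ℝ) i).symm
  have hem : MeasurePreserving e :=
    (volume_preserving_piFinSuccAbove (fun _ : Fin (N + 1) => ℝ) i).symm _
  have heπ : (e ⁻¹' Icc 0 fun _ => 2 * Real.pi)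
      = Icc (0 : ℝ) (2 * Real.pi) ×ˢ Icc (0 : Fin N → ℝ) fun _ => 2 * Real.pi :=
    ((Fin.insertNthOrderIso (fun _ => ℝ) i).preimage_Icc _ _).trans (Icc_prod_eq _ _)
  have hint := hF.integrableOn
  rw [← hem.integrableOn_comp_preimage e.measurableEmbedding, heπ] at hint
  rw [← hem.map_eq, setIntegral_map_equiv, heπ, Measure.volume_eq_prod]
  rw [Measure.volume_eq_prod] at hint
  have hint' : IntegrableOn (fun p : (Fin N → ℝ) × ℝ => F (torusMap 0 ρ (e p.swap)))
      ((Icc (0 : Fin N → ℝ) fun _ => 2 * Real.pi) ×ˢ Icc (0 : ℝ) (2 * Real.pi))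
      (volume.prod volume) := hint.swap
  rw [← setIntegral_prod_swap, setIntegral_prod _ hint']
  refine (setIntegral_congr_fun (g := fun _ => (0 : ℂ)) measurableSet_Icc fun Θ _ => ?_).trans
    (by simp)
  have he : ∀ t : ℝ, torusMap 0 ρ (e (t, Θ))
      = Function.update (torusMap 0 ρ (e (0, Θ))) i (circleMap 0 (ρ i) t) := by
    intro t
    funext j
    rw [torusMap_zero_apply]
    refine Fin.succAboveCases i ?_ (fun j => ?_) j
    · simp [e, MeasurableEquiv.piFinSuccAbove_symm_apply, Fin.insertNthEquiv]
    · rw [Function.update_of_ne (Fin.succAbove_ne i j), torusMap_zero_apply]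
      simp [e, MeasurableEquiv.piFinSuccAbove_symm_apply, Fin.insertNthEquiv]
  have h1 := h (torusMap 0 ρ (e (0, Θ))) (norm_torusMap hρ _)
  rw [circleIntegral_def_Icc] at h1
  have h2 : ∀ t : ℝ, deriv (circleMap 0 (ρ i)) t •
      ((circleMap 0 (ρ i) t)⁻¹ * F (Function.update (torusMap 0 ρ (e (0, Θ))) i
        (circleMap 0 (ρ i) t))) = Complex.I * F (torusMap 0 ρ (e (t, Θ))) := by
    intro t
    rw [← he, deriv_circleMap, smul_eq_mul]
    have := circleMap_ne_center (c := 0) (hρ i).ne' (θ := t)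
    field_simp
  simp only [h2] at h1
  rw [integral_const_mul, mul_eq_zero] at h1
  exact h1.resolve_left Complex.I_ne_zero

end TorusMean

/-! ### Nested contours -/

/-- The circle of radius `a` lies deep inside the circle of radius `b ≤ 1`, so that `s(z)` on the
inner circle dominates `s(z)` on the outer circle and the interaction strength. -/
def Deep (γ : ℂ) (a b : ℝ) : Prop := 0 < a ∧ (4 * ‖γ‖ + 4) * a < b ∧ b ≤ 1

theorem Deep.pos {γ : ℂ} {a b : ℝ} (h : Deep γ a b) : 0 < a := h.1

theorem Deep.lt {γ : ℂ} {a b : ℝ} (h : Deep γ a b) : a < b := by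
  have := h.1
  nlinarith [h.2.1, norm_nonneg γ]

theorem Deep.four_mul_lt_one {γ : ℂ} {a b : ℝ} (h : Deep γ a b) : (4 * ‖γ‖ + 4) * a < 1 :=
  h.2.1.trans_le h.2.2

theorem norm_two_mul_I : ‖(2 * Complex.I : ℂ)‖ = 2 := by simp

theorem le_norm_sParam {w : ℂ} : (‖w‖⁻¹ - ‖w‖) / 2 ≤ ‖sParam w‖ := by
  rw [sParam, norm_div, norm_two_mul_I]
  have h := norm_sub_norm_le (1 / w) w
  rw [norm_div, norm_one, one_div, norm_sub_rev] at h
  linarith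

theorem norm_sParam_le {w : ℂ} : ‖sParam w‖ ≤ (‖w‖⁻¹ + ‖w‖) / 2 := by
  rw [sParam, norm_div, norm_two_mul_I]
  have h := norm_sub_le w (1 / w)
  rw [norm_div, norm_one, one_div ‖w‖] at h
  linarith

theorem Deep.norm_sParam_sub {γ : ℂ} {a b : ℝ} (h : Deep γ a b) {w z : ℂ} (hw0 : w ≠ 0)
    (hw : ‖w‖ ≤ a) (hz : ‖z‖ = b) : 2 * ‖γ‖ < ‖sParam w - sParam z‖ := by
  have hw' : 0 < ‖w‖ := norm_pos_iff.2 hw0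
  have hb : 0 < b := h.pos.trans h.lt
  have h1 := le_norm_sParam (w := w)
  have h2 := norm_sParam_le (w := z)
  have h3 := norm_sub_norm_le (sParam w) (sParam z)
  rw [hz] at h2
  have h4 : (4 * ‖γ‖ + 4) * b⁻¹ ≤ ‖w‖⁻¹ := by
    rw [← div_eq_mul_inv, div_le_iff₀ hb, inv_mul_eq_div, le_div_iff₀ hw']
    nlinarith [h.2.1, norm_nonneg γ]
  have h5 : 1 ≤ b⁻¹ := (one_le_inv₀ hb).2 h.2.2
  have h6 : ‖w‖ ≤ 1 := hw.trans (h.lt.le.trans h.2.2)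
  have h7 := h.2.2
  nlinarith [norm_nonneg γ]

theorem Deep.sParam_sub_ne {γ : ℂ} {a b : ℝ} (h : Deep γ a b) {w z : ℂ} (hw0 : w ≠ 0)
    (hw : ‖w‖ ≤ a) (hz : ‖z‖ = b) {c : ℂ} (hc : ‖c‖ ≤ 2 * ‖γ‖) :
    sParam w - sParam z ≠ c := by
  rintro rfl
  exact absurd (h.norm_sParam_sub hw0 hw hz) (not_lt.2 hc)

theorem Deep.norm_sParam {γ : ℂ} {a b : ℝ} (h : Deep γ a b) {w : ℂ} (hw0 : w ≠ 0)
    (hw : ‖w‖ ≤ a) : 2 * ‖γ‖ < ‖sParam w‖ := by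
  have hw' : 0 < ‖w‖ := norm_pos_iff.2 hw0
  have h1 := le_norm_sParam (w := w)
  have h2 := h.four_mul_lt_one
  have h4 : 4 * ‖γ‖ + 4 ≤ ‖w‖⁻¹ := by
    rw [le_inv_comm₀ (by positivity) hw', le_inv_comm₀ hw' (by positivity),
      inv_eq_one_div, le_div_iff₀ hw']
    nlinarith [norm_nonneg γ]
  have h6 : ‖w‖ ≤ 1 := hw.trans (h.lt.le.trans h.2.2)
  linarith [norm_nonneg γ]

theorem norm_two_mul (γ : ℂ) : ‖2 * γ‖ = 2 * ‖γ‖ := by simp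

/-- Radii that are nested so that inner contours belong to smaller indices. -/
def Nested {N : ℕ} (γ : ℂ) (ρ : Fin N → ℝ) : Prop :=
  (∀ j, 0 < ρ j) ∧ ∀ i j, i < j → Deep γ (ρ i) (ρ j)

theorem Nested.admissible {N : ℕ} {γ : ℂ} {ρ : Fin N → ℝ} (hρ : Nested γ ρ) {z : Fin N → ℂ}
    (hz : ∀ j, ‖z j‖ = ρ j) : Admissible γ z := by
  intro i j hij
  have h0 := ne_zero_of_norm_eq hρ.1 hz
  rcases lt_or_gt_of_ne hij with h | h
  · exact (hρ.2 i j h).sParam_sub_ne (h0 i) (hz i).le (hz j) (norm_two_mul γ).le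
  · intro he
    refine (hρ.2 j i h).sParam_sub_ne (h0 j) (hz j).le (hz i) (c := -(2 * γ)) ?_ ?_
    · rw [norm_neg, norm_two_mul]
    · rw [← he, neg_sub]

theorem nested_radius {n : ℕ} {γ : ℂ} {r : ℝ} (h0 : 0 < r) (h1 : r < (4 * ‖γ‖ + 4)⁻¹) :
    Nested γ (radius n r) := by
  have hr : (4 * ‖γ‖ + 4) * r < 1 := by
    rw [lt_inv_comm₀ h0 (by positivity), inv_eq_one_div, lt_div_iff₀ h0] at h1
    exact h1
  have hr1 : r ≤ 1 := by nlinarith [norm_nonneg γ]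
  refine ⟨fun j => pow_pos h0 _, fun i j hij => ⟨pow_pos h0 _, ?_, pow_le_one₀ h0.le hr1⟩⟩
  have hv : i.val < j.val := hij
  have h2 : radius n r i ≤ r * radius n r j := by
    rw [radius, radius, ← pow_succ']
    exact pow_le_pow_of_le_one h0.le hr1 (by omega)
  have h3 : 0 < radius n r j := pow_pos h0 _
  calc (4 * ‖γ‖ + 4) * radius n r i ≤ (4 * ‖γ‖ + 4) * (r * radius n r j) :=
        mul_le_mul_of_nonneg_left h2 (by positivity)
    _ = ((4 * ‖γ‖ + 4) * r) * radius n r j := by ring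
    _ < 1 * radius n r j := mul_lt_mul_of_pos_right hr h3
    _ = _ := one_mul _

theorem polesOutside {n : ℕ} {γ : ℂ} {r : ℝ} (h0 : 0 < r) (h1 : r < (4 * ‖γ‖ + 4)⁻¹) :
    PolesOutside n γ r := by
  intro j k hjk z w hz hw0 hw
  exact sub_ne_zero.2 (((nested_radius h0 h1).2 j k hjk).sParam_sub_ne hw0 hw hz
    (norm_two_mul γ).le)

section Continuity

variable {N : ℕ} {γ : ℂ} {ρ : Fin N → ℝ}

theorem torusCont_sParam (hρ : ∀ j, 0 < ρ j) (j : Fin N) : TorusCont ρ fun z => sParam (z j) :=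
  ((torusCont_apply j).sub ((torusCont_const 1).div (torusCont_apply j)
    (fun _ hz => ne_zero_of_norm_eq hρ hz j) hρ)).div (torusCont_const _)
    (fun _ _ => by simp) hρ

theorem torusCont_exp {E : (Fin N → ℂ) → ℂ} (hE : TorusCont ρ E) :
    TorusCont ρ fun z => Complex.exp (E z) := Complex.continuous_exp.comp hE

end Continuity

section Contour

variable {n : ℕ} {γ : ℂ} {ρ : Fin (2 * n) → ℝ}

theorem torusCont_scattering (hρ : Nested γ ρ) (P : Perm (Fin (2 * n))) :
    ∀ a : Spins (2 * n), TorusCont ρ fun z => scattering γ z P a := by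
  induction P using perm_descent_induction with
  | step P ih =>
    intro a
    rcases eq_or_ne P 1 with rfl | hP
    · refine (torusCont_const (singletVector n a)).congr hρ.1 fun z hz => ?_
      rw [(scattering_isScatteringFamily (hρ.admissible hz)).base]
    · obtain ⟨j, k, hjk, hd⟩ := exists_descent hP
      have hne : j ≠ k := by rintro rfl; omega
      have hP' : P k ≠ P j := hd.ne
      have hs := (torusCont_sParam hρ.1 (P k)).sub (torusCont_sParam hρ.1 (P j))
      refine TorusCont.congr (((hs.mul (ih j k hjk hd (a ∘ swap j k))).sub
        ((torusCont_const (2 * γ)).mul (ih j k hjk hd a))).div (hs.sub (torusCont_const (2 * γ)))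
        (fun z hz => (hρ.admissible hz).ne_zero hP') hρ.1) hρ.1 fun z hz => ?_
      have h := scattering_mul_swap (hρ.admissible hz) (P * swap j k) hjk a
      rw [mul_assoc, swap_mul_self, mul_one] at h
      rw [h]
      simp

theorem torusCont_betheWave (hρ : Nested γ ρ) (Q : Perm (Fin (2 * n))) (x : Sites (2 * n))
    (a : Spins (2 * n)) : TorusCont ρ fun z => betheWave γ z Q x a :=
  TorusCont.sum fun P _ => ((torusCont_const _).mul (torusCont_scattering hρ P _)).mul
    (TorusCont.prod fun _ _ => torusCont_zpow hρ.1 _ _)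

theorem torusCont_energy (hρ : ∀ j, 0 < ρ j) : TorusCont ρ fun z => energy γ z := by
  refine TorusCont.sub ((torusCont_const _).mul (TorusCont.sum fun _ _ => ?_)) (torusCont_const _)
  exact ((torusCont_apply _).add ((torusCont_const 1).div (torusCont_apply _)
    (fun _ hz => ne_zero_of_norm_eq hρ hz _) hρ)).div (torusCont_const _) (fun _ _ => by simp) hρ

/-- The plane waves `∏_j z_{2j-1}^{-y_j} z_{2j}^{-y_j}` that carry the initial positions. -/
def initialWave {n : ℕ} (y : Fin n → ℤ) (z : Fin (2 * n) → ℂ) : ℂ :=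
  ∏ j : Fin n, (z (pairFst j) ^ (-y j) * z (pairSnd j) ^ (-y j))

theorem torusCont_initialWave (hρ : ∀ j, 0 < ρ j) (y : Fin n → ℤ) :
    TorusCont ρ (initialWave y) :=
  TorusCont.prod fun _ _ => (torusCont_zpow hρ _ _).mul (torusCont_zpow hρ _ _)

theorem contourFormula_eq_torusMean {r : ℝ} (h0 : 0 < r) (y : Fin n → ℤ) (t : ℝ)
    (Q : Perm (Fin (2 * n))) (x : Sites (2 * n)) (a : Spins (2 * n)) :
    contourFormula γ r y t Q x a = torusMean (radius n r) fun z =>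
      Complex.exp (-Complex.I * energy γ z * t) * (betheWave γ z Q x a * initialWave y z) := by
  have hρ : ∀ j, 0 < radius n r j := fun j => pow_pos h0 _
  rw [contourFormula, torusIntegral, torusMean]
  have h1 : ∀ θ : Fin (2 * n) → ℝ,
      (∏ j, (radius n r j : ℂ) * Complex.exp (θ j * Complex.I) * Complex.I) •
        contourIntegrand γ y t Q x a (torusMap 0 (radius n r) θ)
      = Complex.I ^ (2 * n) * (Complex.exp (-Complex.I * energy γ (torusMap 0 (radius n r) θ) * t)
        * (betheWave γ (torusMap 0 (radius n r) θ) Q x a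
          * initialWave y (torusMap 0 (radius n r) θ))) := by
    intro θ
    have h2 : (∏ j, (radius n r j : ℂ) * Complex.exp (θ j * Complex.I) * Complex.I)
        = (∏ j, torusMap 0 (radius n r) θ j) * Complex.I ^ (2 * n) := by
      rw [Finset.prod_mul_distrib, Finset.prod_const, Finset.card_univ, Fintype.card_fin]
      simp [torusMap]
    have h3 : (∏ j, torusMap 0 (radius n r) θ j) ≠ 0 :=
      Finset.prod_ne_zero_iff.2 fun j _ => ne_zero_of_norm_eq hρ (norm_torusMap hρ θ) j
    rw [h2, contourIntegrand, initialWave, smul_eq_mul, Finset.prod_inv_distrib]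
    field_simp
  simp only [h1]
  rw [integral_const_mul, ← mul_assoc]
  congr 1
  rw [mul_pow, mul_inv, mul_assoc, inv_mul_cancel₀ (pow_ne_zero _ Complex.I_ne_zero), mul_one]

theorem torusIntegrable_contourIntegrand {r : ℝ} (hρ : Nested γ (radius n r)) (y : Fin n → ℤ)
    (t : ℝ) (Q : Perm (Fin (2 * n))) (x : Sites (2 * n)) (a : Spins (2 * n)) :
    TorusIntegrable (contourIntegrand γ y t Q x a) 0 (radius n r) := by
  refine TorusCont.integrableOn (TorusCont.mul (TorusCont.prod fun j _ => ?_) (TorusCont.mul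
    (TorusCont.mul (torusCont_exp ?_) (torusCont_betheWave hρ Q x a))
    (torusCont_initialWave hρ.1 y)))
  · exact (torusCont_apply j).inv (fun z hz => ne_zero_of_norm_eq hρ.1 hz j) hρ.1
  · exact ((torusCont_const _).mul (torusCont_energy hρ.1)).mul (torusCont_const _)

end Contour

section Time

variable {N : ℕ} {ρ : Fin N → ℝ}

theorem TorusCont.exists_bound {F : (Fin N → ℂ) → ℂ} (hF : TorusCont ρ F) :
    ∃ C : ℝ, ∀ z : Fin N → ℂ, (∀ j, ‖z j‖ = ρ j) → ‖F z‖ ≤ C := by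
  obtain ⟨C, hC⟩ := (isCompact_Icc (a := fun _ : Fin N => -Real.pi)
    (b := fun _ : Fin N => Real.pi)).exists_bound_of_continuousOn hF.continuousOn
  refine ⟨C, fun z hz => ?_⟩
  have h := hC (fun j => (z j).arg) ⟨fun j => (Complex.neg_pi_lt_arg _).le,
    fun j => Complex.arg_le_pi _⟩
  have hz' : torusMap 0 ρ (fun j => (z j).arg) = z := by
    funext j
    simp only [torusMap, Pi.zero_apply, zero_add]
    rw [← hz j, Complex.norm_mul_exp_arg_mul_I]
  rwa [hz'] at h

/-- Differentiation of torus means with respect to time. -/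
theorem hasDerivAt_torusMean_exp {E F : (Fin N → ℂ) → ℂ} (hρ : ∀ j, 0 < ρ j)
    (hE : TorusCont ρ E) (hF : TorusCont ρ F) (t : ℝ) :
    HasDerivAt (fun t : ℝ => torusMean ρ fun z => Complex.exp (-Complex.I * E z * t) * F z)
      (torusMean ρ fun z => Complex.exp (-Complex.I * E z * t) * (-Complex.I * E z * F z)) t := by
  obtain ⟨CE, hCE⟩ := hE.exists_bound
  obtain ⟨CF, hCF⟩ := hF.exists_bound
  have hcont : ∀ s : ℝ, TorusCont ρ fun z => Complex.exp (-Complex.I * E z * s) * F z := fun s =>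
    (torusCont_exp (((torusCont_const _).mul hE).mul (torusCont_const _))).mul hF
  have hcont' : TorusCont ρ fun z =>
      Complex.exp (-Complex.I * E z * t) * (-Complex.I * E z * F z) :=
    (torusCont_exp (((torusCont_const _).mul hE).mul (torusCont_const _))).mul
      (((torusCont_const _).mul hE).mul hF)
  have key := hasDerivAt_integral_of_dominated_loc_of_deriv_le
    (μ := volume.restrict (Icc (0 : Fin N → ℝ) fun _ => 2 * Real.pi))
    (F := fun (s : ℝ) (θ : Fin N → ℝ) => Complex.exp (-Complex.I * E (torusMap 0 ρ θ) * s)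
      * F (torusMap 0 ρ θ))
    (F' := fun (s : ℝ) (θ : Fin N → ℝ) => Complex.exp (-Complex.I * E (torusMap 0 ρ θ) * s)
      * (-Complex.I * E (torusMap 0 ρ θ) * F (torusMap 0 ρ θ)))
    (x₀ := t) (s := Metric.ball t 1) (bound := fun _ => Real.exp (CE * (|t| + 1)) * (CE * CF))
    (Metric.ball_mem_nhds t one_pos)
    (Eventually.of_forall fun s => (hcont s).integrableOn.aestronglyMeasurable)
    (hcont t).integrableOn hcont'.integrableOn.aestronglyMeasurable ?_ ?_ ?_
  · exact key.2.const_mul _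
  · refine Eventually.of_forall fun θ s hs => ?_
    have hE1 := hCE _ (norm_torusMap hρ θ)
    have hF1 := hCF _ (norm_torusMap hρ θ)
    have hE0 := norm_nonneg (E (torusMap 0 ρ θ))
    have hs1 : |s| ≤ |t| + 1 := by
      rw [Metric.mem_ball, Real.dist_eq] at hs
      have := abs_sub_abs_le_abs_sub s t
      linarith
    rw [norm_mul, norm_mul, norm_mul, norm_neg, Complex.norm_I, one_mul]
    refine mul_le_mul ?_ (mul_le_mul hE1 hF1 (norm_nonneg _) (hE0.trans hE1)) (by positivity)
      (Real.exp_pos _).le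
    refine (Complex.norm_exp_le_exp_norm _).trans (Real.exp_le_exp.2 ?_)
    rw [norm_mul, norm_mul, norm_neg, Complex.norm_I, one_mul, Complex.norm_real, Real.norm_eq_abs]
    exact mul_le_mul hE1 hs1 (abs_nonneg _) (hE0.trans hE1)
  · exact integrableOn_const (isCompact_Icc.measure_lt_top.ne)
  · refine Eventually.of_forall fun θ s _ => ?_
    have h1 : HasDerivAt (fun s : ℝ => -Complex.I * E (torusMap 0 ρ θ) * (s : ℂ))
        (-Complex.I * E (torusMap 0 ρ θ)) s := by
      simpa using (Complex.ofRealCLM.hasDerivAt (x := s)).const_mul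
        (-Complex.I * E (torusMap 0 ρ θ))
    have h2 := (h1.cexp).mul_const (F (torusMap 0 ρ θ))
    refine h2.congr_deriv ?_
    ring

end Time

/-! ### Vanishing contour integrals -/

/-- The kernel `1 / (s_a - s_b - c)`. -/
def ker {N : ℕ} (c : ℂ) (a b : Fin N) (z : Fin N → ℂ) : ℂ :=
  (sParam (z a) - sParam (z b) - c)⁻¹

theorem sParam_sub_inv {w c : ℂ} (hw : w ≠ 0) :
    (sParam w - c)⁻¹ = 2 * Complex.I * w / (w ^ 2 - 1 - 2 * Complex.I * c * w) := by
  have hI := Complex.I_ne_zero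
  rw [sParam]
  have h : (w - 1 / w) / (2 * Complex.I) - c
      = (w ^ 2 - 1 - 2 * Complex.I * c * w) / (2 * Complex.I * w) := by
    field_simp
  rw [h, inv_div]

theorem denom_ne_zero {w c : ℂ} (h : w ≠ 0 → sParam w ≠ c) :
    w ^ 2 - 1 - 2 * Complex.I * c * w ≠ 0 := by
  have hI := Complex.I_ne_zero
  rcases eq_or_ne w 0 with rfl | hw
  · simp
  intro h0
  apply h hw
  rw [sParam]
  field_simp
  linear_combination h0

theorem differentiableOn_kernel {a : ℝ} {c : ℂ}
    (h : ∀ w, w ≠ 0 → ‖w‖ ≤ a → sParam w ≠ c) :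
    DifferentiableOn ℂ (fun w => (w ^ 2 - 1 - 2 * Complex.I * c * w)⁻¹) (closedBall 0 a) := by
  refine DifferentiableOn.inv (by fun_prop) fun w hw => denom_ne_zero fun h0 => h w h0 ?_
  simpa using hw

section Predicates

variable {N : ℕ} {γ : ℂ} {ρ : Fin N → ℝ} {F G : (Fin N → ℂ) → ℂ} {i k : Fin N}

/-- `F` extends holomorphically in the variable `z_i` to the closed disc that the circle
`|z_i| = ρ_i` bounds. -/
def Hol (ρ : Fin N → ℝ) (i : Fin N) (F : (Fin N → ℂ) → ℂ) : Prop :=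
  ∀ z : Fin N → ℂ, (∀ j, ‖z j‖ = ρ j) → ∃ A : ℂ → ℂ, DifferentiableOn ℂ A (closedBall 0 (ρ i)) ∧
    ∀ w, w ≠ 0 → ‖w‖ ≤ ρ i → F (Function.update z i w) = A w

/-- `F` is orthogonal, on the circle of the variable `z_i`, to all holomorphic functions. -/
def Reg (ρ : Fin N → ℝ) (i : Fin N) (F : (Fin N → ℂ) → ℂ) : Prop :=
  ∀ z : Fin N → ℂ, (∀ j, ‖z j‖ = ρ j) → ∀ A : ℂ → ℂ,
    DifferentiableOn ℂ A (closedBall 0 (ρ i)) →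
    (∮ w in C(0, ρ i), A w * F (Function.update z i w)) = 0

/-- `F` is continuous on the torus, holomorphic in `z_i`, and independent of `z_k`. -/
structure Good (ρ : Fin N → ℝ) (i k : Fin N) (F : (Fin N → ℂ) → ℂ) : Prop where
  cont : TorusCont ρ F
  hol : Hol ρ i F
  indep : ∀ z c, F (Function.update z k c) = F z

theorem circleIntegral_eq_zero {A : ℂ → ℂ} {a : ℝ} (ha : 0 < a)
    (hA : DifferentiableOn ℂ A (closedBall 0 a)) : (∮ w in C(0, a), A w) = 0 := by
  refine Complex.circleIntegral_eq_zero_of_differentiable_on_off_countable ha.le countable_empty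
    hA.continuousOn fun w hw => ?_
  exact hA.differentiableAt (mem_of_superset (isOpen_ball.mem_nhds hw.1) ball_subset_closedBall)

theorem circleIntegral_div_sub {A : ℂ → ℂ} {a : ℝ} (hA : DifferentiableOn ℂ A (closedBall 0 a))
    {p : ℂ} (hp : ‖p‖ < a) (hAp : A p = 0) : (∮ w in C(0, a), A w / (w - p)) = 0 := by
  have h : (∮ w in C(0, a), (w - p)⁻¹ • A w) = (2 * Real.pi * Complex.I : ℂ) • A p :=
    hA.circleIntegral_sub_inv_smul (by simpa using hp)
  rw [hAp, smul_zero] at h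
  refine Eq.trans ?_ h
  refine circleIntegral.integral_congr ((norm_nonneg p).trans hp.le) fun w _ => ?_
  rw [smul_eq_mul, div_eq_inv_mul]

theorem circleIntegral_congr' {f g : ℂ → ℂ} {a : ℝ} (ha : 0 < a)
    (h : ∀ w, w ≠ 0 → ‖w‖ = a → f w = g w) : (∮ w in C(0, a), f w) = ∮ w in C(0, a), g w := by
  refine circleIntegral.integral_congr ha.le fun w hw => ?_
  have hw' : ‖w‖ = a := by simpa using hw
  exact h w (by rw [← norm_pos_iff, hw']; exact ha) hw'

theorem Hol.reg (hρ : ∀ j, 0 < ρ j) (hF : Hol ρ i F) : Reg ρ i F := by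
  intro z hz A hA
  obtain ⟨B, hB, hFB⟩ := hF z hz
  rw [circleIntegral_congr' (hρ i) (g := fun w => A w * B w) fun w h0 hw => by
    rw [hFB w h0 hw.le]]
  exact circleIntegral_eq_zero (hρ i) (hA.mul hB)

theorem Hol.of_indep (h : ∀ z c, F (Function.update z i c) = F z) : Hol ρ i F :=
  fun z _ => ⟨fun _ => F z, differentiableOn_const _, fun w _ _ => h z w⟩

theorem Good.const (c : ℂ) : Good ρ i k fun _ => c :=
  ⟨torusCont_const c, .of_indep fun _ _ => rfl, fun _ _ => rfl⟩

theorem Good.add (hF : Good ρ i k F) (hG : Good ρ i k G) : Good ρ i k fun z => F z + G z := by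
  refine ⟨hF.cont.add hG.cont, fun z hz => ?_, fun z c => by rw [hF.indep, hG.indep]⟩
  obtain ⟨A, hA, hFA⟩ := hF.hol z hz
  obtain ⟨B, hB, hGB⟩ := hG.hol z hz
  exact ⟨_, hA.add hB, fun w h0 hw => by rw [hFA w h0 hw, hGB w h0 hw]; rfl⟩

theorem Good.mul (hF : Good ρ i k F) (hG : Good ρ i k G) : Good ρ i k fun z => F z * G z := by
  refine ⟨hF.cont.mul hG.cont, fun z hz => ?_, fun z c => by rw [hF.indep, hG.indep]⟩
  obtain ⟨A, hA, hFA⟩ := hF.hol z hz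
  obtain ⟨B, hB, hGB⟩ := hG.hol z hz
  exact ⟨_, hA.mul hB, fun w h0 hw => by rw [hFA w h0 hw, hGB w h0 hw]; rfl⟩

theorem Good.neg (hF : Good ρ i k F) : Good ρ i k fun z => -F z := by
  simpa using (Good.const (-1)).mul hF

theorem Good.sub (hF : Good ρ i k F) (hG : Good ρ i k G) : Good ρ i k fun z => F z - G z := by
  simpa [sub_eq_add_neg] using hF.add hG.neg

theorem Good.zpow_other (hρ : ∀ j, 0 < ρ j) {j : Fin N} (hi : j ≠ i) (hk : j ≠ k) (m : ℤ) :
    Good ρ i k fun z => z j ^ m :=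
  ⟨torusCont_zpow hρ j m, .of_indep fun z c => by rw [Function.update_of_ne hi],
    fun z c => by rw [Function.update_of_ne hk]⟩

theorem Good.other {j : Fin N} (hi : j ≠ i) (hk : j ≠ k) : Good ρ i k fun z => z j :=
  ⟨torusCont_apply j, .of_indep fun z c => by rw [Function.update_of_ne hi],
    fun z c => by rw [Function.update_of_ne hk]⟩

theorem Good.self (hik : i ≠ k) : Good ρ i k fun z => z i :=
  ⟨torusCont_apply i, fun z _ => ⟨id, differentiableOn_id, fun w _ _ => by simp⟩,
    fun z c => by rw [Function.update_of_ne hik]⟩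

theorem Good.pow (hF : Good ρ i k F) (m : ℕ) : Good ρ i k fun z => F z ^ m := by
  induction m with
  | zero => simpa using Good.const 1
  | succ m ih => simpa [pow_succ] using ih.mul hF

theorem torusCont_ker (hρ : Nested γ ρ) {c : ℂ} (hc : ‖c‖ ≤ 2 * ‖γ‖) {a b : Fin N} (hab : a < b) :
    TorusCont ρ (ker c a b) :=
  (((torusCont_sParam hρ.1 a).sub (torusCont_sParam hρ.1 b)).sub (torusCont_const c)).inv
    (fun _ hz => sub_ne_zero.2 ((hρ.2 a b hab).sParam_sub_ne (ne_zero_of_norm_eq hρ.1 hz a)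
      (hz a).le (hz b) hc)) hρ.1

theorem Good.ker_other (hρ : Nested γ ρ) {c : ℂ} (hc : ‖c‖ ≤ 2 * ‖γ‖) {a b : Fin N} (hab : a < b)
    (hai : a ≠ i) (hak : a ≠ k) (hbi : b ≠ i) (hbk : b ≠ k) : Good ρ i k (ker c a b) :=
  ⟨torusCont_ker hρ hc hab, .of_indep fun z c => by
      rw [ker, Function.update_of_ne hai, Function.update_of_ne hbi, ker],
    fun z c => by rw [ker, Function.update_of_ne hak, Function.update_of_ne hbk, ker]⟩

theorem hol_ker (hρ : Nested γ ρ) {c : ℂ} (hc : ‖c‖ ≤ 2 * ‖γ‖) {b : Fin N} (hib : i < b) :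
    Hol ρ i (ker c i b) := by
  intro z hz
  refine ⟨fun w => 2 * Complex.I * w * (w ^ 2 - 1 - 2 * Complex.I * (sParam (z b) + c) * w)⁻¹,
    DifferentiableOn.mul (by fun_prop) (differentiableOn_kernel fun w hw0 hw h => ?_),
    fun w hw0 hw => ?_⟩
  · exact (hρ.2 i b hib).sParam_sub_ne hw0 hw (hz b) hc (sub_eq_of_eq_add' h)
  · rw [ker, Function.update_self, Function.update_of_ne hib.ne', sub_sub, sParam_sub_inv hw0,
      div_eq_mul_inv]

theorem Good.ker_self (hρ : Nested γ ρ) {c : ℂ} (hc : ‖c‖ ≤ 2 * ‖γ‖) {b : Fin N} (hib : i < b)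
    (hik : i ≠ k) (hbk : b ≠ k) : Good ρ i k (ker c i b) :=
  ⟨torusCont_ker hρ hc hib, hol_ker hρ hc hib,
    fun z c => by rw [ker, Function.update_of_ne hik, Function.update_of_ne hbk, ker]⟩

theorem circleIntegral_zpow_mul_sParam_pow {a : ℝ} (ha : 0 < a) (l : ℕ) :
    ∀ e : ℤ, e + l < 0 → (∮ w in C(0, a), w⁻¹ * (w ^ e * sParam w ^ l)) = 0 := by
  have hsph : ∀ w ∈ sphere (0 : ℂ) a, w ≠ 0 := by
    intro w hw
    rw [← norm_pos_iff]
    have : ‖w‖ = a := by simpa using hw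
    rwa [this]
  have hci : ∀ (l : ℕ) (e : ℤ),
      CircleIntegrable (fun w : ℂ => w⁻¹ * (w ^ e * sParam w ^ l)) 0 a := by
    intro l e
    refine ContinuousOn.circleIntegrable ha.le ?_
    refine ContinuousOn.mul (continuousOn_id.inv₀ hsph) (ContinuousOn.mul
      (continuousOn_id.zpow₀ e fun w hw => .inl (hsph w hw)) (ContinuousOn.pow ?_ l))
    exact (continuousOn_id.sub (continuousOn_const.div continuousOn_id hsph)).div_const _
  induction l with
  | zero =>
    intro e he
    rw [circleIntegral_congr' ha (g := fun w => (w - 0) ^ (e - 1)) fun w hw0 _ => by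
      rw [sub_zero, pow_zero, mul_one, zpow_sub_one₀ hw0, mul_comm]]
    refine circleIntegral.integral_sub_zpow_of_ne ?_ _ _ _
    have : e < 0 := by simpa using he
    omega
  | succ l ih =>
    intro e he
    push_cast at he
    rw [circleIntegral_congr' ha (g := fun w => (2 * Complex.I)⁻¹ *
      (w⁻¹ * (w ^ (e + 1) * sParam w ^ l) - w⁻¹ * (w ^ (e - 1) * sParam w ^ l))) fun w hw0 _ => ?_]
    · rw [circleIntegral.integral_const_mul, circleIntegral.integral_sub (hci _ _) (hci _ _),
        ih _ (by omega), ih _ (by omega), sub_zero, mul_zero]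
    · rw [zpow_add_one₀ hw0, zpow_sub_one₀ hw0, pow_succ, sParam]
      have hI := Complex.I_ne_zero
      field_simp

end Predicates

section Vanishing

variable {N : ℕ} {γ : ℂ} {ρ : Fin N → ℝ} {i k : Fin N}

/-- If the variable `z_k` of an outer contour enters as a power and the integrand has a zero of
one order more in the variable `z_i`, then the mean vanishes: for a nonzero power by the mean over
`z_k`, otherwise by Cauchy's theorem for `z_i`. -/
theorem torusMean_zpow_eq_zero (hρ : ∀ j, 0 < ρ j) (hik : i ≠ k) (e : ℤ)
    {h : (Fin N → ℂ) → ℂ} (hc : TorusCont ρ h) (hreg : Reg ρ i h)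
    (hind : ∀ z c, h (Function.update z k c) = h z) :
    torusMean ρ (fun z => z k ^ e * (z i ^ (e + 1) * h z)) = 0 := by
  have hcont : TorusCont ρ fun z => z k ^ e * (z i ^ (e + 1) * h z) :=
    (torusCont_zpow hρ k e).mul ((torusCont_zpow hρ i _).mul hc)
  rcases eq_or_ne e 0 with rfl | he
  · refine torusMean_eq_zero_of_circle hρ hcont i fun z hz => ?_
    rw [circleIntegral_congr' (hρ i) (g := fun w => 1 * h (Function.update z i w))
      fun w hw0 _ => ?_]
    · exact hreg z hz _ (differentiableOn_const _)
    · simp [hw0]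
  · refine torusMean_eq_zero_of_circle hρ hcont k fun z hz => ?_
    simp only [Function.update_self, Function.update_of_ne hik, hind]
    rw [circleIntegral_congr' (hρ k) (g := fun w => (z i ^ (e + 1) * h z) * (w - 0) ^ (e - 1))
      fun w hw0 _ => by rw [sub_zero, zpow_sub_one₀ hw0]; ring]
    rw [circleIntegral.integral_const_mul, circleIntegral.integral_sub_zpow_of_ne (by omega),
      mul_zero]

/-- The basic vanishing lemma. In `z_k^e / (s_i - s_k - 2γ)` with `e < 0` the kernel may be
replaced by `(s_k / (s_i - 2γ))^m / (s_i - s_k - 2γ)`, `m = -e`, because the difference is a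
polynomial in `s_k` of degree below `m`, which the mean over `z_k` annihilates. Now there are
enough zeros at `z_i = 0` for Cauchy's theorem in the inner variable `z_i`. -/
theorem torusMean_ker_eq_zero (hρ : Nested γ ρ) (hik : i < k) (e : ℤ)
    {h : (Fin N → ℂ) → ℂ} (hc : TorusCont ρ h) (hreg : Reg ρ i h)
    (hind : ∀ z c, h (Function.update z k c) = h z) :
    torusMean ρ (fun z => z k ^ e * (ker (2 * γ) i k z * (z i ^ e * h z))) = 0 := by
  have hc2 : ‖2 * γ‖ ≤ 2 * ‖γ‖ := (norm_two_mul γ).le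
  have hD := hρ.2 i k hik
  obtain ⟨m, p, hmp, hm⟩ : ∃ m p : ℕ, (p : ℤ) = m + e ∧ (m = 0 ∨ e + m ≤ 0) := by
    rcases le_total 0 e with he | he
    · exact ⟨0, e.toNat, by omega, .inl rfl⟩
    · exact ⟨(-e).toNat, 0, by omega, .inr (by omega)⟩
  have hσ : ∀ w : ℂ, w ≠ 0 → ‖w‖ ≤ ρ i → sParam w - 2 * γ ≠ 0 := by
    intro w h0 hw h
    have h1 := hD.norm_sParam h0 hw
    rw [sub_eq_zero.1 h, norm_two_mul] at h1
    exact lt_irrefl _ h1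
  have hκ : ∀ z : Fin N → ℂ, (∀ j, ‖z j‖ = ρ j) → sParam (z i) - sParam (z k) - 2 * γ ≠ 0 :=
    fun z hz => sub_ne_zero.2 (hD.sParam_sub_ne (ne_zero_of_norm_eq hρ.1 hz i) (hz i).le (hz k) hc2)
  have cσ : TorusCont ρ fun z => (sParam (z i) - 2 * γ)⁻¹ :=
    ((torusCont_sParam hρ.1 i).sub (torusCont_const _)).inv
      (fun z hz => hσ _ (ne_zero_of_norm_eq hρ.1 hz i) (hz i).le) hρ.1
  have c1 : ∀ l ∈ Finset.range m, TorusCont ρ fun z => (z k ^ e * sParam (z k) ^ l) *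
      ((sParam (z i) - 2 * γ)⁻¹ ^ (l + 1) * (z i ^ e * h z)) := fun l _ =>
    ((torusCont_zpow hρ.1 k e).mul ((torusCont_sParam hρ.1 k).pow l)).mul
      ((cσ.pow (l + 1)).mul ((torusCont_zpow hρ.1 i e).mul hc))
  have c2 : TorusCont ρ fun z => z k ^ e * (ker (2 * γ) i k z *
      ((sParam (z k) * (sParam (z i) - 2 * γ)⁻¹) ^ m * (z i ^ e * h z))) :=
    (torusCont_zpow hρ.1 k e).mul ((torusCont_ker hρ hc2 hik).mul
      ((((torusCont_sParam hρ.1 k).mul cσ).pow m).mul ((torusCont_zpow hρ.1 i e).mul hc)))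
  have split : ∀ z : Fin N → ℂ, (∀ j, ‖z j‖ = ρ j) →
      z k ^ e * (ker (2 * γ) i k z * (z i ^ e * h z))
      = ∑ l ∈ Finset.range m, (z k ^ e * sParam (z k) ^ l) *
          ((sParam (z i) - 2 * γ)⁻¹ ^ (l + 1) * (z i ^ e * h z))
        + z k ^ e * (ker (2 * γ) i k z *
          ((sParam (z k) * (sParam (z i) - 2 * γ)⁻¹) ^ m * (z i ^ e * h z))) := by
    intro z hz
    have n1 := hσ _ (ne_zero_of_norm_eq hρ.1 hz i) (hz i).le
    have n2 := hκ z hz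
    have hgeom := geom_sum_mul (sParam (z k) * (sParam (z i) - 2 * γ)⁻¹) m
    have hsum : ∑ l ∈ Finset.range m, (z k ^ e * sParam (z k) ^ l) *
          ((sParam (z i) - 2 * γ)⁻¹ ^ (l + 1) * (z i ^ e * h z))
        = (∑ l ∈ Finset.range m, (sParam (z k) * (sParam (z i) - 2 * γ)⁻¹) ^ l)
          * ((sParam (z i) - 2 * γ)⁻¹ * (z k ^ e * (z i ^ e * h z))) := by
      rw [Finset.sum_mul]
      refine Finset.sum_congr rfl fun l _ => ?_
      ring
    rw [hsum]
    generalize hS : ∑ l ∈ Finset.range m, (sParam (z k) * (sParam (z i) - 2 * γ)⁻¹) ^ l = S at *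
    generalize (sParam (z k) * (sParam (z i) - 2 * γ)⁻¹) ^ m = q at *
    have hk : ker (2 * γ) i k z * (sParam (z i) - sParam (z k) - 2 * γ) = 1 := inv_mul_cancel₀ n2
    have hσ1 : (sParam (z i) - 2 * γ)⁻¹ * (sParam (z i) - 2 * γ) = 1 := inv_mul_cancel₀ n1
    generalize (sParam (z i) - 2 * γ)⁻¹ = τ at *
    generalize ker (2 * γ) i k z = κ at *
    generalize sParam (z k) = sk at *
    generalize sParam (z i) = si at *
    have hq : q = S * (sk * τ - 1) + 1 := by linear_combination -hgeom
    have : κ = S * τ + κ * q := by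
      rw [hq]
      linear_combination (S * τ) * hk - S * κ * hσ1
    linear_combination (z k ^ e * (z i ^ e * h z)) * this
  rw [torusMean_congr hρ.1 split, torusMean_add (TorusCont.sum c1) c2, torusMean_sum _ c1]
  have z1 : ∀ l ∈ Finset.range m, torusMean ρ (fun z => (z k ^ e * sParam (z k) ^ l) *
      ((sParam (z i) - 2 * γ)⁻¹ ^ (l + 1) * (z i ^ e * h z))) = 0 := by
    intro l hl
    have hlm := Finset.mem_range.1 hl
    refine torusMean_eq_zero_of_circle hρ.1 (c1 l hl) k fun z hz => ?_
    simp only [Function.update_self, Function.update_of_ne hik.ne, hind]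
    rw [circleIntegral_congr' (hρ.1 k) (g := fun w =>
      ((sParam (z i) - 2 * γ)⁻¹ ^ (l + 1) * (z i ^ e * h z)) * (w⁻¹ * (w ^ e * sParam w ^ l)))
      fun w _ _ => by ring]
    rw [circleIntegral.integral_const_mul,
      circleIntegral_zpow_mul_sParam_pow (hρ.1 k) l e (by omega),
      mul_zero]
  have z2 : torusMean ρ (fun z => z k ^ e * (ker (2 * γ) i k z *
      ((sParam (z k) * (sParam (z i) - 2 * γ)⁻¹) ^ m * (z i ^ e * h z)))) = 0 := by
    refine torusMean_eq_zero_of_circle hρ.1 c2 i fun z hz => ?_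
    rw [circleIntegral_congr' (hρ.1 i) (g := fun w => (z k ^ e * (2 * Complex.I *
        (w ^ 2 - 1 - 2 * Complex.I * (sParam (z k) + 2 * γ) * w)⁻¹ * ((sParam (z k) *
        (2 * Complex.I * (w ^ 2 - 1 - 2 * Complex.I * (2 * γ) * w)⁻¹)) ^ m * w ^ p))) *
        h (Function.update z i w)) fun w hw0 hw => ?_]
    · refine hreg z hz _ ?_
      refine DifferentiableOn.mul (by fun_prop) (DifferentiableOn.mul (DifferentiableOn.mul
        (by fun_prop) (differentiableOn_kernel fun w hw0 hw h => ?_)) (DifferentiableOn.mul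
        (DifferentiableOn.pow (DifferentiableOn.mul (by fun_prop) (DifferentiableOn.mul
        (by fun_prop) (differentiableOn_kernel fun w hw0 hw h => ?_))) m) (by fun_prop)))
      · exact hD.sParam_sub_ne hw0 hw (hz k) hc2 (sub_eq_of_eq_add' h)
      · exact hσ w hw0 hw (sub_eq_zero.2 h)
    · have hpow : w ^ e * w ^ m = w ^ p := by
        rw [← zpow_natCast w p, hmp, zpow_add₀ hw0, zpow_natCast, mul_comm]
      rw [ker, Function.update_self, Function.update_of_ne hik.ne', sub_sub, sParam_sub_inv hw0,
        sParam_sub_inv hw0, ← hpow]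
      simp only [mul_pow, div_eq_mul_inv]
      field_simp
  rw [z2, Finset.sum_eq_zero z1, add_zero]

end Vanishing

/-! ### Functions of mean zero -/

section Null

variable {N : ℕ} {γ : ℂ} {ρ : Fin N → ℝ} {F G h : (Fin N → ℂ) → ℂ} {i k : Fin N}

/-- Continuous functions of mean zero. -/
def Null (ρ : Fin N → ℝ) (F : (Fin N → ℂ) → ℂ) : Prop := TorusCont ρ F ∧ torusMean ρ F = 0

theorem Null.add (hF : Null ρ F) (hG : Null ρ G) : Null ρ fun z => F z + G z :=
  ⟨hF.1.add hG.1, by rw [torusMean_add hF.1 hG.1, hF.2, hG.2, add_zero]⟩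

theorem Null.const_mul (hF : Null ρ F) (c : ℂ) : Null ρ fun z => c * F z :=
  ⟨(torusCont_const c).mul hF.1, by rw [torusMean_const_mul, hF.2, mul_zero]⟩

theorem Null.congr (hF : Null ρ F) (hρ : ∀ j, 0 < ρ j)
    (h : ∀ z : Fin N → ℂ, (∀ j, ‖z j‖ = ρ j) → F z = G z) : Null ρ G :=
  ⟨hF.1.congr hρ h, by rw [← torusMean_congr hρ h, hF.2]⟩

/-- A free term, in which `z_k` enters only as a power, has mean zero. -/
theorem null_zpow (hρ : Nested γ ρ) (hik : i < k) (e : ℤ) (hh : Good ρ i k h) :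
    Null ρ fun z => z k ^ e * (z i ^ e * (z i * h z)) := by
  have h1 : Null ρ fun z => z k ^ e * (z i ^ (e + 1) * h z) :=
    ⟨(torusCont_zpow hρ.1 k e).mul ((torusCont_zpow hρ.1 i _).mul hh.cont),
      torusMean_zpow_eq_zero hρ.1 hik.ne e hh.cont (hh.hol.reg hρ.1) hh.indep⟩
  refine h1.congr hρ.1 fun z hz => ?_
  rw [zpow_add_one₀ (ne_zero_of_norm_eq hρ.1 hz i)]
  ring

/-- A term with the kernel `1 / (s_i - s_k - 2γ)` and a holomorphic numerator has mean zero. -/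
theorem null_ker (hρ : Nested γ ρ) (hik : i < k) (e : ℤ) (hh : Good ρ i k h) :
    Null ρ fun z => z k ^ e * (ker (2 * γ) i k z * (z i ^ e * h z)) :=
  ⟨(torusCont_zpow hρ.1 k e).mul ((torusCont_ker hρ (norm_two_mul γ).le hik).mul
    ((torusCont_zpow hρ.1 i e).mul hh.cont)),
    torusMean_ker_eq_zero hρ hik e hh.cont (hh.hol.reg hρ.1) hh.indep⟩

/-- A numerator that vanishes at `z_i = z_p` compensates the pole of `1 / (s_p - s_i)`. -/
theorem reg_ker_mul (hρ : Nested γ ρ) {p : Fin N} (hpi : p < i) (hh : Hol ρ i h)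
    (h0 : ∀ z : Fin N → ℂ, (∀ j, ‖z j‖ = ρ j) → h (Function.update z i (z p)) = 0) :
    Reg ρ i fun z => ker 0 p i z * h z := by
  intro z hz A hA
  obtain ⟨B, hB, hhB⟩ := hh z hz
  have hz0 := ne_zero_of_norm_eq hρ.1 hz
  have hlt := (hρ.2 p i hpi).lt
  have hone : ∀ w : ℂ, ‖w‖ ≤ ρ i → 1 + z p * w ≠ 0 := by
    intro w hw h
    have h1 : z p * w = -1 := by linear_combination h
    have h2 : ‖z p‖ * ‖w‖ = 1 := by rw [← norm_mul, h1, norm_neg, norm_one]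
    rw [hz] at h2
    have h3 := (hρ.2 p i hpi).2.2
    have h4 := (hρ.2 p i hpi).1
    nlinarith [norm_nonneg w]
  have hC : DifferentiableOn ℂ (fun w => -(2 * Complex.I * z p * w) * (1 + z p * w)⁻¹)
      (closedBall 0 (ρ i)) := by
    refine DifferentiableOn.mul (by fun_prop) (DifferentiableOn.inv (by fun_prop) fun w hw => ?_)
    exact hone w (by simpa using hw)
  have e1 := circleIntegral_div_sub (hA.mul (hC.mul hB)) (p := z p) (by rw [hz]; exact hlt) (by
    have : B (z p) = 0 := by rw [← hhB _ (hz0 p) (by rw [hz]; exact hlt.le), h0 z hz]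
    simp [this])
  refine Eq.trans ?_ e1
  refine circleIntegral_congr' (hρ.1 i) fun w hw0 hw => ?_
  have n1 : w - z p ≠ 0 := sub_ne_zero.2 fun h => hlt.ne (by rw [← hz p, ← h, hw])
  have n2 := hone w hw.le
  have n3 := hz0 p
  have hs : sParam (z p) - sParam w = -((w - z p) * (1 + z p * w)) / (2 * Complex.I * z p * w) := by
    have hI := Complex.I_ne_zero
    rw [sParam, sParam]
    field_simp
    ring
  simp only [ker, Function.update_self, Function.update_of_ne hpi.ne, sub_zero, Pi.mul_apply,
    hhB w hw0 hw.le]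
  rw [hs, inv_div]
  field_simp

/-- As `null_ker`, with an additional pole at `z_i = z_p` which the numerator compensates. -/
theorem null_ker_pole (hρ : Nested γ ρ) {p : Fin N} (hpi : p < i) (hik : i < k) (e : ℤ)
    (hh : Good ρ i k h)
    (h0 : ∀ z : Fin N → ℂ, (∀ j, ‖z j‖ = ρ j) → h (Function.update z i (z p)) = 0) :
    Null ρ fun z => z k ^ e * (ker (2 * γ) i k z * (z i ^ e * (ker 0 p i z * h z))) := by
  have hc : TorusCont ρ fun z => ker 0 p i z * h z :=
    (torusCont_ker hρ (by simp) hpi).mul hh.cont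
  refine ⟨(torusCont_zpow hρ.1 k e).mul ((torusCont_ker hρ (norm_two_mul γ).le hik).mul
    ((torusCont_zpow hρ.1 i e).mul hc)), torusMean_ker_eq_zero hρ hik e hc
    (reg_ker_mul hρ hpi hh.hol h0) fun z c => ?_⟩
  rw [hh.indep, ker, ker, Function.update_of_ne (hpi.trans hik).ne, Function.update_of_ne hik.ne]

end Null

/-! ### Relations between kernels -/

section Relations

variable {N : ℕ} {γ : ℂ} {ρ : Fin N → ℝ} {z : Fin N → ℂ}

theorem ker_mul_eq_one (hρ : Nested γ ρ) (hz : ∀ j, ‖z j‖ = ρ j) {c : ℂ} (hc : ‖c‖ ≤ 2 * ‖γ‖)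
    {a b : Fin N} (hab : a < b) : ker c a b z * (sParam (z a) - sParam (z b) - c) = 1 :=
  inv_mul_cancel₀ (sub_ne_zero.2 ((hρ.2 a b hab).sParam_sub_ne (ne_zero_of_norm_eq hρ.1 hz a)
    (hz a).le (hz b) hc))

/-- Partial fractions in the variable `s_k`. -/
theorem ker_mul_ker (hρ : Nested γ ρ) (hz : ∀ j, ‖z j‖ = ρ j) {c : ℂ} (hc : ‖c‖ ≤ 2 * ‖γ‖)
    {p q k : Fin N} (hpq : p < q) (hqk : q < k) :
    ker c p k z * ker c q k z = (ker c q k z - ker c p k z) * ker 0 p q z := by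
  have h1 := ker_mul_eq_one hρ hz hc (hpq.trans hqk)
  have h2 := ker_mul_eq_one hρ hz hc hqk
  have h3 := ker_mul_eq_one hρ hz (c := 0) (by simp) hpq
  linear_combination (ker c q k z * ker 0 p q z) * h1 - (ker c p k z * ker 0 p q z) * h2
    - (ker c p k z * ker c q k z) * h3

theorem ker_eq (hρ : Nested γ ρ) (hz : ∀ j, ‖z j‖ = ρ j) {a b : Fin N} (hab : a < b) :
    ker (2 * γ) a b z = ker 0 a b z + 2 * γ * ker (2 * γ) a b z * ker 0 a b z := by
  have h1 := ker_mul_eq_one hρ hz (norm_two_mul γ).le hab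
  have h3 := ker_mul_eq_one hρ hz (c := 0) (by simp) hab
  linear_combination ker 0 a b z * h1 - ker (2 * γ) a b z * h3

end Relations

/-! ### Cancellations between the permutations -/

section Cancel

variable {N : ℕ} {γ : ℂ} {ρ : Fin N → ℝ}

/-- `α = l / (l - 2γ)` at `l = s_a - s_b`, so that `Y = 1 - α (1 - Π)`. -/
def al (γ : ℂ) {N : ℕ} (a b : Fin N) (z : Fin N → ℂ) : ℂ := 1 + 2 * γ * ker (2 * γ) a b z

/-- `(l + 2γ) / (l - 2γ)` at `l = s_a - s_b`. -/
def sc (γ : ℂ) {N : ℕ} (a b : Fin N) (z : Fin N → ℂ) : ℂ := 1 + 4 * γ * ker (2 * γ) a b z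

theorem Good.al_of_ker {i k a b : Fin N} (h : Good ρ i k (ker (2 * γ) a b)) :
    Good ρ i k (al γ a b) := (Good.const _).add ((Good.const _).mul h)

theorem Good.sc_of_ker {i k a b : Fin N} (h : Good ρ i k (ker (2 * γ) a b)) :
    Good ρ i k (sc γ a b) := (Good.const _).add ((Good.const _).mul h)

/-- Two of the three-variable amplitudes: the variable `k` stands to the left of the smaller
variable `q`, and `l` is to the right of `k`. -/
def thetaPoly (v w ak al : ℂ) (A B : ℂ) : ℂ :=
  -(v - ak * w) * A + ((1 - 2 * al + ak * al) * v - ak * w) * B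

/-- Splitting `al γ q k` into its constant and its kernel leaves terms without poles inside the
circle of `z_q`. -/
theorem theta_null (hρ : Nested γ ρ) {q k l : Fin N} (hqk : q < k) (hql : q < l) (hkl : k ≠ l)
    {S : (Fin N → ℂ) → ℂ} (hS : Good ρ q k S) (e : ℤ) (u u' : ℕ) (v w : ℂ) :
    Null ρ fun z => S z * (z k ^ e * (z q ^ e * z q)) * thetaPoly v w (al γ q k z) (al γ q l z)
      (z q ^ u * z l ^ u') (z l ^ u * z q ^ u') := by
  have hc2 := (norm_two_mul γ).le
  have gL : Good ρ q k (al γ q l) := (Good.ker_self hρ hc2 hql hqk.ne hkl.symm).al_of_ker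
  have gq : Good ρ q k fun z => z q := .self hqk.ne
  have gl : Good ρ q k fun z => z l := .other hql.ne' hkl.symm
  have h0 := null_zpow hρ hqk e (h := fun z => S z * (-(v - w) * (z q ^ u * z l ^ u')
    + ((1 - al γ q l z) * v - w) * (z l ^ u * z q ^ u'))) (by
      repeat' first
        | assumption | apply Good.const | apply Good.add | apply Good.sub | apply Good.mul
        | apply Good.neg | apply Good.pow)
  have h1 := null_ker hρ hqk e (h := fun z => z q * (S z * (w * (z q ^ u * z l ^ u')
    + (al γ q l z * v - w) * (z l ^ u * z q ^ u')))) (by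
      repeat' first
        | assumption | apply Good.const | apply Good.add | apply Good.sub | apply Good.mul
        | apply Good.neg | apply Good.pow)
  refine (h0.add (h1.const_mul (2 * γ))).congr hρ.1 fun z _ => ?_
  have : al γ q k z = 1 + 2 * γ * ker (2 * γ) q k z := rfl
  rw [thetaPoly, this]
  ring

theorem one_sub_two_al (hρ : Nested γ ρ) {z : Fin N → ℂ} (hz : ∀ j, ‖z j‖ = ρ j) {a b : Fin N}
    (hab : a < b) : 1 - 2 * al γ a b z + al γ a b z * (1 + 2 * γ * ker 0 a b z) = 0 := by
  have := ker_eq hρ hz hab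
  rw [al]
  linear_combination -2 * γ * this

/-- With the additional kernel in `s_l - s_k`, partial fractions in `s_k` produce the factor
`1 / (s_q - s_l)`. In the term with the kernel in `s_l - s_k`, its pole at `z_l = z_q` lies inside
the circle of `z_l`, but the two monomials coincide there and cancel. -/
theorem theta_ker_null (hρ : Nested γ ρ) {q k l : Fin N} (hql : q < l) (hlk : l < k)
    {S : (Fin N → ℂ) → ℂ} (hS : Good ρ q k S) (hS' : Good ρ l k S) (e : ℤ) (d u u' : ℕ)
    (v w : ℂ) :
    Null ρ fun z => ker (2 * γ) l k z * (S z * (z k ^ e * (z l ^ e * (z q ^ e * z q ^ d)))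
      * thetaPoly v w (al γ q k z) (al γ q l z) (z q ^ u * z l ^ u') (z l ^ u * z q ^ u')) := by
  have hc2 := (norm_two_mul γ).le
  have hc0 : ‖(0 : ℂ)‖ ≤ 2 * ‖γ‖ := by simp
  have hqk := hql.trans hlk
  have h1 : Null ρ _ := null_ker hρ hlk e (h := fun z => S z * (z q ^ e * (z q ^ d *
      (-v * (z q ^ u * z l ^ u') + w * (z q ^ u * z l ^ u' - z l ^ u * z q ^ u'))))) (by
    have gq : Good ρ l k fun z => z q := .other hql.ne hqk.ne
    have gqe : Good ρ l k fun z => z q ^ e := .zpow_other hρ.1 hql.ne hqk.ne e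
    have gl : Good ρ l k fun z => z l := .self hlk.ne
    repeat' first
      | assumption | apply Good.const | apply Good.add | apply Good.sub | apply Good.mul
      | apply Good.neg | apply Good.pow)
  have h2 : Null ρ _ := null_ker_pole hρ hql hlk e (h := fun z => S z * (z q ^ e * (z q ^ d *
      (w * (z q ^ u * z l ^ u' - z l ^ u * z q ^ u'))))) (by
    have gq : Good ρ l k fun z => z q := .other hql.ne hqk.ne
    have gqe : Good ρ l k fun z => z q ^ e := .zpow_other hρ.1 hql.ne hqk.ne e
    have gl : Good ρ l k fun z => z l := .self hlk.ne
    repeat' first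
      | assumption | apply Good.const | apply Good.add | apply Good.sub | apply Good.mul
      | apply Good.neg | apply Good.pow) (by
    intro z _
    simp only [Function.update_self, Function.update_of_ne hql.ne]
    ring)
  have h3 : Null ρ _ := null_ker hρ hqk e (h := fun z => S z * (z l ^ e * (z q ^ d *
      (ker 0 q l z * (w * (z q ^ u * z l ^ u')
        + (al γ q l z * v - w) * (z l ^ u * z q ^ u')))))) (by
    have gq : Good ρ q k fun z => z q := .self hqk.ne
    have gle : Good ρ q k fun z => z l ^ e := .zpow_other hρ.1 hql.ne' hlk.ne e
    have gl : Good ρ q k fun z => z l := .other hql.ne' hlk.ne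
    have gk : Good ρ q k (ker 0 q l) := .ker_self hρ hc0 hql hqk.ne hlk.ne
    have ga : Good ρ q k (al γ q l) := (Good.ker_self hρ hc2 hql hqk.ne hlk.ne).al_of_ker
    repeat' first
      | assumption | apply Good.const | apply Good.add | apply Good.sub | apply Good.mul
      | apply Good.neg | apply Good.pow)
  refine ((h1.add (h2.const_mul (2 * γ))).add (h3.const_mul (-(2 * γ)))).congr hρ.1 fun z hz => ?_
  have r1 := ker_mul_ker hρ hz hc2 hql hlk
  have r2 := one_sub_two_al hρ hz hql
  have e1 : al γ q k z = 1 + 2 * γ * ker (2 * γ) q k z := rfl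
  rw [thetaPoly, e1]
  generalize al γ q l z = L at *
  linear_combination (-(S z * z k ^ e * z l ^ e * z q ^ e * z q ^ d * ker (2 * γ) l k z *
      (v * (z l ^ u * z q ^ u')))) * r2
    - (S z * z k ^ e * z l ^ e * z q ^ e * z q ^ d * 2 * γ *
      (w * (z q ^ u * z l ^ u') + (L * v - w) * (z l ^ u * z q ^ u'))) * r1

end Cancel

/-! ### The four-variable amplitudes -/

section FourVariables

variable {N : ℕ} {γ : ℂ} {ρ : Fin N → ℝ}

/-- Three of the four-variable amplitudes: both variables `k` and `l` stand to the left of at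
least one of the smaller variables `p` and `q`. The arguments `ap, aq, L, M` are the values of
`al` at the pairs `(p, k), (q, k), (q, l), (p, l)`. -/
def crossPoly (v w ap aq L M m1 m2 m3 : ℂ) : ℂ :=
  ((1 - 2 * ap + ap * aq) * v - aq * w) * m1
    - (((1 - 2 * L + aq * L) * (1 - 2 * ap) + ap * aq) * v - aq * w) * m2
    + (((1 - 2 * L + aq * L) * (1 - 2 * ap) + ap * aq) * v - aq * w
      - M * ((1 - 2 * L + aq * L) * (1 - 2 * ap) + ap * aq - 2 * aq) * w) * m3

/-- The value of `crossPoly` at `ap = aq = 1`. -/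
def crossBase (v w L M m1 m2 m3 : ℂ) : ℂ :=
  -w * m1 - (L * v - w) * m2 + (L * (v - M * w) - (1 - 2 * M) * w) * m3

/-- The coefficient of `(ap - 1) (aq - 1)` in `crossPoly`. -/
def crossTop (v w L M m1 m2 m3 : ℂ) : ℂ :=
  v * m1 - (1 - 2 * L) * v * m2 + (1 - 2 * L) * (v - M * w) * m3

/-- The symmetrization of `crossPoly` over the pair `p, q`. -/
def crossSum (γ v w : ℂ) (u₂ u₃ u₄ : ℕ) (p q k l : Fin N) (z : Fin N → ℂ) : ℂ :=
  crossPoly v w (al γ p k z) (al γ q k z) (al γ q l z) (al γ p l z)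
      (z p ^ u₂ * z q ^ u₃ * z l ^ u₄) (z p ^ u₂ * z l ^ u₃ * z q ^ u₄)
      (z l ^ u₂ * z p ^ u₃ * z q ^ u₄)
    + sc γ p q z * crossPoly v w (al γ q k z) (al γ p k z) (al γ p l z) (al γ q l z)
      (z q ^ u₂ * z p ^ u₃ * z l ^ u₄) (z q ^ u₂ * z l ^ u₃ * z p ^ u₄)
      (z l ^ u₂ * z q ^ u₃ * z p ^ u₄)

/-- `crossBase` as a function of the variables. -/
def crossBaseFn (γ v w : ℂ) (u₂ u₃ u₄ : ℕ) (p q l : Fin N) (z : Fin N → ℂ) : ℂ :=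
  crossBase v w (al γ q l z) (al γ p l z)
      (z p ^ u₂ * z q ^ u₃ * z l ^ u₄) (z p ^ u₂ * z l ^ u₃ * z q ^ u₄)
      (z l ^ u₂ * z p ^ u₃ * z q ^ u₄)

/-- The antisymmetrization of `crossTop` over the pair `p, q`. -/
def crossTopFn (γ v w : ℂ) (u₂ u₃ u₄ : ℕ) (p q l : Fin N) (z : Fin N → ℂ) : ℂ :=
  crossTop v w (al γ q l z) (al γ p l z)
      (z p ^ u₂ * z q ^ u₃ * z l ^ u₄) (z p ^ u₂ * z l ^ u₃ * z q ^ u₄)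
      (z l ^ u₂ * z p ^ u₃ * z q ^ u₄)
    - crossTop v w (al γ p l z) (al γ q l z)
      (z q ^ u₂ * z p ^ u₃ * z l ^ u₄) (z q ^ u₂ * z l ^ u₃ * z p ^ u₄)
      (z l ^ u₂ * z q ^ u₃ * z p ^ u₄)

theorem sc_mul (hρ : Nested γ ρ) {z : Fin N → ℂ} (hz : ∀ j, ‖z j‖ = ρ j) {a b : Fin N}
    (hab : a < b) : sc γ a b z * (1 - 2 * γ * ker 0 a b z) = 1 + 2 * γ * ker 0 a b z := by
  have := ker_eq hρ hz hab
  rw [sc]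
  linear_combination 4 * γ * this

/-- Partial fractions in `s_k`. The residue at `s_q - s_k = 2γ` has a pole at `z_q = z_p` only
through `ker 0 p q`, and there its numerator `crossTopFn` vanishes. -/
theorem crossSum_eq (hρ : Nested γ ρ) {z : Fin N → ℂ} (hz : ∀ j, ‖z j‖ = ρ j) {p q k l : Fin N}
    (hpq : p < q) (hqk : q < k) (v w : ℂ) (u₂ u₃ u₄ : ℕ) :
    crossSum γ v w u₂ u₃ u₄ p q k l z =
      crossBaseFn γ v w u₂ u₃ u₄ p q l z + sc γ p q z * crossBaseFn γ v w u₂ u₃ u₄ q p l z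
      + 2 * γ * ker (2 * γ) p k z * (sc γ p q z * crossBaseFn γ v w u₂ u₃ u₄ q p l z
        - (1 + 2 * γ * ker 0 p q z) * crossTopFn γ v w u₂ u₃ u₄ p q l z)
      + 2 * γ * ker (2 * γ) q k z * (crossBaseFn γ v w u₂ u₃ u₄ p q l z
        + (1 + 2 * γ * ker 0 p q z) * crossTopFn γ v w u₂ u₃ u₄ p q l z) := by
  have r1 := ker_mul_ker hρ hz (norm_two_mul γ).le hpq hqk
  have r2 := sc_mul hρ hz hpq
  have e1 : al γ p k z = 1 + 2 * γ * ker (2 * γ) p k z := rfl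
  have e2 : al γ q k z = 1 + 2 * γ * ker (2 * γ) q k z := rfl
  simp only [crossSum, crossBaseFn, crossTopFn, crossPoly, e1, e2]
  generalize z p ^ u₂ * z q ^ u₃ * z l ^ u₄ = m1
  generalize z p ^ u₂ * z l ^ u₃ * z q ^ u₄ = m2
  generalize z l ^ u₂ * z p ^ u₃ * z q ^ u₄ = m3
  generalize z q ^ u₂ * z p ^ u₃ * z l ^ u₄ = m1'
  generalize z q ^ u₂ * z l ^ u₃ * z p ^ u₄ = m2'
  generalize z l ^ u₂ * z q ^ u₃ * z p ^ u₄ = m3'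
  generalize al γ q l z = L
  generalize al γ p l z = M
  generalize ker (2 * γ) p k z = Kp at *
  generalize ker (2 * γ) q k z = Kq at *
  generalize ker 0 p q z = δ at *
  generalize sc γ p q z = F at *
  simp only [crossBase, crossTop]
  linear_combination (4 * γ ^ 2 * ((v * m1 - (1 - 2 * L) * v * m2 + (1 - 2 * L) * (v - M * w) * m3)
      + F * (v * m1' - (1 - 2 * M) * v * m2' + (1 - 2 * M) * (v - L * w) * m3'))) * r1
    + (2 * γ * (Kp - Kq) * (v * m1' - (1 - 2 * M) * v * m2' + (1 - 2 * M) * (v - L * w) * m3')) * r2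

section Goodness

variable {i k p q l : Fin N} (v w : ℂ) (u₂ u₃ u₄ : ℕ)

theorem Good.crossBaseFn (hp : Good ρ i k fun z => z p) (hq : Good ρ i k fun z => z q)
    (hl : Good ρ i k fun z => z l) (hL : Good ρ i k (al γ q l)) (hM : Good ρ i k (al γ p l)) :
    Good ρ i k (crossBaseFn γ v w u₂ u₃ u₄ p q l) := by
  unfold DephasingChain.crossBaseFn crossBase
  repeat' first
    | assumption | apply Good.const | apply Good.add | apply Good.sub | apply Good.mul
    | apply Good.neg | apply Good.pow

theorem Good.crossTopFn (hp : Good ρ i k fun z => z p) (hq : Good ρ i k fun z => z q)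
    (hl : Good ρ i k fun z => z l) (hL : Good ρ i k (al γ q l)) (hM : Good ρ i k (al γ p l)) :
    Good ρ i k (crossTopFn γ v w u₂ u₃ u₄ p q l) := by
  unfold DephasingChain.crossTopFn crossTop
  repeat' first
    | assumption | apply Good.const | apply Good.add | apply Good.sub | apply Good.mul
    | apply Good.neg | apply Good.pow

end Goodness

section Residues

variable {p q k l : Fin N} {S : (Fin N → ℂ) → ℂ} (v w : ℂ) (u₂ u₃ u₄ : ℕ) (e : ℤ) (d : ℕ)

/-- The common prefactor of the four-variable amplitudes. -/
def crossPre (e : ℤ) (d : ℕ) (p q k l : Fin N) (z : Fin N → ℂ) : ℂ :=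
  z k ^ e * z l ^ e * (z p ^ e * z p * z p ^ d) * (z q ^ e * z q * z q ^ d)

/-- The term of `crossSum_eq` with the kernel in `s_p - s_k` has mean zero: `p` has the innermost
circle, so that the other kernels are holomorphic in `z_p`. -/
theorem crossSum_residue_left (hρ : Nested γ ρ) (hpq : p < q) (hqk : q < k) (hql : q < l)
    (hkl : k ≠ l) (hS : Good ρ p k S) :
    Null ρ fun z => S z * crossPre e d p q k l z * (ker (2 * γ) p k z *
      (sc γ p q z * crossBaseFn γ v w u₂ u₃ u₄ q p l z
        - (1 + 2 * γ * ker 0 p q z) * crossTopFn γ v w u₂ u₃ u₄ p q l z)) := by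
  have hc2 := (norm_two_mul γ).le
  have hc0 : ‖(0 : ℂ)‖ ≤ 2 * ‖γ‖ := by simp
  have hpk := hpq.trans hqk
  have hpl := hpq.trans hql
  have gp : Good ρ p k fun z => z p := .self hpk.ne
  have gq : Good ρ p k fun z => z q := .other hpq.ne' hqk.ne
  have gl : Good ρ p k fun z => z l := .other hpl.ne' hkl.symm
  have gqe : Good ρ p k fun z => z q ^ e := .zpow_other hρ.1 hpq.ne' hqk.ne e
  have gle : Good ρ p k fun z => z l ^ e := .zpow_other hρ.1 hpl.ne' hkl.symm e
  have gL : Good ρ p k (al γ q l) :=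
    (Good.ker_other hρ hc2 hql hpq.ne' hqk.ne hpl.ne' hkl.symm).al_of_ker
  have gM : Good ρ p k (al γ p l) := (Good.ker_self hρ hc2 hpl hpk.ne hkl.symm).al_of_ker
  have gF : Good ρ p k (sc γ p q) := (Good.ker_self hρ hc2 hpq hpk.ne hqk.ne).sc_of_ker
  have gD : Good ρ p k (ker 0 p q) := Good.ker_self hρ hc0 hpq hpk.ne hqk.ne
  have gB := Good.crossBaseFn v w u₂ u₃ u₄ gq gp gl gM gL
  have gT := Good.crossTopFn v w u₂ u₃ u₄ gp gq gl gL gM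
  refine (null_ker hρ hpk e (h := fun z => z p * z p ^ d * (S z * z l ^ e *
    (z q ^ e * z q * z q ^ d) * (sc γ p q z * crossBaseFn γ v w u₂ u₃ u₄ q p l z
        - (1 + 2 * γ * ker 0 p q z) * crossTopFn γ v w u₂ u₃ u₄ p q l z))) (by
    repeat' first
      | assumption | apply Good.const | apply Good.add | apply Good.sub | apply Good.mul
      | apply Good.neg | apply Good.pow)).congr hρ.1 fun z _ => ?_
  rw [crossPre]
  ring

/-- The term of `crossSum_eq` with the kernel in `s_q - s_k` has mean zero: its pole at `z_q = z_p`
is compensated by the zero of `crossTopFn`. -/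
theorem crossSum_residue_right (hρ : Nested γ ρ) (hpq : p < q) (hqk : q < k) (hql : q < l)
    (hkl : k ≠ l) (hS : Good ρ q k S) :
    Null ρ fun z => S z * crossPre e d p q k l z * (ker (2 * γ) q k z *
      (crossBaseFn γ v w u₂ u₃ u₄ p q l z
        + (1 + 2 * γ * ker 0 p q z) * crossTopFn γ v w u₂ u₃ u₄ p q l z)) := by
  have hc2 := (norm_two_mul γ).le
  have hpk := hpq.trans hqk
  have hpl := hpq.trans hql
  have gp : Good ρ q k fun z => z p := .other hpq.ne hpk.ne
  have gpe : Good ρ q k fun z => z p ^ e := .zpow_other hρ.1 hpq.ne hpk.ne e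
  have gq : Good ρ q k fun z => z q := .self hqk.ne
  have gl : Good ρ q k fun z => z l := .other hql.ne' hkl.symm
  have gle : Good ρ q k fun z => z l ^ e := .zpow_other hρ.1 hql.ne' hkl.symm e
  have gL : Good ρ q k (al γ q l) := (Good.ker_self hρ hc2 hql hqk.ne hkl.symm).al_of_ker
  have gM : Good ρ q k (al γ p l) :=
    (Good.ker_other hρ hc2 hpl hpq.ne hpk.ne hql.ne' hkl.symm).al_of_ker
  have gB := Good.crossBaseFn v w u₂ u₃ u₄ gp gq gl gL gM
  have gT := Good.crossTopFn v w u₂ u₃ u₄ gp gq gl gL gM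
  have h1 := null_ker hρ hqk e (h := fun z => z q * z q ^ d * (S z * z l ^ e *
    (z p ^ e * z p * z p ^ d) * (crossBaseFn γ v w u₂ u₃ u₄ p q l z
        + crossTopFn γ v w u₂ u₃ u₄ p q l z))) (by
    repeat' first
      | assumption | apply Good.const | apply Good.add | apply Good.sub | apply Good.mul
      | apply Good.neg | apply Good.pow)
  have h2 := null_ker_pole hρ hpq hqk e (h := fun z => z q * z q ^ d * (S z * z l ^ e *
    (z p ^ e * z p * z p ^ d) * crossTopFn γ v w u₂ u₃ u₄ p q l z)) (by
    repeat' first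
      | assumption | apply Good.const | apply Good.add | apply Good.sub | apply Good.mul
      | apply Good.neg | apply Good.pow) (by
    intro z _
    simp only [crossTopFn, al, ker, Function.update_self, Function.update_of_ne hpq.ne,
      Function.update_of_ne hql.ne', sub_self, mul_zero])
  refine (h1.add (h2.const_mul (2 * γ))).congr hρ.1 fun z _ => ?_
  rw [crossPre]
  ring

/-- The terms in which both variables of the first pair are overtaken by a variable `k` of the
second pair have mean zero, by partial fractions in `s_k`. -/
theorem crossSum_null (hρ : Nested γ ρ) (hpq : p < q) (hqk : q < k) (hql : q < l) (hkl : k ≠ l) :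
    Null ρ fun z => crossPre e d p q k l z * crossSum γ v w u₂ u₃ u₄ p q k l z := by
  have hc2 := (norm_two_mul γ).le
  have hpk := hpq.trans hqk
  have hpl := hpq.trans hql
  have gp : Good ρ p k fun z => z p := .self hpk.ne
  have gq : Good ρ p k fun z => z q := .other hpq.ne' hqk.ne
  have gl : Good ρ p k fun z => z l := .other hpl.ne' hkl.symm
  have gqe : Good ρ p k fun z => z q ^ e := .zpow_other hρ.1 hpq.ne' hqk.ne e
  have gle : Good ρ p k fun z => z l ^ e := .zpow_other hρ.1 hpl.ne' hkl.symm e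
  have gL : Good ρ p k (al γ q l) :=
    (Good.ker_other hρ hc2 hql hpq.ne' hqk.ne hpl.ne' hkl.symm).al_of_ker
  have gM : Good ρ p k (al γ p l) := (Good.ker_self hρ hc2 hpl hpk.ne hkl.symm).al_of_ker
  have gF : Good ρ p k (sc γ p q) := (Good.ker_self hρ hc2 hpq hpk.ne hqk.ne).sc_of_ker
  have gB := Good.crossBaseFn v w u₂ u₃ u₄ gq gp gl gM gL
  have gB' := Good.crossBaseFn v w u₂ u₃ u₄ gp gq gl gL gM
  have h0 := null_zpow hρ hpk e (h := fun z => z p ^ d * (z l ^ e *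
    (z q ^ e * z q * z q ^ d) * (crossBaseFn γ v w u₂ u₃ u₄ p q l z
      + sc γ p q z * crossBaseFn γ v w u₂ u₃ u₄ q p l z))) (by
    repeat' first
      | assumption | apply Good.const | apply Good.add | apply Good.sub | apply Good.mul
      | apply Good.neg | apply Good.pow)
  have h1 := crossSum_residue_left v w u₂ u₃ u₄ e d hρ hpq hqk hql hkl (Good.const 1)
  have h2 := crossSum_residue_right v w u₂ u₃ u₄ e d hρ hpq hqk hql hkl (Good.const 1)
  refine ((h0.add (h1.const_mul (2 * γ))).add (h2.const_mul (2 * γ))).congr hρ.1 fun z hz => ?_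
  rw [crossSum_eq hρ hz hpq hqk, crossPre]
  ring

/-- The value at `s_k - s_l = -2γ` of `crossSum`, in partial fractions in `s_l`: its poles at
`z_l = z_p` and `z_l = z_q` are compensated. -/
theorem cross_pole_eq (hρ : Nested γ ρ) {z : Fin N → ℂ} (hz : ∀ j, ‖z j‖ = ρ j)
    (hpq : p < q) (hql : q < l) (m1 m2 m3 m1' m2' m3' : ℂ) :
    (1 + 2 * γ * ker 0 q l z) * crossBase v w (al γ q l z) (al γ p l z) m1 m2 m3
      + (1 + 2 * γ * ker 0 p l z) * (sc γ p q z *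
        crossBase v w (al γ p l z) (al γ q l z) m1' m2' m3')
      + (1 + 2 * γ * ker 0 p q z) * (2 * γ * ker 0 q l z - 2 * γ * ker 0 p l z) *
        (crossTop v w (al γ q l z) (al γ p l z) m1 m2 m3
          - crossTop v w (al γ p l z) (al γ q l z) m1' m2' m3') =
    -w * m1 - (v - w) * m2 + v * m3 + sc γ p q z * (-w * m1' - (v - w) * m2' + v * m3')
      + 2 * γ * ker 0 p l z * (v * (1 + 2 * γ * ker 0 p q z) * (m3' - m1)
        + v * (1 - 2 * γ * ker 0 p q z) * (m3 - m2)
        + (v * (1 + 2 * γ * ker 0 p q z) - sc γ p q z * w) * (m1' - m2'))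
      + 2 * γ * ker 0 q l z * ((v * (1 + 2 * γ * ker 0 p q z) - w) * (m1 - m2)
        + v * (1 + 2 * γ * ker 0 p q z) * (m3 - m1')
        + sc γ p q z * v * (1 + 2 * γ * ker 0 p q z) * (m3' - m2')) := by
  have hpl := hpq.trans hql
  have key : ∀ {a b : Fin N}, a < b → sParam (z a) - sParam (z b) ≠ 0 ∧
      sParam (z a) - sParam (z b) - 2 * γ ≠ 0 := fun {a b} hab =>
    ⟨sub_ne_zero.2 fun h => (hρ.2 a b hab).sParam_sub_ne (ne_zero_of_norm_eq hρ.1 hz a)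
      (hz a).le (hz b) (c := 0) (by simp) (sub_eq_zero.2 h),
      sub_ne_zero.2 ((hρ.2 a b hab).sParam_sub_ne (ne_zero_of_norm_eq hρ.1 hz a)
      (hz a).le (hz b) (norm_two_mul γ).le)⟩
  obtain ⟨a1, a2⟩ := key hpq
  obtain ⟨b1, b2⟩ := key hql
  obtain ⟨c1, c2⟩ := key hpl
  have hc : sParam (z p) - sParam (z l)
      = (sParam (z p) - sParam (z q)) + (sParam (z q) - sParam (z l)) := by ring
  simp only [al, sc, ker, crossBase, crossTop, sub_zero]
  rw [hc] at c1 c2 ⊢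
  generalize sParam (z p) - sParam (z q) = a at *
  generalize sParam (z q) - sParam (z l) = b at *
  field_simp
  ring

/-- As `crossSum_null`, with the additional kernel in `s_l - s_k` of a reversed second pair: the
residue at `s_l - s_k = 2γ` has only compensated poles inside the circle of `z_l`. -/
theorem crossSum_ker_null (hρ : Nested γ ρ) (hpq : p < q) (hql : q < l) (hlk : l < k) :
    Null ρ fun z => ker (2 * γ) l k z *
      (crossPre e d p q k l z * crossSum γ v w u₂ u₃ u₄ p q k l z) := by
  have hc2 := (norm_two_mul γ).le
  have hc0 : ‖(0 : ℂ)‖ ≤ 2 * ‖γ‖ := by simp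
  have hqk := hql.trans hlk
  have hpk := hpq.trans hqk
  have hpl := hpq.trans hql
  have gp : Good ρ l k fun z => z p := .other hpl.ne hpk.ne
  have gq : Good ρ l k fun z => z q := .other hql.ne hqk.ne
  have gl : Good ρ l k fun z => z l := .self hlk.ne
  have gpe : Good ρ l k fun z => z p ^ e := .zpow_other hρ.1 hpl.ne hpk.ne e
  have gqe : Good ρ l k fun z => z q ^ e := .zpow_other hρ.1 hql.ne hqk.ne e
  have gF : Good ρ l k (sc γ p q) :=
    (Good.ker_other hρ hc2 hpq hpl.ne hpk.ne hql.ne hqk.ne).sc_of_ker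
  have gD : Good ρ l k (ker 0 p q) := Good.ker_other hρ hc0 hpq hpl.ne hpk.ne hql.ne hqk.ne
  have h0 := null_ker hρ hlk e (h := fun z => (z p ^ e * z p * z p ^ d) *
    (z q ^ e * z q * z q ^ d) * (-w * (z p ^ u₂ * z q ^ u₃ * z l ^ u₄)
      - (v - w) * (z p ^ u₂ * z l ^ u₃ * z q ^ u₄) + v * (z l ^ u₂ * z p ^ u₃ * z q ^ u₄)
      + sc γ p q z * (-w * (z q ^ u₂ * z p ^ u₃ * z l ^ u₄)
        - (v - w) * (z q ^ u₂ * z l ^ u₃ * z p ^ u₄) + v * (z l ^ u₂ * z q ^ u₃ * z p ^ u₄)))) (by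
    repeat' first
      | assumption | apply Good.const | apply Good.add | apply Good.sub | apply Good.mul
      | apply Good.neg | apply Good.pow)
  have h1 := null_ker_pole hρ hpl hlk e (h := fun z => (z p ^ e * z p * z p ^ d) *
    (z q ^ e * z q * z q ^ d) * (v * (1 + 2 * γ * ker 0 p q z) *
        (z l ^ u₂ * z q ^ u₃ * z p ^ u₄ - z p ^ u₂ * z q ^ u₃ * z l ^ u₄)
      + v * (1 - 2 * γ * ker 0 p q z) *
        (z l ^ u₂ * z p ^ u₃ * z q ^ u₄ - z p ^ u₂ * z l ^ u₃ * z q ^ u₄)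
      + (v * (1 + 2 * γ * ker 0 p q z) - sc γ p q z * w) *
        (z q ^ u₂ * z p ^ u₃ * z l ^ u₄ - z q ^ u₂ * z l ^ u₃ * z p ^ u₄))) (by
    repeat' first
      | assumption | apply Good.const | apply Good.add | apply Good.sub | apply Good.mul
      | apply Good.neg | apply Good.pow) (by
    intro z _
    simp only [sc, ker, Function.update_self, Function.update_of_ne hpl.ne,
      Function.update_of_ne hql.ne]
    ring)
  have h2 := null_ker_pole hρ hql hlk e (h := fun z => (z p ^ e * z p * z p ^ d) *
    (z q ^ e * z q * z q ^ d) * ((v * (1 + 2 * γ * ker 0 p q z) - w) *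
        (z p ^ u₂ * z q ^ u₃ * z l ^ u₄ - z p ^ u₂ * z l ^ u₃ * z q ^ u₄)
      + v * (1 + 2 * γ * ker 0 p q z) *
        (z l ^ u₂ * z p ^ u₃ * z q ^ u₄ - z q ^ u₂ * z p ^ u₃ * z l ^ u₄)
      + sc γ p q z * v * (1 + 2 * γ * ker 0 p q z) *
        (z l ^ u₂ * z q ^ u₃ * z p ^ u₄ - z q ^ u₂ * z l ^ u₃ * z p ^ u₄))) (by
    repeat' first
      | assumption | apply Good.const | apply Good.add | apply Good.sub | apply Good.mul
      | apply Good.neg | apply Good.pow) (by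
    intro z _
    simp only [sc, ker, Function.update_self, Function.update_of_ne hpl.ne,
      Function.update_of_ne hql.ne]
    ring)
  have h3 := crossSum_residue_left v w u₂ u₃ u₄ e d hρ hpq hqk hql hlk.ne'
    (Good.ker_self hρ hc0 hpl hpk.ne hlk.ne)
  have h4 := crossSum_residue_right v w u₂ u₃ u₄ e d hρ hpq hqk hql hlk.ne'
    (Good.ker_self hρ hc0 hql hqk.ne hlk.ne)
  refine ((((h0.add (h1.const_mul (2 * γ))).add (h2.const_mul (2 * γ))).add
    (h3.const_mul (-(2 * γ)))).add (h4.const_mul (-(2 * γ)))).congr hρ.1 fun z hz => ?_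
  have r1 := ker_mul_ker hρ hz hc2 hpl hlk
  have r2 := ker_mul_ker hρ hz hc2 hql hlk
  have r3 := cross_pole_eq v w hρ hz hpq hql (z p ^ u₂ * z q ^ u₃ * z l ^ u₄)
    (z p ^ u₂ * z l ^ u₃ * z q ^ u₄) (z l ^ u₂ * z p ^ u₃ * z q ^ u₄)
    (z q ^ u₂ * z p ^ u₃ * z l ^ u₄) (z q ^ u₂ * z l ^ u₃ * z p ^ u₄)
    (z l ^ u₂ * z q ^ u₃ * z p ^ u₄)
  rw [crossSum_eq hρ hz hpq hqk]
  generalize hV1 : sc γ p q z * crossBaseFn γ v w u₂ u₃ u₄ q p l z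
        - (1 + 2 * γ * ker 0 p q z) * crossTopFn γ v w u₂ u₃ u₄ p q l z = V1
  generalize hV2 : crossBaseFn γ v w u₂ u₃ u₄ p q l z
        + (1 + 2 * γ * ker 0 p q z) * crossTopFn γ v w u₂ u₃ u₄ p q l z = V2
  simp only [crossBaseFn, crossTopFn] at hV1 hV2 ⊢
  rw [crossPre]
  linear_combination (-(ker (2 * γ) l k z * (z k ^ e * z l ^ e * (z p ^ e * z p * z p ^ d) *
      (z q ^ e * z q * z q ^ d)))) * (r3 - 2 * γ * ker 0 p l z * hV1 - 2 * γ * ker 0 q l z * hV2)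
    - (2 * γ * V1 * (z k ^ e * z l ^ e * (z p ^ e * z p * z p ^ d) *
      (z q ^ e * z q * z q ^ d))) * r1
    - (2 * γ * V2 * (z k ^ e * z l ^ e * (z p ^ e * z p * z p ^ d) *
      (z q ^ e * z q * z q ^ d))) * r2

end Residues

end FourVariables

/-! ### The Bethe wave function of two pairs -/

theorem torusMean_monomial {N : ℕ} {ρ : Fin N → ℝ} (hρ : ∀ j, 0 < ρ j) (m : Fin N → ℤ) :
    torusMean ρ (fun z => ∏ j, z j ^ m j) = if m = 0 then 1 else 0 := by
  split_ifs with h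
  · simp [h, torusMean_const]
  · obtain ⟨j, hj⟩ := Function.ne_iff.1 h
    refine torusMean_eq_zero_of_circle hρ (TorusCont.prod fun _ _ => torusCont_zpow hρ _ _) j
      fun z _ => ?_
    rw [circleIntegral_congr' (hρ j)
      (g := fun w => (∏ i ∈ Finset.univ.erase j, z i ^ m i) * (w - 0) ^ (m j - 1)) fun w h0 _ => ?_]
    · rw [circleIntegral.integral_const_mul, circleIntegral.integral_sub_zpow_of_ne (by
        simpa [sub_eq_neg_self] using hj), mul_zero]
    · rw [← Finset.mul_prod_erase _ _ (Finset.mem_univ j), Function.update_self, sub_zero,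
        zpow_sub_one₀ h0, Finset.prod_congr rfl fun i hi => by
          rw [Function.update_of_ne (Finset.ne_of_mem_erase hi)]]
      ring

section Amplitudes

variable {γ : ℂ}

theorem scattering_mul_swap' {n : ℕ} {z : Fin (2 * n) → ℂ} (hz : Admissible γ z)
    (P : Perm (Fin (2 * n))) {j k : Fin (2 * n)} (hjk : j.val + 1 = k.val) (a : Spins (2 * n)) :
    scattering γ z (P * swap j k) a = scattering γ z P a
      - al γ (P j) (P k) z * (scattering γ z P a - scattering γ z P (a ∘ swap j k)) := by
  have hne : P j ≠ P k := fun h => by have := P.injective h; subst this; omega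
  have h := hz.ne_zero hne
  rw [scattering_mul_swap hz P hjk, al, ker]
  field_simp
  ring

theorem singletCoeff_comm (a b : Spin) : singletCoeff a b = -singletCoeff b a := by
  cases a <;> cases b <;> simp [singletCoeff]

/-- The Plücker relation for the three ways to form singlets of four spins. By it, the span of
`singletVector 2` and `crossVector` is invariant under permutations of the spins. -/
theorem singletCoeff_plucker (a b c d : Spin) :
    singletCoeff a b * singletCoeff c d - singletCoeff a c * singletCoeff b d
      + singletCoeff a d * singletCoeff b c = 0 := by
  have h1 : singletCoeff Spin.up Spin.down = -1 := by simp [singletCoeff]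
  have h2 : singletCoeff Spin.down Spin.up = 1 := by simp [singletCoeff]
  have h3 : ∀ s, singletCoeff s s = 0 := fun s => by cases s <;> simp [singletCoeff]
  cases a <;> cases b <;> cases c <;> cases d <;> norm_num [h1, h2, h3]

/-- The antisymmetrization of the singlet vector in the two middle spins. -/
def crossVector (b : Spins 4) : ℂ :=
  singletVector 2 b - singletVector 2 (b ∘ swap (1 : Fin 4) 2)

theorem singletVector_two (b : Spins 4) :
    singletVector 2 b = -(1 / 4) * (singletCoeff (b 0) (b 1) * singletCoeff (b 2) (b 3)) := by
  rw [singletVector, Fin.prod_univ_two]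
  have e0 : pairFst (0 : Fin 2) = (0 : Fin 4) := rfl
  have e1 : pairSnd (0 : Fin 2) = (1 : Fin 4) := rfl
  have e2 : pairFst (1 : Fin 2) = (2 : Fin 4) := rfl
  have e3 : pairSnd (1 : Fin 2) = (3 : Fin 4) := rfl
  rw [e0, e1, e2, e3]
  norm_num

theorem singletVector_comp_first (b : Spins 4) :
    singletVector 2 (b ∘ swap (0 : Fin 4) 1) = -singletVector 2 b := by
  simp only [singletVector_two, Function.comp_apply]
  simp only [show swap (0 : Fin 4) 1 0 = 1 by decide, show swap (0 : Fin 4) 1 1 = 0 by decide,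
    show swap (0 : Fin 4) 1 2 = 2 by decide, show swap (0 : Fin 4) 1 3 = 3 by decide]
  rw [singletCoeff_comm (b 1)]
  ring

theorem singletVector_comp_last (b : Spins 4) :
    singletVector 2 (b ∘ swap (2 : Fin 4) 3) = -singletVector 2 b := by
  simp only [singletVector_two, Function.comp_apply]
  simp only [show swap (2 : Fin 4) 3 0 = 0 by decide, show swap (2 : Fin 4) 3 1 = 1 by decide,
    show swap (2 : Fin 4) 3 2 = 3 by decide, show swap (2 : Fin 4) 3 3 = 2 by decide]
  rw [singletCoeff_comm (b 3)]
  ring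

theorem singletVector_comp_middle (b : Spins 4) :
    singletVector 2 (b ∘ swap (1 : Fin 4) 2) = singletVector 2 b - crossVector b := by
  rw [crossVector]
  ring

theorem crossVector_comp_middle (b : Spins 4) :
    crossVector (b ∘ swap (1 : Fin 4) 2) = -crossVector b := by
  have : (b ∘ swap (1 : Fin 4) 2) ∘ swap (1 : Fin 4) 2 = b := by funext i; simp
  rw [crossVector, this, crossVector]
  ring

theorem crossVector_comp_first (b : Spins 4) :
    crossVector (b ∘ swap (0 : Fin 4) 1) = crossVector b - singletVector 2 b := by
  simp only [crossVector, singletVector_two, Function.comp_apply]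
  simp only [show swap (0 : Fin 4) 1 0 = 1 by decide, show swap (0 : Fin 4) 1 1 = 0 by decide,
    show swap (0 : Fin 4) 1 2 = 2 by decide, show swap (0 : Fin 4) 1 3 = 3 by decide,
    show swap (1 : Fin 4) 2 0 = 0 by decide, show swap (1 : Fin 4) 2 1 = 2 by decide,
    show swap (1 : Fin 4) 2 2 = 1 by decide, show swap (1 : Fin 4) 2 3 = 3 by decide]
  rw [singletCoeff_comm (b 1) (b 0)]
  linear_combination (1 / 4) * singletCoeff_plucker (b 0) (b 1) (b 2) (b 3)

theorem crossVector_comp_last (b : Spins 4) :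
    crossVector (b ∘ swap (2 : Fin 4) 3) = crossVector b - singletVector 2 b := by
  simp only [crossVector, singletVector_two, Function.comp_apply]
  simp only [show swap (2 : Fin 4) 3 0 = 0 by decide, show swap (2 : Fin 4) 3 1 = 1 by decide,
    show swap (2 : Fin 4) 3 2 = 3 by decide, show swap (2 : Fin 4) 3 3 = 2 by decide,
    show swap (1 : Fin 4) 2 0 = 0 by decide, show swap (1 : Fin 4) 2 1 = 2 by decide,
    show swap (1 : Fin 4) 2 2 = 1 by decide, show swap (1 : Fin 4) 2 3 = 3 by decide]
  rw [singletCoeff_comm (b 3) (b 2)]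
  linear_combination (1 / 4) * singletCoeff_plucker (b 0) (b 1) (b 2) (b 3)

/-- Monomials with exponents `c` in the variables `z_i, z_j, z_k, z_l`, in this order. -/
def mono (c : Fin 4 → ℤ) (z : Fin 4 → ℂ) (i j k l : Fin 4) : ℂ :=
  z i ^ c 0 * z j ^ c 1 * z k ^ c 2 * z l ^ c 3

/-- The contribution to the Bethe wave function of the permutations that keep the pairs `{p, q}`
and `{k, l}` internally ordered as `p, q` and `k, l`. -/
def shuffleSum (γ v w : ℂ) (c : Fin 4 → ℤ) (z : Fin 4 → ℂ) (p q k l : Fin 4) : ℂ :=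
  v * mono c z p q k l
    + thetaPoly v w (al γ q k z) (al γ q l z) (mono c z p k q l) (mono c z p k l q)
    + crossPoly v w (al γ p k z) (al γ q k z) (al γ q l z) (al γ p l z)
      (mono c z k p q l) (mono c z k p l q) (mono c z k l p q)

theorem planeWave_four (z : Fin 4 → ℂ) (P : Perm (Fin 4)) (c : Fin 4 → ℤ) :
    planeWave z P c = mono c z (P 0) (P 1) (P 2) (P 3) := by
  rw [planeWave, Fin.prod_univ_four, mono]

/-- The pairs of permutations that keep the two pairs `{0, 1}`, `{2, 3}` together. -/
def pairPerms : Finset (Perm (Fin 4)) := {1, swap 0 1, swap 2 3, swap 0 1 * swap 2 3}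

/-- The shuffles of the two pairs `{0, 1}`, `{2, 3}`. -/
def shuffles : Finset (Perm (Fin 4)) :=
  {1, swap 1 2, swap 1 2 * swap 2 3, swap 1 2 * swap 0 1, swap 1 2 * swap 2 3 * swap 0 1,
    swap 1 2 * swap 2 3 * swap 0 1 * swap 1 2}

set_option maxRecDepth 100000 in
theorem sum_perm_four (f : Perm (Fin 4) → ℂ) :
    ∑ P, f P = ∑ σ ∈ pairPerms, ∑ τ ∈ shuffles, f (σ * τ) := by
  have h1 : (Finset.univ : Finset (Perm (Fin 4)))
      = (pairPerms ×ˢ shuffles).image fun x => x.1 * x.2 := by decide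
  have h2 : ((pairPerms ×ˢ shuffles).image fun x => x.1 * x.2).card
      = (pairPerms ×ˢ shuffles).card := by decide
  rw [h1, Finset.sum_image (Finset.card_image_iff.1 h2), Finset.sum_product]

/-- Each shuffle is reached by adjacent transpositions, whose Yang operators act on the span of
`singletVector 2` and `crossVector`. -/
theorem sum_shuffles {z : Fin 4 → ℂ} (hz : Admissible γ z) (σ : Perm (Fin 4)) (s : ℂ)
    (hσ : ∀ b, scattering (n := 2) γ z σ b = s * singletVector 2 b) (b : Spins 4)
    (c : Fin 4 → ℤ) :
    ∑ τ ∈ shuffles, csign (σ * τ) * scattering (n := 2) γ z (σ * τ) b * planeWave z (σ * τ) c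
      = csign σ * s * shuffleSum γ (singletVector 2 b) (crossVector b) c z
          (σ 0) (σ 1) (σ 2) (σ 3) := by
  have A2 : ∀ b, scattering (n := 2) γ z (σ * swap 1 2) b = s * (singletVector 2 b
      - al γ (σ 1) (σ 2) z * crossVector b) := by
    intro b
    rw [scattering_mul_swap' (n := 2) hz σ rfl, hσ, hσ, singletVector_comp_middle]
    ring
  have A3 : ∀ b, scattering (n := 2) γ z (σ * swap 1 2 * swap 2 3) b
      = s * ((1 - 2 * al γ (σ 1) (σ 3) z + al γ (σ 1) (σ 2) z * al γ (σ 1) (σ 3) z) *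
        singletVector 2 b - al γ (σ 1) (σ 2) z * crossVector b) := by
    intro b
    rw [scattering_mul_swap' (n := 2) hz (σ * swap 1 2) rfl, A2, A2, singletVector_comp_last,
      crossVector_comp_last]
    have e1 : (σ * swap 1 2 : Perm (Fin 4)) 2 = σ 1 := by simp [Perm.mul_apply]
    have e2 : (σ * swap 1 2 : Perm (Fin 4)) 3 = σ 3 := by
      rw [Perm.mul_apply, show swap (1 : Fin 4) 2 3 = 3 by decide]
    rw [e1, e2]
    ring
  have A4 : ∀ b, scattering (n := 2) γ z (σ * swap 1 2 * swap 0 1) b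
      = s * ((1 - 2 * al γ (σ 0) (σ 2) z + al γ (σ 0) (σ 2) z * al γ (σ 1) (σ 2) z) *
        singletVector 2 b - al γ (σ 1) (σ 2) z * crossVector b) := by
    intro b
    rw [scattering_mul_swap' (n := 2) hz (σ * swap 1 2) rfl, A2, A2, singletVector_comp_first,
      crossVector_comp_first]
    have e1 : (σ * swap 1 2 : Perm (Fin 4)) 1 = σ 2 := by simp [Perm.mul_apply]
    have e2 : (σ * swap 1 2 : Perm (Fin 4)) 0 = σ 0 := by
      rw [Perm.mul_apply, show swap (1 : Fin 4) 2 0 = 0 by decide]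
    rw [e1, e2]
    ring
  have A5 : ∀ b, scattering (n := 2) γ z (σ * swap 1 2 * swap 2 3 * swap 0 1) b
      = s * (((1 - 2 * al γ (σ 1) (σ 3) z + al γ (σ 1) (σ 2) z * al γ (σ 1) (σ 3) z) *
          (1 - 2 * al γ (σ 0) (σ 2) z) + al γ (σ 0) (σ 2) z * al γ (σ 1) (σ 2) z) *
        singletVector 2 b - al γ (σ 1) (σ 2) z * crossVector b) := by
    intro b
    rw [scattering_mul_swap' (n := 2) hz (σ * swap 1 2 * swap 2 3) rfl, A3, A3,
      singletVector_comp_first, crossVector_comp_first]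
    have e1 : (σ * swap 1 2 * swap 2 3 : Perm (Fin 4)) 1 = σ 2 := by
      rw [Perm.mul_apply, Perm.mul_apply,
        show swap (1 : Fin 4) 2 (swap (2 : Fin 4) 3 1) = 2 by decide]
    have e2 : (σ * swap 1 2 * swap 2 3 : Perm (Fin 4)) 0 = σ 0 := by
      rw [Perm.mul_apply, Perm.mul_apply,
        show swap (1 : Fin 4) 2 (swap (2 : Fin 4) 3 0) = 0 by decide]
    rw [e1, e2]
    ring
  have A6 := scattering_mul_swap' (n := 2) hz (σ * swap 1 2 * swap 2 3 * swap 0 1)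
    (j := (1 : Fin 4)) (k := (2 : Fin 4)) rfl b
  have e1 : (σ * swap 1 2 * swap 2 3 * swap 0 1 : Perm (Fin 4)) 1 = σ 0 := by
    rw [Perm.mul_apply, Perm.mul_apply, Perm.mul_apply,
      show swap (1 : Fin 4) 2 (swap (2 : Fin 4) 3 (swap (0 : Fin 4) 1 1)) = 0 by decide]
  have e2 : (σ * swap 1 2 * swap 2 3 * swap 0 1 : Perm (Fin 4)) 2 = σ 3 := by
    rw [Perm.mul_apply, Perm.mul_apply, Perm.mul_apply,
      show swap (1 : Fin 4) 2 (swap (2 : Fin 4) 3 (swap (0 : Fin 4) 1 2)) = 3 by decide]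
  rw [A5, A5, singletVector_comp_middle, crossVector_comp_middle, e1, e2] at A6
  rw [shuffles, Finset.sum_insert (by decide), Finset.sum_insert (by decide),
    Finset.sum_insert (by decide), Finset.sum_insert (by decide), Finset.sum_insert (by decide),
    Finset.sum_singleton]
  have c0 : csign (swap (0 : Fin 4) 1) = -1 := csign_swap (by decide)
  have c1 : csign (swap (1 : Fin 4) 2) = -1 := csign_swap (by decide)
  have c2 : csign (swap (2 : Fin 4) 3) = -1 := csign_swap (by decide)
  simp only [mul_one, ← mul_assoc, A2, A3, A4, A5, hσ]
  rw [A6]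
  simp only [csign_mul, c0, c1, c2, planeWave_four, Perm.mul_apply,
    show swap (0 : Fin 4) 1 0 = 1 by decide, show swap (0 : Fin 4) 1 1 = 0 by decide,
    show swap (0 : Fin 4) 1 2 = 2 by decide, show swap (0 : Fin 4) 1 3 = 3 by decide,
    show swap (2 : Fin 4) 3 0 = 0 by decide, show swap (2 : Fin 4) 3 1 = 1 by decide,
    show swap (2 : Fin 4) 3 2 = 3 by decide, show swap (2 : Fin 4) 3 3 = 2 by decide,
    show swap (1 : Fin 4) 2 0 = 0 by decide, show swap (1 : Fin 4) 2 1 = 2 by decide,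
    show swap (1 : Fin 4) 2 2 = 1 by decide, show swap (1 : Fin 4) 2 3 = 3 by decide]
  rw [shuffleSum, thetaPoly, crossPoly]
  ring

/-- The four internal orders of the two pairs. As a pair is in the singlet state, its reversal gives
a scalar factor `sc`. -/
theorem betheWave_four {z : Fin 4 → ℂ} (hz : Admissible γ z) (b : Spins 4) (c : Fin 4 → ℤ) :
    betheWave (n := 2) γ z 1 c b =
      shuffleSum γ (singletVector 2 b) (crossVector b) c z 0 1 2 3
      + sc γ (0 : Fin 4) 1 z * shuffleSum γ (singletVector 2 b) (crossVector b) c z 1 0 2 3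
      + sc γ (2 : Fin 4) 3 z * (shuffleSum γ (singletVector 2 b) (crossVector b) c z 0 1 3 2
      + sc γ (0 : Fin 4) 1 z * shuffleSum γ (singletVector 2 b) (crossVector b) c z 1 0 3 2) := by
  have A1 : ∀ b, scattering (n := 2) γ z 1 b = 1 * singletVector 2 b := fun b => by
    rw [(scattering_isScatteringFamily (n := 2) hz).base, one_mul]
  have A2 : ∀ b, scattering (n := 2) γ z (swap 0 1) b
      = (-sc γ (0 : Fin 4) 1 z) * singletVector 2 b := by
    intro b
    have := scattering_mul_swap' (n := 2) hz 1 (j := (0 : Fin 4)) (k := (1 : Fin 4)) rfl b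
    rw [one_mul, A1, A1, singletVector_comp_first, Perm.one_apply, Perm.one_apply] at this
    rw [this, al, sc]
    ring
  have A3 : ∀ b, scattering (n := 2) γ z (swap 2 3) b
      = (-sc γ (2 : Fin 4) 3 z) * singletVector 2 b := by
    intro b
    have := scattering_mul_swap' (n := 2) hz 1 (j := (2 : Fin 4)) (k := (3 : Fin 4)) rfl b
    rw [one_mul, A1, A1, singletVector_comp_last, Perm.one_apply, Perm.one_apply] at this
    rw [this, al, sc]
    ring
  have A4 : ∀ b, scattering (n := 2) γ z (swap 0 1 * swap 2 3) b
      = (sc γ (0 : Fin 4) 1 z * sc γ (2 : Fin 4) 3 z) * singletVector 2 b := by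
    intro b
    have := scattering_mul_swap' (n := 2) hz (swap 0 1) (j := (2 : Fin 4)) (k := (3 : Fin 4)) rfl b
    rw [A2, A2, singletVector_comp_last, show swap (0 : Fin 4) 1 2 = 2 by decide,
      show swap (0 : Fin 4) 1 3 = 3 by decide] at this
    rw [this, al, sc, sc]
    ring
  have c0 : csign (swap (0 : Fin 4) 1) = -1 := csign_swap (by decide)
  have c2 : csign (swap (2 : Fin 4) 3) = -1 := csign_swap (by decide)
  have h := betheWave_one (n := 2) (γ := γ) (z := z) c b
  refine h.trans ?_
  rw [sum_perm_four, pairPerms, Finset.sum_insert (by decide), Finset.sum_insert (by decide),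
    Finset.sum_insert (by decide), Finset.sum_singleton,
    sum_shuffles hz _ _ A1, sum_shuffles hz _ _ A2, sum_shuffles hz _ _ A3, sum_shuffles hz _ _ A4]
  simp only [csign_mul, c0, c2, csign_one, Perm.mul_apply, Perm.one_apply,
    show swap (0 : Fin 4) 1 0 = 1 by decide, show swap (0 : Fin 4) 1 1 = 0 by decide,
    show swap (0 : Fin 4) 1 2 = 2 by decide, show swap (0 : Fin 4) 1 3 = 3 by decide,
    show swap (2 : Fin 4) 3 0 = 0 by decide, show swap (2 : Fin 4) 3 1 = 1 by decide,
    show swap (2 : Fin 4) 3 2 = 3 by decide, show swap (2 : Fin 4) 3 3 = 2 by decide]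
  ring

end Amplitudes

/-! ### The contour integral at time zero -/

section InitialTwo

variable {γ : ℂ} {ρ : Fin 4 → ℝ} {c : Fin 4 → ℤ} {y : Fin 2 → ℤ}

theorem initialWave_two (y : Fin 2 → ℤ) (z : Fin 4 → ℂ) :
    initialWave y z = z 0 ^ (-y 0) * z 1 ^ (-y 0) * (z 2 ^ (-y 1) * z 3 ^ (-y 1)) := by
  have e0 : pairFst (0 : Fin 2) = (0 : Fin 4) := rfl
  have e1 : pairSnd (0 : Fin 2) = (1 : Fin 4) := rfl
  have e2 : pairFst (1 : Fin 2) = (2 : Fin 4) := rfl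
  have e3 : pairSnd (1 : Fin 2) = (3 : Fin 4) := rfl
  rw [initialWave, Fin.prod_univ_two, e0, e1, e2, e3]

/-- The lowest powers of the variables can be split off from the amplitudes. -/
theorem initialWave_mul_shuffleSum {z : Fin 4 → ℂ} (h0 : ∀ j, z j ≠ 0) {p q k l : Fin 4}
    (hI : initialWave y z = z p ^ (-y 0) * z q ^ (-y 0) * (z k ^ (-y 1) * z l ^ (-y 1)))
    {d u₂ u₃ u₄ u u' : ℕ} (hy : y 1 = y 0 + 1 + d) (h2 : c 1 = c 0 + u₂) (h3 : c 2 = c 0 + u₃)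
    (h4 : c 3 = c 0 + u₄) (hu : c 2 = c 1 + u) (hu' : c 3 = c 1 + u') (v w : ℂ) :
    shuffleSum γ v w c z p q k l * initialWave y z =
      v * (z p ^ (c 0 - y 0) * z q ^ (c 1 - y 0) * (z k ^ (c 2 - y 1) * z l ^ (c 3 - y 1)))
      + z p ^ (c 0 - y 0) * (z k ^ (c 1 - y 1) * z l ^ (c 1 - y 1)
          * (z q ^ (c 1 - y 1) * z q * z q ^ d))
        * thetaPoly v w (al γ q k z) (al γ q l z) (z q ^ u * z l ^ u') (z l ^ u * z q ^ u')
      + crossPre (c 0 - y 1) d p q k l z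
        * crossPoly v w (al γ p k z) (al γ q k z) (al γ q l z) (al γ p l z)
          (z p ^ u₂ * z q ^ u₃ * z l ^ u₄) (z p ^ u₂ * z l ^ u₃ * z q ^ u₄)
          (z l ^ u₂ * z p ^ u₃ * z q ^ u₄) := by
  have m1 : ∀ i, z i ^ c 1 = z i ^ c 0 * z i ^ u₂ := fun i => by
    rw [h2, zpow_add₀ (h0 i), zpow_natCast]
  have m2 : ∀ i, z i ^ c 2 = z i ^ c 0 * z i ^ u₃ := fun i => by
    rw [h3, zpow_add₀ (h0 i), zpow_natCast]
  have m3 : ∀ i, z i ^ c 3 = z i ^ c 0 * z i ^ u₄ := fun i => by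
    rw [h4, zpow_add₀ (h0 i), zpow_natCast]
  have m2' : ∀ i, z i ^ c 2 = z i ^ c 1 * z i ^ u := fun i => by
    rw [hu, zpow_add₀ (h0 i), zpow_natCast]
  have m3' : ∀ i, z i ^ c 3 = z i ^ c 1 * z i ^ u' := fun i => by
    rw [hu', zpow_add₀ (h0 i), zpow_natCast]
  have d0 : ∀ i (a b : ℤ), z i ^ (a - b) = z i ^ a * z i ^ (-b) := fun i a b => by
    rw [sub_eq_add_neg, zpow_add₀ (h0 i)]
  have d1 : ∀ i, z i ^ (-y 1) * (z i * z i ^ d) = z i ^ (-y 0) := fun i => by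
    rw [← pow_succ', ← zpow_natCast, ← zpow_add₀ (h0 i), hy]
    congr 1
    push_cast
    ring
  have e1 : mono c z p q k l * initialWave y z
      = z p ^ (c 0 - y 0) * z q ^ (c 1 - y 0) * (z k ^ (c 2 - y 1) * z l ^ (c 3 - y 1)) := by
    simp only [mono, hI, d0]
    ring
  have hθ : z p ^ (c 0 - y 0) * (z k ^ (c 1 - y 1) * z l ^ (c 1 - y 1)
          * (z q ^ (c 1 - y 1) * z q * z q ^ d))
      = z p ^ c 0 * z k ^ c 1 * z l ^ c 1 * z q ^ c 1 * initialWave y z := by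
    simp only [hI, d0, ← d1 q]
    ring
  have e2 : thetaPoly v w (al γ q k z) (al γ q l z) (mono c z p k q l) (mono c z p k l q)
      = z p ^ c 0 * z k ^ c 1 * z l ^ c 1 * z q ^ c 1 *
        thetaPoly v w (al γ q k z) (al γ q l z) (z q ^ u * z l ^ u') (z l ^ u * z q ^ u') := by
    simp only [mono, thetaPoly, m2', m3']
    ring
  have hκ : crossPre (c 0 - y 1) d p q k l z
      = z p ^ c 0 * z k ^ c 0 * z l ^ c 0 * z q ^ c 0 * initialWave y z := by
    simp only [crossPre, hI, d0, ← d1 q, ← d1 p]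
    ring
  have e3 : crossPoly v w (al γ p k z) (al γ q k z) (al γ q l z) (al γ p l z)
        (mono c z k p q l) (mono c z k p l q) (mono c z k l p q)
      = z p ^ c 0 * z k ^ c 0 * z l ^ c 0 * z q ^ c 0 *
        crossPoly v w (al γ p k z) (al γ q k z) (al γ q l z) (al γ p l z)
          (z p ^ u₂ * z q ^ u₃ * z l ^ u₄) (z p ^ u₂ * z l ^ u₃ * z q ^ u₄)
          (z l ^ u₂ * z p ^ u₃ * z q ^ u₄) := by
    simp only [mono, crossPoly, m1, m2, m3]
    ring
  rw [shuffleSum, e2, e3, hθ, hκ, ← e1]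
  ring

theorem crossPre_comm {N : ℕ} (e : ℤ) (d : ℕ) (p q k l : Fin N) (z : Fin N → ℂ) :
    crossPre e d q p k l z = crossPre e d p q k l z := by
  rw [crossPre, crossPre]
  ring

/-- The terms in which the second variable of the first pair is exchanged with the second pair,
summed over both orders of the second pair. One order carries `sc γ 2 3`, hence an
additional kernel. -/
theorem shuffle_theta_null (hρ : Nested γ ρ) (e f : ℤ) (d u u' : ℕ) (v w : ℂ) {p q : Fin 4}
    (hp : p = 0 ∧ q = 1 ∨ p = 1 ∧ q = 0) {F : (Fin 4 → ℂ) → ℂ} (hF : Good ρ q 2 F)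
    (hF' : Good ρ q 3 F) (hF2 : Good ρ 2 3 F) :
    Null ρ fun z => F z * (z p ^ f * (z 2 ^ e * z 3 ^ e * (z q ^ e * z q * z q ^ d))
        * thetaPoly v w (al γ q 2 z) (al γ q 3 z) (z q ^ u * z 3 ^ u') (z 3 ^ u * z q ^ u')
      + sc γ (2 : Fin 4) 3 z * (z p ^ f * (z 3 ^ e * z 2 ^ e * (z q ^ e * z q * z q ^ d))
        * thetaPoly v w (al γ q 3 z) (al γ q 2 z) (z q ^ u * z 2 ^ u') (z 2 ^ u * z q ^ u'))) := by
  have hq2 : q < 2 := by rcases hp with ⟨-, rfl⟩ | ⟨-, rfl⟩ <;> decide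
  have hq3 : q < 3 := hq2.trans (by decide)
  have hp2 : p ≠ 2 := by rcases hp with ⟨rfl, -⟩ | ⟨rfl, -⟩ <;> decide
  have hp3 : p ≠ 3 := by rcases hp with ⟨rfl, -⟩ | ⟨rfl, -⟩ <;> decide
  have hpq : p ≠ q := by rcases hp with ⟨rfl, rfl⟩ | ⟨rfl, rfl⟩ <;> decide
  have h23 : (2 : Fin 4) ≠ 3 := by decide
  have gq2 : Good ρ q 2 fun z => z q := .self hq2.ne
  have gq3 : Good ρ q 3 fun z => z q := .self hq3.ne
  have gq23 : Good ρ 2 3 fun z => z q := .other hq2.ne hq3.ne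
  have gp2 : Good ρ q 2 fun z => z p ^ f := .zpow_other hρ.1 hpq hp2 f
  have gp3 : Good ρ q 3 fun z => z p ^ f := .zpow_other hρ.1 hpq hp3 f
  have gp23 : Good ρ 2 3 fun z => z p ^ f := .zpow_other hρ.1 hp2 hp3 f
  have g3 : Good ρ q 2 fun z => z 3 ^ e := .zpow_other hρ.1 hq3.ne' h23.symm e
  have g2 : Good ρ q 3 fun z => z 2 ^ e := .zpow_other hρ.1 hq2.ne' h23 e
  have n1 := theta_null hρ hq2 hq3 h23 (S := fun z => F z * z p ^ f * z 3 ^ e * z q ^ d)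
    (((hF.mul gp2).mul g3).mul (gq2.pow d)) e u u' v w
  have n2 := theta_null hρ hq3 hq2 h23.symm (S := fun z => F z * z p ^ f * z 2 ^ e * z q ^ d)
    (((hF'.mul gp3).mul g2).mul (gq3.pow d)) e u u' v w
  have n3 := theta_ker_null hρ hq2 (show (2 : Fin 4) < 3 by decide)
    (S := fun z => F z * z p ^ f * z q) ((hF'.mul gp3).mul gq3) ((hF2.mul gp23).mul gq23)
    e d u u' v w
  refine ((n1.add n2).add (n3.const_mul (4 * γ))).congr hρ.1 fun z _ => ?_
  rw [sc]
  ring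

/-- The integrand at time zero is the symmetrization of a monomial over the two pairs, up to terms
of mean zero. -/
theorem torusMean_betheWave_two (hρ : Nested γ ρ) (hy : y 0 < y 1) (hc : Monotone c)
    (b : Spins 4) :
    torusMean ρ (fun z => betheWave (n := 2) γ z 1 c b * initialWave y z)
      = doublonState y (1 : Perm (Fin 4)) c b := by
  obtain ⟨d, hd⟩ : ∃ d : ℕ, y 1 = y 0 + 1 + d := ⟨(y 1 - y 0 - 1).toNat, by omega⟩
  have c01 : c 0 ≤ c 1 := hc (by decide)
  have c12 : c 1 ≤ c 2 := hc (by decide)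
  have c23 : c 2 ≤ c 3 := hc (by decide)
  obtain ⟨u₂, h2⟩ : ∃ d : ℕ, c 1 = c 0 + d := ⟨(c 1 - c 0).toNat, by omega⟩
  obtain ⟨u, hu⟩ : ∃ d : ℕ, c 2 = c 1 + d := ⟨(c 2 - c 1).toNat, by omega⟩
  obtain ⟨t, ht⟩ : ∃ d : ℕ, c 3 = c 2 + d := ⟨(c 3 - c 2).toNat, by omega⟩
  set u₃ := u₂ + u with hu₃
  set u' := u + t with hu'
  set u₄ := u₂ + u + t with hu₄
  have h3 : c 2 = c 0 + u₃ := by omega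
  have h4 : c 3 = c 0 + u₄ := by omega
  have h5 : c 3 = c 1 + u' := by omega
  set v := singletVector 2 b with hv
  set w := crossVector b with hw
  have hc2 := (norm_two_mul γ).le
  have h01 : (0 : Fin 4) < 1 := by decide
  have h12 : (1 : Fin 4) < 2 := by decide
  have h13 : (1 : Fin 4) < 3 := by decide
  have h23 : (2 : Fin 4) < 3 := by decide
  have h02 : (0 : Fin 4) < 2 := by decide
  have h03 : (0 : Fin 4) < 3 := by decide
  have F02 : Good ρ 0 2 (sc γ (0 : Fin 4) 1) :=
    (Good.ker_self hρ hc2 h01 h02.ne h12.ne).sc_of_ker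
  have F03 : Good ρ 0 3 (sc γ (0 : Fin 4) 1) :=
    (Good.ker_self hρ hc2 h01 h03.ne h13.ne).sc_of_ker
  have F23 : Good ρ 2 3 (sc γ (0 : Fin 4) 1) :=
    (Good.ker_other hρ hc2 h01 h02.ne h03.ne h12.ne h13.ne).sc_of_ker
  have F01 : Good ρ 0 1 (sc γ (2 : Fin 4) 3) :=
    (Good.ker_other hρ hc2 h23 h02.ne' h12.ne' h03.ne' h13.ne').sc_of_ker
  -- the terms in which the variables of the two pairs are exchanged
  have n1 := shuffle_theta_null hρ (c 1 - y 1) (c 0 - y 0) d u u' v w (.inl ⟨rfl, rfl⟩)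
    (Good.const 1) (Good.const 1) (Good.const 1)
  have n2 := shuffle_theta_null hρ (c 1 - y 1) (c 0 - y 0) d u u' v w (.inr ⟨rfl, rfl⟩) F02 F03 F23
  have n3 := crossSum_null v w u₂ u₃ u₄ (c 0 - y 1) d hρ h01 h12 h13 h23.ne
  have n4 := crossSum_null v w u₂ u₃ u₄ (c 0 - y 1) d hρ h01 h13 h12 h23.ne'
  have n5 := crossSum_ker_null v w u₂ u₃ u₄ (c 0 - y 1) d hρ h01 h12 h23
  -- the kernels within a pair
  have n6 := null_ker hρ h01 (c 0 - y 0) (h := fun z => v * (z 0 ^ u₂ *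
      (z 2 ^ (c 2 - y 1) * z 3 ^ (c 3 - y 1)
        + sc γ (2 : Fin 4) 3 z * (z 3 ^ (c 2 - y 1) * z 2 ^ (c 3 - y 1))))) (by
    have g0 : Good ρ 0 1 fun z => z 0 := .self h01.ne
    have g2 : ∀ m : ℤ, Good ρ 0 1 fun z => z 2 ^ m := .zpow_other hρ.1 h02.ne' h12.ne'
    have g3 : ∀ m : ℤ, Good ρ 0 1 fun z => z 3 ^ m := .zpow_other hρ.1 h03.ne' h13.ne'
    exact (Good.const v).mul ((g0.pow u₂).mul (((g2 _).mul (g3 _)).add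
      (F01.mul ((g3 _).mul (g2 _))))))
  have n7 := null_ker hρ h23 (c 2 - y 1) (h := fun z => v * (z 2 ^ t *
      (z 0 ^ (c 0 - y 0) * z 1 ^ (c 1 - y 0) + z 1 ^ (c 0 - y 0) * z 0 ^ (c 1 - y 0)))) (by
    have g2 : Good ρ 2 3 fun z => z 2 := .self h23.ne
    have g0 : ∀ m : ℤ, Good ρ 2 3 fun z => z 0 ^ m := .zpow_other hρ.1 h02.ne h03.ne
    have g1 : ∀ m : ℤ, Good ρ 2 3 fun z => z 1 ^ m := .zpow_other hρ.1 h12.ne h13.ne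
    exact (Good.const v).mul ((g2.pow t).mul (((g0 _).mul (g1 _)).add ((g1 _).mul (g0 _)))))
  have n := (((((n1.add n2).add n3).add n4).add (n5.const_mul (4 * γ))).add
    (n6.const_mul (4 * γ))).add (n7.const_mul (4 * γ))
  have hM : ∀ m : Fin 4 → ℤ, TorusCont ρ fun z => ∏ j, z j ^ m j := fun m =>
    TorusCont.prod fun _ _ => torusCont_zpow hρ.1 _ _
  have hM4 : TorusCont ρ fun z =>
      v * (((∏ j, z j ^ (![c 0 - y 0, c 1 - y 0, c 2 - y 1, c 3 - y 1] : Fin 4 → ℤ) j)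
        + ∏ j, z j ^ (![c 1 - y 0, c 0 - y 0, c 2 - y 1, c 3 - y 1] : Fin 4 → ℤ) j)
        + ((∏ j, z j ^ (![c 0 - y 0, c 1 - y 0, c 3 - y 1, c 2 - y 1] : Fin 4 → ℤ) j)
        + ∏ j, z j ^ (![c 1 - y 0, c 0 - y 0, c 3 - y 1, c 2 - y 1] : Fin 4 → ℤ) j)) :=
    (torusCont_const v).mul (((hM _).add (hM _)).add ((hM _).add (hM _)))
  have hN : Null ρ fun z => betheWave (n := 2) γ z 1 c b * initialWave y z -
      v * (((∏ j, z j ^ (![c 0 - y 0, c 1 - y 0, c 2 - y 1, c 3 - y 1] : Fin 4 → ℤ) j)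
        + ∏ j, z j ^ (![c 1 - y 0, c 0 - y 0, c 2 - y 1, c 3 - y 1] : Fin 4 → ℤ) j)
        + ((∏ j, z j ^ (![c 0 - y 0, c 1 - y 0, c 3 - y 1, c 2 - y 1] : Fin 4 → ℤ) j)
        + ∏ j, z j ^ (![c 1 - y 0, c 0 - y 0, c 3 - y 1, c 2 - y 1] : Fin 4 → ℤ) j)) := by
    refine n.congr hρ.1 fun z hz => ?_
    have h0 := ne_zero_of_norm_eq hρ.1 hz
    have I := initialWave_two y z
    have w1 : ∀ i, z i ^ (c 1 - y 0) = z i ^ (c 0 - y 0) * z i ^ u₂ := fun i => by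
      rw [← zpow_natCast, ← zpow_add₀ (h0 i)]; congr 1; omega
    have w2 : ∀ i, z i ^ (c 3 - y 1) = z i ^ (c 2 - y 1) * z i ^ t := fun i => by
      rw [← zpow_natCast, ← zpow_add₀ (h0 i)]; congr 1; omega
    have s1 : sc γ (0 : Fin 4) 1 z = 1 + 4 * γ * ker (2 * γ) 0 1 z := rfl
    have s2 : sc γ (2 : Fin 4) 3 z = 1 + 4 * γ * ker (2 * γ) 2 3 z := rfl
    have r1 := initialWave_mul_shuffleSum (γ := γ) h0 (p := 0) (q := 1) (k := 2) (l := 3)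
      (I.trans (by ring)) hd h2 h3 h4 hu h5 v w
    have r2 := initialWave_mul_shuffleSum (γ := γ) h0 (p := 1) (q := 0) (k := 2) (l := 3)
      (I.trans (by ring)) hd h2 h3 h4 hu h5 v w
    have r3 := initialWave_mul_shuffleSum (γ := γ) h0 (p := 0) (q := 1) (k := 3) (l := 2)
      (I.trans (by ring)) hd h2 h3 h4 hu h5 v w
    have r4 := initialWave_mul_shuffleSum (γ := γ) h0 (p := 1) (q := 0) (k := 3) (l := 2)
      (I.trans (by ring)) hd h2 h3 h4 hu h5 v w
    rw [betheWave_four (hρ.admissible hz), ← hv, ← hw]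
    simp only [Fin.prod_univ_four, Matrix.cons_val, crossSum]
    rw [crossPre_comm _ _ (0 : Fin 4) 1] at r2 r4
    simp only [w1, w2, s1, s2] at r1 r2 r3 r4 ⊢
    linear_combination -r1 - (1 + 4 * γ * ker (2 * γ) 0 1 z) * r2
      - (1 + 4 * γ * ker (2 * γ) 2 3 z) * (r3 + (1 + 4 * γ * ker (2 * γ) 0 1 z) * r4)
  have hsum := torusMean_add hN.1 hM4
  rw [hN.2, zero_add, torusMean_const_mul, torusMean_add ((hM _).add (hM _)) ((hM _).add (hM _)),
    torusMean_add (hM _) (hM _), torusMean_add (hM _) (hM _)] at hsum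
  simp only [torusMean_monomial hρ.1, sub_add_cancel] at hsum
  rw [hsum, hv, singletVector_two, doublonState, Fin.prod_univ_two]
  have e0 : pairFst (0 : Fin 2) = (0 : Fin 4) := rfl
  have e1 : pairSnd (0 : Fin 2) = (1 : Fin 4) := rfl
  have e2 : pairFst (1 : Fin 2) = (2 : Fin 4) := rfl
  have e3 : pairSnd (1 : Fin 2) = (3 : Fin 4) := rfl
  rw [e0, e1, e2, e3]
  simp only [Perm.one_apply, csign_one, funext_iff, Fin.forall_fin_succ, Matrix.cons_val,
    Pi.zero_apply, sub_eq_zero]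
  clear hsum hN hM4 n n1 n2 n3 n4 n5 n6 n7
  by_cases p0 : c 0 = y 0 <;> by_cases p1 : c 1 = y 0 <;> by_cases p2 : c 2 = y 1 <;>
    by_cases p3 : c 3 = y 1 <;> simp [p0, p1, p2, p3, sub_eq_zero]
  ring

end InitialTwo

section InitialOne

variable {γ : ℂ} {ρ : Fin 2 → ℝ} {c : Fin 2 → ℤ} {y : Fin 1 → ℤ}

theorem betheWave_two {z : Fin 2 → ℂ} (hz : Admissible γ z) (b : Spins 2) (c : Fin 2 → ℤ) :
    betheWave (n := 1) γ z 1 c b = singletVector 1 b *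
      (z 0 ^ c 0 * z 1 ^ c 1 + sc γ (0 : Fin 2) 1 z * (z 1 ^ c 0 * z 0 ^ c 1)) := by
  have A1 : scattering (n := 1) γ z 1 = singletVector 1 :=
    (scattering_isScatteringFamily (n := 1) hz).base
  have e0 : pairFst (0 : Fin 1) = (0 : Fin 2) := rfl
  have e1 : pairSnd (0 : Fin 1) = (1 : Fin 2) := rfl
  have hs : singletVector 1 (b ∘ swap (0 : Fin 2) 1) = -singletVector 1 b := by
    simp only [singletVector, Fin.prod_univ_one, e0, e1, Function.comp_apply, swap_apply_left,
      swap_apply_right]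
    rw [singletCoeff_comm (b 1)]
    ring
  have A2 := scattering_mul_swap' (n := 1) hz 1 (j := (0 : Fin 2)) (k := (1 : Fin 2)) rfl b
  rw [one_mul, A1, hs, Perm.one_apply, Perm.one_apply] at A2
  have hu : (Finset.univ : Finset (Perm (Fin 2))) = {1, swap 0 1} := by decide
  refine (betheWave_one (n := 1) (γ := γ) (z := z) c b).trans ?_
  refine (Finset.sum_congr hu fun _ _ => rfl).trans ?_
  rw [Finset.sum_insert (by decide), Finset.sum_singleton, A1, A2,
    csign_one, csign_swap (by decide), planeWave, planeWave, Fin.prod_univ_two, Fin.prod_univ_two,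
    swap_apply_left, swap_apply_right, Perm.one_apply, Perm.one_apply, al, sc]
  ring

theorem torusMean_betheWave_one (hρ : Nested γ ρ) (hc : Monotone c) (b : Spins 2) :
    torusMean ρ (fun z => betheWave (n := 1) γ z 1 c b * initialWave y z)
      = doublonState y (1 : Perm (Fin 2)) c b := by
  have h01 : (0 : Fin 2) < 1 := by decide
  have c01 : c 0 ≤ c 1 := hc (by decide)
  obtain ⟨u, hu⟩ : ∃ d : ℕ, c 1 = c 0 + d := ⟨(c 1 - c 0).toNat, by omega⟩
  have e0 : pairFst (0 : Fin 1) = (0 : Fin 2) := rfl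
  have e1 : pairSnd (0 : Fin 1) = (1 : Fin 2) := rfl
  have n := (null_ker hρ h01 (c 0 - y 0) (h := fun z => singletVector 1 b * z 0 ^ u)
    ((Good.const _).mul ((Good.self h01.ne).pow u))).const_mul (4 * γ)
  have hM : ∀ m : Fin 2 → ℤ, TorusCont ρ fun z => ∏ j, z j ^ m j := fun m =>
    TorusCont.prod fun _ _ => torusCont_zpow hρ.1 _ _
  have hsum := torusMean_add n.1 ((torusCont_const (singletVector 1 b)).mul
    ((hM ![c 0 - y 0, c 1 - y 0]).add (hM ![c 1 - y 0, c 0 - y 0])))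
  rw [n.2, zero_add, torusMean_const_mul, torusMean_add (hM _) (hM _), torusMean_monomial hρ.1,
    torusMean_monomial hρ.1] at hsum
  refine (torusMean_congr hρ.1 fun z hz => ?_).trans (hsum.trans ?_)
  · have h0 := ne_zero_of_norm_eq hρ.1 hz
    have w1 : ∀ i, z i ^ (c 1 - y 0) = z i ^ (c 0 - y 0) * z i ^ u := fun i => by
      rw [← zpow_natCast, ← zpow_add₀ (h0 i)]; congr 1; omega
    have w2 : ∀ i, z i ^ c 0 = z i ^ (c 0 - y 0) * z i ^ y 0 := fun i => by
      rw [← zpow_add₀ (h0 i)]; congr 1; omega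
    have w3 : ∀ i, z i ^ c 1 = z i ^ (c 0 - y 0) * z i ^ u * z i ^ y 0 := fun i => by
      rw [← w1, ← zpow_add₀ (h0 i)]; congr 1; omega
    have w4 : ∀ i, z i ^ y 0 * z i ^ (-y 0) = 1 := fun i => by
      rw [← zpow_add₀ (h0 i), add_neg_cancel, zpow_zero]
    rw [betheWave_two (hρ.admissible hz), initialWave, Fin.prod_univ_one, e0, e1, sc]
    simp only [Fin.prod_univ_two, Matrix.cons_val, w1, w2, w3]
    linear_combination (singletVector 1 b * z 0 ^ (c 0 - y 0) * z 1 ^ (c 0 - y 0) *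
      (z 1 ^ u + z 0 ^ u + 4 * γ * ker (2 * γ) 0 1 z * z 0 ^ u)) *
      (z 0 ^ y 0 * z 0 ^ (-y 0) * w4 1 + w4 0)
  · rw [singletVector, doublonState, Fin.prod_univ_one, Fin.prod_univ_one, e0, e1]
    simp only [Perm.one_apply, csign_one, funext_iff, Fin.forall_fin_succ, Matrix.cons_val,
      Pi.zero_apply]
    by_cases p0 : c 0 = y 0 <;> by_cases p1 : c 1 = y 0 <;> simp [p0, p1, sub_eq_zero]
    ring

end InitialOne

/-- At time zero the contour integral is the doublon state. -/
theorem torusMean_betheWave {n : ℕ} (hn : n = 1 ∨ n = 2) {γ : ℂ} {ρ : Fin (2 * n) → ℝ}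
    (hρ : Nested γ ρ) {y : Fin n → ℤ} (hy : StrictMono y) {Q : Perm (Fin (2 * n))}
    {x : Sites (2 * n)} (hQ : Monotone (x ∘ Q)) (a : Spins (2 * n)) :
    torusMean ρ (fun z => betheWave γ z Q x a * initialWave y z) = doublonState y Q x a := by
  have h1 : torusMean ρ (fun z => betheWave γ z 1 (x ∘ Q) (a ∘ Q) * initialWave y z)
      = doublonState y 1 (x ∘ Q) (a ∘ Q) := by
    rcases hn with rfl | rfl
    · exact torusMean_betheWave_one hρ hQ _
    · exact torusMean_betheWave_two hρ (hy (by decide)) hQ _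
  have h2 : doublonState y Q x a = csign Q * doublonState y 1 (x ∘ Q) (a ∘ Q) := by
    rw [doublonState, doublonState, csign_one, one_mul, mul_assoc]
    rfl
  rw [h2, ← h1, ← torusMean_const_mul]
  refine torusMean_congr hρ.1 fun z _ => ?_
  rw [betheWave_one_comp]
  ring

/-! ### The Schrödinger equation -/

section HubbardLinear

variable {n : ℕ} {γ : ℂ}

theorem hubbardH_add (f g : Wave (2 * n)) :
    hubbardH n γ (fun x a => f x a + g x a)
      = fun x a => hubbardH n γ f x a + hubbardH n γ g x a := by
  funext x a
  simp only [hubbardH, Finset.sum_add_distrib]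
  ring

theorem hubbardH_const_mul (c : ℂ) (f : Wave (2 * n)) :
    hubbardH n γ (fun x a => c * f x a) = fun x a => c * hubbardH n γ f x a := by
  funext x a
  simp only [hubbardH, ← mul_add, ← Finset.mul_sum]
  ring

theorem hubbardH_sub (f g : Wave (2 * n)) :
    hubbardH n γ (fun x a => f x a - g x a)
      = fun x a => hubbardH n γ f x a - hubbardH n γ g x a := by
  have := hubbardH_add (γ := γ) f fun x a => -1 * g x a
  rw [hubbardH_const_mul] at this
  simpa [sub_eq_add_neg] using this

theorem norm_hubbardH_le {f : Wave (2 * n)} {x : Sites (2 * n)} {a : Spins (2 * n)} {K D : ℝ}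
    (h : ‖f x a‖ ≤ D) (hp : ∀ j, ‖f (x + Pi.single j 1) a‖ ≤ K * D)
    (hm : ∀ j, ‖f (x - Pi.single j 1) a‖ ≤ K * D) :
    ‖hubbardH n γ f x a‖ ≤ (4 * n * K + 16 * ‖γ‖ * n ^ 2 + 4 * ‖γ‖ * n) * D := by
  have h1 : ‖∑ j : Fin (2 * n), (f (x + Pi.single j 1) a + f (x - Pi.single j 1) a)‖
      ≤ 2 * n * (2 * (K * D)) := by
    refine (norm_sum_le_of_le _ (n := fun _ => 2 * (K * D)) fun j _ => ?_).trans (by simp)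
    refine (norm_add_le _ _).trans ?_
    linarith [hp j, hm j]
  have h2 : ‖∑ j : Fin (2 * n), ∑ k : Fin (2 * n), if j < k ∧ x j = x k then (1 : ℂ) else 0‖
      ≤ 2 * n * (2 * n) := by
    refine (norm_sum_le_of_le _ (n := fun _ => 2 * (n : ℝ)) fun j _ => ?_).trans (by simp)
    refine (norm_sum_le_of_le _ (n := fun _ => (1 : ℝ)) fun k _ => ?_).trans (by simp)
    split_ifs <;> simp
  have h0 := norm_nonneg (f x a)
  have e4 : ‖(4 : ℂ)‖ = 4 := by simp
  rw [hubbardH]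
  refine (norm_sub_le _ _).trans ?_
  refine (add_le_add_left (norm_add_le _ _) _).trans ?_
  rw [norm_neg]
  simp only [norm_mul, e4, Complex.norm_I, mul_one, Complex.norm_natCast]
  have h3 : ‖∑ j : Fin (2 * n), ∑ k : Fin (2 * n), if j < k ∧ x j = x k then (1 : ℂ) else 0‖
      * ‖f x a‖ ≤ 2 * n * (2 * n) * D := mul_le_mul h2 h h0 (by positivity)
  have h4 : 4 * ‖γ‖ * (‖∑ j : Fin (2 * n), ∑ k : Fin (2 * n),
      if j < k ∧ x j = x k then (1 : ℂ) else 0‖ * ‖f x a‖) ≤ 4 * ‖γ‖ * (2 * n * (2 * n) * D) :=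
    mul_le_mul_of_nonneg_left h3 (by positivity)
  have h5 : 4 * ‖γ‖ * n * ‖f x a‖ ≤ 4 * ‖γ‖ * n * D :=
    mul_le_mul_of_nonneg_left h (by positivity)
  linarith

theorem hubbardH_torusMean {N : ℕ} {ρ : Fin N → ℝ} {f : (Fin N → ℂ) → Wave (2 * n)}
    (hf : ∀ x a, TorusCont ρ fun z => f z x a) (x : Sites (2 * n)) (a : Spins (2 * n)) :
    hubbardH n γ (fun x a => torusMean ρ fun z => f z x a) x a
      = torusMean ρ fun z => hubbardH n γ (f z) x a := by
  have c1 : TorusCont ρ fun z => ∑ j : Fin (2 * n),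
      (f z (x + Pi.single j 1) a + f z (x - Pi.single j 1) a) :=
    TorusCont.sum fun j _ => (hf _ a).add (hf _ a)
  have e1 : torusMean ρ (fun z => ∑ j : Fin (2 * n),
      (f z (x + Pi.single j 1) a + f z (x - Pi.single j 1) a))
      = ∑ j : Fin (2 * n), ((torusMean ρ fun z => f z (x + Pi.single j 1) a)
        + torusMean ρ fun z => f z (x - Pi.single j 1) a) := by
    rw [torusMean_sum _ fun j _ => (hf _ a).add (hf _ a)]
    exact Finset.sum_congr rfl fun j _ => torusMean_add (hf _ a) (hf _ a)
  have e2 : ∀ c, torusMean ρ (fun z => -1 * (∑ j : Fin (2 * n),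
      (f z (x + Pi.single j 1) a + f z (x - Pi.single j 1) a)) + c * f z x a)
      = -1 * torusMean ρ (fun z => ∑ j : Fin (2 * n),
      (f z (x + Pi.single j 1) a + f z (x - Pi.single j 1) a))
      + c * torusMean ρ fun z => f z x a := by
    intro c
    rw [torusMean_add ((torusCont_const _).mul c1) ((torusCont_const _).mul (hf _ _)),
      torusMean_const_mul, torusMean_const_mul]
  have e3 := e2 (4 * Complex.I * γ *
    (∑ j : Fin (2 * n), ∑ k : Fin (2 * n), if j < k ∧ x j = x k then 1 else 0)
    - 4 * Complex.I * γ * n)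
  rw [e1] at e3
  simp only [hubbardH]
  refine Eq.trans ?_ (e3.symm.trans ?_)
  · ring
  · congr 1
    funext z
    ring

end HubbardLinear

instance : Fintype Spin := ⟨{Spin.up, Spin.down}, fun s => by cases s <;> simp⟩

section Weight

variable {N : ℕ}

/-- The exponential weight `∏_j K^{|x_j|}`. -/
def siteWeight (K : ℝ) (x : Sites N) : ℝ := ∏ j, K ^ (x j).natAbs

theorem one_le_siteWeight {K : ℝ} (hK : 1 ≤ K) (x : Sites N) : 1 ≤ siteWeight K x :=
  Finset.one_le_prod fun _ _ => one_le_pow₀ hK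

theorem siteWeight_add_single {K : ℝ} (hK : 1 ≤ K) (x : Sites N) (j : Fin N) {m : ℤ}
    (hm : m.natAbs ≤ 1) : siteWeight K (x + Pi.single j m) ≤ K * siteWeight K x := by
  rw [siteWeight, siteWeight, ← Finset.mul_prod_erase _ _ (Finset.mem_univ j),
    ← Finset.mul_prod_erase Finset.univ (fun i => K ^ (x i).natAbs) (Finset.mem_univ j),
    ← mul_assoc]
  refine mul_le_mul ?_ (le_of_eq (Finset.prod_congr rfl fun i hi => ?_))
    (Finset.prod_nonneg fun _ _ => by positivity) (by positivity)
  · rw [← pow_succ']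
    refine pow_le_pow_right₀ hK ?_
    rw [Pi.add_apply, Pi.single_eq_same]
    omega
  · rw [Pi.add_apply, Pi.single_eq_of_ne (Finset.ne_of_mem_erase hi), add_zero]

theorem zpow_le_pow_natAbs {a K : ℝ} (ha : 0 < a) (ha1 : a ≤ K) (ha2 : a⁻¹ ≤ K) (m : ℤ) :
    a ^ m ≤ K ^ m.natAbs := by
  rcases le_total 0 m with h | h
  · obtain ⟨k, rfl⟩ := Int.eq_ofNat_of_zero_le h
    rw [zpow_natCast, Int.natAbs_natCast]
    exact pow_le_pow_left₀ ha.le ha1 k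
  · obtain ⟨k, hk⟩ := Int.eq_ofNat_of_zero_le (neg_nonneg.2 h)
    obtain rfl : m = -(k : ℤ) := by omega
    rw [zpow_neg, zpow_natCast, Int.natAbs_neg, Int.natAbs_natCast, ← inv_pow]
    exact pow_le_pow_left₀ (by positivity) ha2 k

end Weight

section ContourWave

variable {n : ℕ} {γ : ℂ} {ρ : Fin (2 * n) → ℝ} {y : Fin n → ℤ}

/-- The superposition of Bethe wave functions by the contour integral, as a function of time. -/
def contourWave (γ : ℂ) (ρ : Fin (2 * n) → ℝ) (y : Fin n → ℤ) (t : ℝ) : Wave (2 * n) := fun x a =>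
  torusMean ρ fun z => Complex.exp (-Complex.I * energy γ z * t) *
    (betheFn γ z x a * initialWave y z)

theorem torusCont_betheFn (hρ : Nested γ ρ) (x : Sites (2 * n)) (a : Spins (2 * n)) :
    TorusCont ρ fun z => betheFn γ z x a := torusCont_betheWave hρ _ x a

theorem torusCont_exp_energy (hρ : Nested γ ρ) (t : ℝ) :
    TorusCont ρ fun z => Complex.exp (-Complex.I * energy γ z * t) :=
  torusCont_exp (((torusCont_const _).mul (torusCont_energy hρ.1)).mul (torusCont_const _))

theorem hasDerivAt_contourWave (hρ : Nested γ ρ) (t : ℝ) (x : Sites (2 * n)) (a : Spins (2 * n)) :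
    HasDerivAt (fun t => contourWave γ ρ y t x a)
      (-Complex.I * hubbardH n γ (contourWave γ ρ y t) x a) t := by
  refine (hasDerivAt_torusMean_exp hρ.1 (torusCont_energy hρ.1)
    ((torusCont_betheFn hρ x a).mul (torusCont_initialWave hρ.1 y)) t).congr_deriv ?_
  have h := hubbardH_torusMean (γ := γ) (f := fun z x a =>
    Complex.exp (-Complex.I * energy γ z * t) * (betheFn γ z x a * initialWave y z))
    (fun x a => (torusCont_exp_energy hρ t).mul
      ((torusCont_betheFn hρ x a).mul (torusCont_initialWave hρ.1 y))) x a
  have h' : hubbardH n γ (contourWave γ ρ y t) x a = _ := h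
  rw [h', ← torusMean_const_mul]
  refine torusMean_congr hρ.1 fun z hz => ?_
  have e : (fun (x : Sites (2 * n)) (a : Spins (2 * n)) =>
      Complex.exp (-Complex.I * energy γ z * t) * (betheFn γ z x a * initialWave y z))
      = fun x a =>
        (Complex.exp (-Complex.I * energy γ z * t) * initialWave y z) * betheFn γ z x a := by
    funext x a
    ring
  rw [e, hubbardH_const_mul]
  beta_reduce
  rw [hubbardH_betheFn (hρ.admissible hz) (ne_zero_of_norm_eq hρ.1 hz)]
  ring

theorem norm_csign {N : ℕ} (P : Perm (Fin N)) : ‖csign P‖ = 1 := by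
  have := congrArg norm (csign_mul_self P)
  rw [norm_mul, norm_one] at this
  nlinarith [norm_nonneg (csign P)]

theorem exists_scattering_bound (hρ : Nested γ ρ) :
    ∃ C : ℝ, ∀ z : Fin (2 * n) → ℂ, (∀ j, ‖z j‖ = ρ j) → ∀ P a, ‖scattering γ z P a‖ ≤ C := by
  choose C hC using fun (P : Perm (Fin (2 * n))) a => (torusCont_scattering hρ P a).exists_bound
  obtain ⟨M, hM⟩ := (Set.finite_range fun p : Perm (Fin (2 * n)) × Spins (2 * n) =>
    C p.1 p.2).bddAbove
  exact ⟨M, fun z hz P a => (hC P a z hz).trans (hM ⟨(P, a), rfl⟩)⟩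

theorem norm_planeWave_le {K : ℝ} (hρ : ∀ j, 0 < ρ j) (hK : ∀ j, ρ j ≤ K) (hK' : ∀ j, (ρ j)⁻¹ ≤ K)
    {z : Fin (2 * n) → ℂ} (hz : ∀ j, ‖z j‖ = ρ j) (P : Perm (Fin (2 * n))) (x : Sites (2 * n)) :
    ‖planeWave z P x‖ ≤ siteWeight K x := by
  rw [planeWave, norm_prod]
  refine Finset.prod_le_prod (fun _ _ => norm_nonneg _) fun j _ => ?_
  rw [norm_zpow, hz]
  exact zpow_le_pow_natAbs (hρ _) (hK _) (hK' _) _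

/-- Each `|z_j|^x` is at most `K^|x|`; this is all that the integrand reveals about the growth. -/
theorem exists_contourWave_bound (hρ : Nested γ ρ) {K : ℝ} (hK : ∀ j, ρ j ≤ K)
    (hK' : ∀ j, (ρ j)⁻¹ ≤ K) (τ : ℝ) :
    ∃ C : ℝ, ∀ t : ℝ, |t| ≤ τ → ∀ x a, ‖contourWave γ ρ y t x a‖ ≤ C * siteWeight K x := by
  obtain ⟨C₁, hC₁⟩ := exists_scattering_bound hρ
  obtain ⟨C₂, hC₂⟩ := (torusCont_initialWave hρ.1 y).exists_bound
  obtain ⟨C₃, hC₃⟩ := (torusCont_energy (γ := γ) hρ.1).exists_bound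
  have hex : ∃ z : Fin (2 * n) → ℂ, ∀ j, ‖z j‖ = ρ j :=
    ⟨fun j => (ρ j : ℂ), fun j => by simp [abs_of_pos (hρ.1 j)]⟩
  obtain ⟨z₀, hz₀⟩ := hex
  have p1 : 0 ≤ C₁ := (norm_nonneg _).trans (hC₁ z₀ hz₀ 1 fun _ => Spin.up)
  have p2 : 0 ≤ C₂ := (norm_nonneg _).trans (hC₂ z₀ hz₀)
  have p3 : 0 ≤ C₃ := (norm_nonneg _).trans (hC₃ z₀ hz₀)
  refine ⟨Real.exp (C₃ * τ) * (Fintype.card (Perm (Fin (2 * n))) * C₁ * C₂), fun t ht x a => ?_⟩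
  refine norm_torusMean_le hρ.1 fun z hz => ?_
  have b1 : ‖Complex.exp (-Complex.I * energy γ z * t)‖ ≤ Real.exp (C₃ * τ) := by
    rw [Complex.norm_exp]
    refine Real.exp_le_exp.2 ((Complex.re_le_norm _).trans ?_)
    rw [norm_mul, norm_mul, norm_neg, Complex.norm_I, one_mul, Complex.norm_real, Real.norm_eq_abs]
    exact mul_le_mul (hC₃ z hz) ht (abs_nonneg _) p3
  have b2 : ‖betheFn γ z x a‖ ≤ Fintype.card (Perm (Fin (2 * n))) * C₁ * siteWeight K x := by
    have hW : siteWeight K (x ∘ Tuple.sort x) = siteWeight K x :=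
      Equiv.prod_comp (Tuple.sort x) fun j => K ^ (x j).natAbs
    rw [betheFn, betheWave_one_comp, norm_mul, betheWave_one]
    rw [norm_csign, one_mul]
    refine (norm_sum_le_of_le _ (n := fun _ => C₁ * siteWeight K x) fun P _ => ?_).trans
      (by simp [mul_assoc])
    rw [norm_mul, norm_mul, norm_csign, one_mul, ← hW]
    exact mul_le_mul (hC₁ z hz _ _) (norm_planeWave_le hρ.1 hK hK' hz _ _) (norm_nonneg _) p1
  have hb : 0 ≤ Fintype.card (Perm (Fin (2 * n))) * C₁ * siteWeight K x := (norm_nonneg _).trans b2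
  rw [norm_mul, norm_mul]
  calc _ ≤ Real.exp (C₃ * τ) *
          ((Fintype.card (Perm (Fin (2 * n))) * C₁ * siteWeight K x) * C₂) := by
        refine mul_le_mul b1 (mul_le_mul b2 (hC₂ z hz) (norm_nonneg _) hb) (by positivity)
          (by positivity)
    _ = _ := by ring

theorem contourWave_zero (hn : n = 1 ∨ n = 2) (hρ : Nested γ ρ) (hy : StrictMono y)
    {Q : Perm (Fin (2 * n))} {x : Sites (2 * n)} (hQ : Monotone (x ∘ Q)) (a : Spins (2 * n)) :
    contourWave γ ρ y 0 x a = doublonState y Q x a := by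
  rw [← torusMean_betheWave hn hρ hy hQ, contourWave]
  refine torusMean_congr hρ.1 fun z hz => ?_
  rw [betheFn_eq (hρ.admissible hz) a hQ]
  simp

theorem contourFormula_eq_contourWave {r : ℝ} (h0 : 0 < r) (hρ : Nested γ (radius n r)) (t : ℝ)
    {Q : Perm (Fin (2 * n))} {x : Sites (2 * n)} (hQ : Monotone (x ∘ Q)) (a : Spins (2 * n)) :
    contourFormula γ r y t Q x a = contourWave γ (radius n r) y t x a := by
  rw [contourFormula_eq_torusMean h0, contourWave]
  refine torusMean_congr hρ.1 fun z hz => ?_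
  rw [betheFn_eq (hρ.admissible hz) a hQ]

/-- Uniqueness: although the contour integral is only known to grow at most exponentially in the
positions, the difference to a bounded solution obeys the evolution equation in a weighted space. -/
theorem IsSchrodingerSolution.eq_contourWave (hn : n = 1 ∨ n = 2) (hρ : Nested γ ρ)
    (hy : StrictMono y) {J : Set ℝ} (hJ : J.OrdConnected) (h0 : (0 : ℝ) ∈ J)
    {ψ : ℝ → Wave (2 * n)} (hψ : IsSchrodingerSolution γ y J ψ) {t : ℝ} (ht : t ∈ J)
    (x : Sites (2 * n)) (a : Spins (2 * n)) : ψ t x a = contourWave γ ρ y t x a := by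
  obtain ⟨K, hK1, hK, hK'⟩ : ∃ K : ℝ, 1 ≤ K ∧ (∀ j, ρ j ≤ K) ∧ ∀ j, (ρ j)⁻¹ ≤ K := by
    have h : ∀ j, 0 ≤ ρ j + (ρ j)⁻¹ := fun j => by have := hρ.1 j; positivity
    have h' : ∀ j, ρ j + (ρ j)⁻¹ ≤ ∑ i, (ρ i + (ρ i)⁻¹) := fun j =>
      Finset.single_le_sum (fun i _ => h i) (Finset.mem_univ j)
    have h'' : 0 ≤ ∑ i, (ρ i + (ρ i)⁻¹) := Finset.sum_nonneg fun i _ => h i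
    refine ⟨1 + ∑ i, (ρ i + (ρ i)⁻¹), by linarith, fun j => ?_, fun j => ?_⟩
    · have := inv_pos.2 (hρ.1 j); linarith [h' j]
    · have := hρ.1 j; linarith [h' j]
  have hK0 : 0 ≤ K := by linarith
  have key := evolution_unique (ι := Sites (2 * n) × Spins (2 * n))
    (W := fun i => siteWeight K i.1) (fun i => by linarith [one_le_siteWeight hK1 i.1])
    (L := 4 * n * K + 16 * ‖γ‖ * n ^ 2 + 4 * ‖γ‖ * n)
    (G := fun f i => -Complex.I * hubbardH n γ (fun x a => f (x, a)) i.1 i.2) ?_ (by positivity)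
    hJ h0 (u := fun t i => ψ t i.1 i.2 - contourWave γ ρ y t i.1 i.2) ?_ ?_ ?_ t ht (x, a)
  · exact sub_eq_zero.1 key
  · intro f C hC hf i
    rw [norm_mul, norm_neg, Complex.norm_I, one_mul]
    refine norm_hubbardH_le (hf i) (fun j => (hf (_, i.2)).trans ?_)
      (fun j => (hf (_, i.2)).trans ?_)
    · calc C * siteWeight K (i.1 + Pi.single j 1) ≤ C * (K * siteWeight K i.1) :=
            mul_le_mul_of_nonneg_left (siteWeight_add_single hK1 _ _ (by simp)) hC
        _ = _ := by ring
    · have : i.1 - Pi.single j 1 = i.1 + Pi.single j (-1) := by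
        rw [Pi.single_neg, sub_eq_add_neg]
      calc C * siteWeight K (i.1 - Pi.single j 1) ≤ C * (K * siteWeight K i.1) := by
            rw [this]
            exact mul_le_mul_of_nonneg_left (siteWeight_add_single hK1 _ _ (by simp)) hC
        _ = _ := by ring
  · intro s hs i
    refine ((hψ.equation s hs i.1 i.2).sub
      (hasDerivAt_contourWave (y := y) hρ s i.1 i.2).hasDerivWithinAt).congr_deriv ?_
    rw [hubbardH_sub (ψ s) (contourWave γ ρ y s)]
    ring
  · intro i
    rw [hψ.initial _ _ _ (Tuple.monotone_sort i.1),
      contourWave_zero hn hρ hy (Tuple.monotone_sort i.1), sub_self]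
  · intro τ
    obtain ⟨C₁, h1⟩ := hψ.bounded τ
    obtain ⟨C₂, h2⟩ := exists_contourWave_bound (y := y) hρ hK hK' τ
    refine ⟨|C₁| + C₂, fun s hs hsτ i => (norm_sub_le _ _).trans ?_⟩
    have b1 := h1 s hs hsτ i.1 i.2
    have b2 := h2 s hsτ i.1 i.2
    have b3 := one_le_siteWeight hK1 i.1
    have b4 : C₁ ≤ |C₁| * siteWeight K i.1 :=
      (le_abs_self C₁).trans (le_mul_of_one_le_right (abs_nonneg _) b3)
    rw [add_mul]
    linarith

theorem norm_doublonState_le (Q : Perm (Fin (2 * n))) (x : Sites (2 * n)) (a : Spins (2 * n)) :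
    ‖doublonState y Q x a‖ ≤ 1 := by
  have h1 : ∀ s s', ‖singletCoeff s s'‖ ≤ 1 := fun s s' => by
    cases s <;> cases s' <;> simp [singletCoeff]
  have h2 : ∀ p : Prop, ∀ _ : Decidable p, ‖(if p then (1 : ℂ) else 0)‖ ≤ 1 := fun p _ => by
    split_ifs <;> simp
  rw [doublonState, norm_mul, norm_mul, norm_csign, norm_pow, norm_neg, norm_one, one_pow, one_mul,
    one_mul, norm_prod]
  refine Finset.prod_le_one (fun _ _ => norm_nonneg _) fun j _ => ?_
  rw [norm_mul, norm_mul]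
  exact mul_le_one₀ (mul_le_one₀ (h2 _ _) (norm_nonneg _) (h2 _ _)) (norm_nonneg _) (h1 _ _)

theorem exists_isSchrodingerSolution (hn : n = 1 ∨ n = 2) (hρ : Nested γ ρ) (hy : StrictMono y) :
    ∃ ψ, IsSchrodingerSolution γ y Set.univ ψ := by
  let G : (Sites (2 * n) × Spins (2 * n) → ℂ) →ₗ[ℂ] (Sites (2 * n) × Spins (2 * n) → ℂ) :=
    { toFun := fun f i => -Complex.I * hubbardH n γ (fun x a => f (x, a)) i.1 i.2
      map_add' := fun f g => by
        funext i
        simp only [Pi.add_apply]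
        rw [hubbardH_add (fun x a => f (x, a)) fun x a => g (x, a)]
        ring
      map_smul' := fun c f => by
        funext i
        simp only [Pi.smul_apply, smul_eq_mul, RingHom.id_apply]
        rw [hubbardH_const_mul c fun x a => f (x, a)]
        ring }
  obtain ⟨u, hu0, hder, hb⟩ := evolution_exists (L := 4 * n * 1 + 16 * ‖γ‖ * n ^ 2 + 4 * ‖γ‖ * n)
    (by positivity) G (fun f C hC hf i => by
      change ‖-Complex.I * hubbardH n γ (fun x a => f (x, a)) i.1 i.2‖ ≤ _
      rw [norm_mul, norm_neg, Complex.norm_I, one_mul]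
      exact norm_hubbardH_le (hf i) (fun j => by simpa using hf (_, i.2))
        (fun j => by simpa using hf (_, i.2)))
    (fun i => doublonState y (Tuple.sort i.1) i.1 i.2) (C₀ := 1)
    (fun i => norm_doublonState_le _ _ _)
  refine ⟨fun t x a => u t (x, a), fun t _ x a => (hder t (x, a)).hasDerivWithinAt,
    fun x a Q hQ => ?_, fun τ => ?_⟩
  · rw [hu0]
    exact (contourWave_zero hn hρ hy (Tuple.monotone_sort x) a).symm.trans
      (contourWave_zero hn hρ hy hQ a)
  · obtain ⟨C, hC⟩ := hb τ
    exact ⟨C, fun t _ ht x a => hC t ht (x, a)⟩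

end ContourWave

/-! ### The Liouvillian in the occupation number basis -/

theorem creat_apply (x : ℤ) (S U : Finset ℤ) :
    creat x S U = if x ∈ S ∧ U = S.erase x then (-1) ^ (S.filter (fun u => u < x)).card else 0 := by
  rw [creat, FockOp.adj, annih]
  split_ifs <;> simp

theorem creat_comp_annih (x y : ℤ) (S T : Finset ℤ) :
    FockOp.comp (creat x) (annih y) S T = if x ∈ S ∧ y ∈ T ∧ S.erase x = T.erase y then
      (-1) ^ (S.filter (fun u => u < x)).card * (-1) ^ (T.filter (fun u => u < y)).card else 0 := by
  rw [FockOp.comp, tsum_eq_single (T.erase y) fun U hU => by simp [annih, hU]]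
  rw [creat_apply, annih]
  by_cases h1 : x ∈ S <;> by_cases h2 : y ∈ T <;> by_cases h3 : S.erase x = T.erase y <;>
    simp [h1, h2, h3, eq_comm]

theorem numOp_apply (x : ℤ) (S T : Finset ℤ) :
    numOp x S T = if S = T then (if x ∈ S then 1 else 0) else 0 := by
  rw [numOp, creat_comp_annih]
  rcases eq_or_ne S T with rfl | h
  · by_cases h1 : x ∈ S
    · simp [h1, ← mul_pow]
    · simp [h1]
  · rw [if_neg, if_neg h]
    rintro ⟨h1, h2, h3⟩
    exact h (by rw [← Finset.insert_erase h1, ← Finset.insert_erase h2, h3])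

/-- Hopping between neighbouring sites produces no sign. -/
theorem hop_apply {x y : ℤ} (h : y = x + 1 ∨ y = x - 1) (S T : Finset ℤ) :
    FockOp.comp (creat x) (annih y) S T =
      if x ∈ S ∧ y ∉ S ∧ T = insert y (S.erase x) then 1 else 0 := by
  rw [creat_comp_annih]
  have hxy : x ≠ y := by rcases h with h | h <;> omega
  have hiff : (x ∈ S ∧ y ∈ T ∧ S.erase x = T.erase y) ↔
      (x ∈ S ∧ y ∉ S ∧ T = insert y (S.erase x)) := by
    refine and_congr_right fun hx => ⟨fun ⟨h1, h2⟩ => ⟨fun hy => ?_, ?_⟩, fun ⟨h1, h2⟩ => ?_⟩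
    · have : y ∈ S.erase x := Finset.mem_erase.2 ⟨hxy.symm, hy⟩
      rw [h2] at this
      exact Finset.notMem_erase _ _ this
    · rw [h2, Finset.insert_erase h1]
    · rw [h2]
      refine ⟨Finset.mem_insert_self _ _, ?_⟩
      rw [Finset.erase_insert]
      exact fun h => h1 (Finset.mem_of_mem_erase h)
  simp only [hiff]
  refine if_ctx_congr Iff.rfl (fun ⟨h1, h2, h3⟩ => ?_) fun _ => rfl
  have e : S.filter (fun u => u < x) = T.filter (fun u => u < y) := by
    ext u
    rw [h3]
    simp only [Finset.mem_filter, Finset.mem_insert, Finset.mem_erase]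
    constructor
    · rintro ⟨hu, hlt⟩
      have : u ≠ y := by rintro rfl; exact h2 hu
      exact ⟨.inr ⟨hlt.ne, hu⟩, by omega⟩
    · rintro ⟨rfl | ⟨hne, hu⟩, hlt⟩
      · exact absurd hlt (lt_irrefl _)
      · exact ⟨hu, by omega⟩
  rw [e, ← mul_pow]
  simp

/-- The sum of `f` over the configurations that arise from `S` by moving one particle to a
neighbouring empty site. -/
def hopSum (S : Finset ℤ) (f : Finset ℤ → ℂ) : ℂ :=
  ∑ x ∈ S, ((if x + 1 ∉ S then f (insert (x + 1) (S.erase x)) else 0)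
    + if x - 1 ∉ S then f (insert (x - 1) (S.erase x)) else 0)

theorem tightBinding_apply (S T : Finset ℤ) :
    tightBinding S T = -hopSum S fun U => if T = U then 1 else 0 := by
  have s1 : ∀ x ∉ S, FockOp.comp (creat x) (annih (x + 1)) S T = 0 := fun x hx => by
    rw [hop_apply (.inl rfl), if_neg fun h => hx h.1]
  have s2 : ∀ x ∉ S, FockOp.comp (creat x) (annih (x - 1)) S T = 0 := fun x hx => by
    rw [hop_apply (.inr rfl), if_neg fun h => hx h.1]
  have hs : (∑' x : ℤ, FockOp.comp (creat (x + 1)) (annih x) S T)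
      = ∑' x : ℤ, FockOp.comp (creat x) (annih (x - 1)) S T := by
    rw [← Equiv.tsum_eq (Equiv.addRight (1 : ℤ))
      fun x => FockOp.comp (creat x) (annih (x - 1)) S T]
    simp
  have hs' : Summable fun x : ℤ => FockOp.comp (creat (x + 1)) (annih x) S T := by
    rw [← Equiv.summable_iff (Equiv.subRight (1 : ℤ))]
    refine summable_of_ne_finset_zero (s := S) fun x hx => ?_
    simpa using s2 x hx
  rw [tightBinding, Summable.tsum_add (summable_of_ne_finset_zero s1) hs', hs,
    tsum_eq_sum s1, tsum_eq_sum s2, ← Finset.sum_add_distrib, hopSum]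
  congr 1
  refine Finset.sum_congr rfl fun x hx => ?_
  rw [hop_apply (.inl rfl), hop_apply (.inr rfl)]
  by_cases h1 : x + 1 ∈ S <;> by_cases h2 : x - 1 ∈ S <;> simp [hx, h1, h2]

theorem tightBinding_comm (S T : Finset ℤ) : tightBinding S T = tightBinding T S := by
  have h : ∀ x y, FockOp.comp (creat x) (annih y) S T = FockOp.comp (creat y) (annih x) T S := by
    intro x y
    rw [creat_comp_annih, creat_comp_annih, mul_comm]
    refine if_congr ?_ rfl rfl
    rw [eq_comm (a := S.erase x)]
    tauto
  rw [tightBinding, tightBinding]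
  congr 1
  refine tsum_congr fun x => ?_
  rw [h, h (x + 1), add_comm]

theorem tsum_hopSum_mul (S : Finset ℤ) (f : Finset ℤ → ℂ) :
    ∑' U, (hopSum S fun V => if U = V then 1 else 0) * f U = hopSum S f := by
  have key : ∀ (p : Prop) [Decidable p] (V : Finset ℤ),
      HasSum (fun U => (if p then if U = V then (1 : ℂ) else 0 else 0) * f U)
        (if p then f V else 0) := by
    intro p _ V
    split_ifs
    · have := hasSum_ite_eq V (f V)
      refine this.congr_fun fun U => ?_
      split_ifs with h
      · rw [h, one_mul]
      · rw [zero_mul]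
    · simp
  have h := hasSum_sum (s := S) fun x _ => (key (x + 1 ∉ S) (insert (x + 1) (S.erase x))).add
    (key (x - 1 ∉ S) (insert (x - 1) (S.erase x)))
  rw [hopSum, ← h.tsum_eq]
  refine tsum_congr fun U => ?_
  rw [hopSum, Finset.sum_mul]
  simp only [add_mul]

theorem tightBinding_comp (ρ : FockOp) (S T : Finset ℤ) :
    FockOp.comp tightBinding ρ S T = -hopSum S fun U => ρ U T := by
  rw [FockOp.comp, ← tsum_hopSum_mul, ← tsum_neg]
  exact tsum_congr fun U => by rw [tightBinding_apply]; ring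

theorem comp_tightBinding (ρ : FockOp) (S T : Finset ℤ) :
    FockOp.comp ρ tightBinding S T = -hopSum T fun U => ρ S U := by
  rw [FockOp.comp, ← tsum_hopSum_mul, ← tsum_neg]
  exact tsum_congr fun U => by rw [tightBinding_comm, tightBinding_apply]; ring

theorem comp_of_diag_left {A : FockOp} {d : Finset ℤ → ℂ}
    (hA : ∀ S T, A S T = if S = T then d S else 0) (B : FockOp) (S T : Finset ℤ) :
    FockOp.comp A B S T = d S * B S T := by
  rw [FockOp.comp, tsum_eq_single S fun U hU => by rw [hA, if_neg hU.symm, zero_mul],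
    hA, if_pos rfl]

theorem comp_of_diag_right {A : FockOp} {d : Finset ℤ → ℂ}
    (hA : ∀ S T, A S T = if S = T then d S else 0) (B : FockOp) (S T : Finset ℤ) :
    FockOp.comp B A S T = B S T * d T := by
  rw [FockOp.comp, tsum_eq_single T fun U hU => by rw [hA, if_neg hU, mul_zero], hA, if_pos rfl]

theorem liouvillian_apply {g : ℝ} (hg : 0 ≤ g) (ρ : FockOp) (S T : Finset ℤ) :
    liouvillian g ρ S T =
      -Complex.I * (-(hopSum S fun U => ρ U T) + hopSum T fun U => ρ S U)
        + 4 * g * ((S ∩ T).card - ((S.card : ℂ) + T.card) / 2) * ρ S T := by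
  have hsq : (Real.sqrt (4 * g) : ℂ) * (Real.sqrt (4 * g) : ℂ) = 4 * g := by
    rw [← Complex.ofReal_mul, Real.mul_self_sqrt (by positivity)]
    push_cast
    ring
  have hL : ∀ x S T, lindbladOp g x S T
      = if S = T then (Real.sqrt (4 * g) : ℂ) * (if x ∈ S then 1 else 0) else 0 := by
    intro x S T
    rw [lindbladOp, numOp_apply, mul_ite, mul_zero]
  have hL' : ∀ x S T, FockOp.adj (lindbladOp g x) S T
      = if S = T then (Real.sqrt (4 * g) : ℂ) * (if x ∈ S then 1 else 0) else 0 := by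
    intro x S T
    rw [FockOp.adj, hL]
    rcases eq_or_ne S T with rfl | h
    · split_ifs <;> simp
    · simp [h, h.symm]
  have hLL : ∀ x S T, FockOp.comp (FockOp.adj (lindbladOp g x)) (lindbladOp g x) S T
      = if S = T then 4 * (g : ℂ) * (if x ∈ S then 1 else 0) else 0 := by
    intro x S T
    rw [comp_of_diag_left (hL' x), hL]
    split_ifs
    · linear_combination hsq
    all_goals simp
  have hterm : ∀ x : ℤ,
      FockOp.comp (FockOp.comp (lindbladOp g x) ρ) (FockOp.adj (lindbladOp g x)) S T
        - 1 / 2 * (FockOp.comp (FockOp.comp (FockOp.adj (lindbladOp g x)) (lindbladOp g x)) ρ S T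
          + FockOp.comp ρ (FockOp.comp (FockOp.adj (lindbladOp g x)) (lindbladOp g x)) S T)
      = 4 * g * ρ S T * ((if x ∈ S ∩ T then 1 else 0)
        - ((if x ∈ S then 1 else 0) + (if x ∈ T then 1 else 0)) / 2) := by
    intro x
    rw [comp_of_diag_right (hL' x), comp_of_diag_left (hL x), comp_of_diag_left (hLL x),
      comp_of_diag_right (hLL x)]
    have hST : (if x ∈ S ∩ T then (1 : ℂ) else 0)
        = (if x ∈ S then 1 else 0) * (if x ∈ T then 1 else 0) := by
      by_cases h1 : x ∈ S <;> by_cases h2 : x ∈ T <;> simp [h1, h2]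
    rw [hST]
    linear_combination ((if x ∈ S then 1 else 0) * (if x ∈ T then 1 else 0) * ρ S T) * hsq
  have hcount : ∀ U : Finset ℤ, U ⊆ S ∪ T →
      (∑ x ∈ S ∪ T, if x ∈ U then (1 : ℂ) else 0) = U.card := by
    intro U hU
    rw [Finset.sum_ite_mem, Finset.inter_eq_right.2 hU]
    simp
  rw [liouvillian, tightBinding_comp, comp_tightBinding]
  simp only [hterm]
  rw [tsum_eq_sum (s := S ∪ T) fun x hx => by
    simp only [Finset.mem_union, not_or] at hx
    simp [hx.1, hx.2], ← Finset.mul_sum, Finset.sum_sub_distrib, ← Finset.sum_div,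
    Finset.sum_add_distrib, hcount _ (Finset.inter_subset_left.trans Finset.subset_union_left),
    hcount _ Finset.subset_union_left, hcount _ Finset.subset_union_right]
  ring

/-! ### Occupation number states -/

theorem app_creat_indicator (a : ℤ) (U₀ S : Finset ℤ) :
    FockOp.app (creat a) (fun U => if U = U₀ then 1 else 0) S = creat a S U₀ := by
  rw [FockOp.app, tsum_eq_single U₀ fun U hU => by rw [if_neg hU, mul_zero], if_pos rfl, mul_one]

theorem ketList_singleton (a : ℤ) :
    ketList [a] = fun S : Finset ℤ => if S = {a} then 1 else 0 := by
  funext S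
  refine (app_creat_indicator a ∅ S).trans ?_
  rw [creat_apply]
  have h : (a ∈ S ∧ ∅ = S.erase a) ↔ S = {a} := by
    constructor
    · rintro ⟨h1, h2⟩
      rw [← Finset.insert_erase h1, ← h2]
      simp
    · rintro rfl
      simp
  simp only [h]
  split_ifs with h'
  · subst h'
    simp [Finset.filter_singleton]
  · rfl

theorem ketList_pair (a b : ℤ) (S : Finset ℤ) : ketList [a, b] S =
    if a ≠ b ∧ S = {a, b} then (if a < b then 1 else -1) else 0 := by
  have hk : ketList [a, b] S = FockOp.app (creat a) (ketList [b]) S := rfl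
  rw [hk, ketList_singleton, app_creat_indicator, creat_apply]
  have h : (a ∈ S ∧ {b} = S.erase a) ↔ a ≠ b ∧ S = {a, b} := by
    constructor
    · rintro ⟨h1, h2⟩
      refine ⟨?_, by rw [← Finset.insert_erase h1, ← h2]⟩
      rintro rfl
      have : a ∈ S.erase a := by rw [← h2]; simp
      exact Finset.notMem_erase _ _ this
    · rintro ⟨h1, rfl⟩
      refine ⟨by simp, ?_⟩
      rw [Finset.erase_insert (by simpa using h1)]
  simp only [h]
  refine if_ctx_congr Iff.rfl (fun ⟨h1, h2⟩ => ?_) fun _ => rfl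
  clear hk h
  subst h2
  rw [Finset.filter_insert, if_neg (lt_irrefl _), Finset.filter_singleton]
  rcases lt_or_gt_of_ne h1 with h | h
  · simp [h, h.not_gt]
  · simp [h, h.not_gt]

variable {n : ℕ}

theorem ket_of_not_injective (hn : n = 1 ∨ n = 2) {x : Fin n → ℤ}
    (hx : ¬ Function.Injective x) : ket x = 0 := by
  rcases hn with rfl | rfl
  · exact absurd (Function.injective_of_subsingleton x) hx
  · funext S
    have e : ket x S = ketList [x 0, x 1] S := by simp [ket]
    rw [e, ketList_pair, if_neg]
    · rfl
    · rintro ⟨h, -⟩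
      refine hx fun i j hij => ?_
      fin_cases i <;> fin_cases j <;> simp_all

theorem ket_of_strictMono (hn : n = 1 ∨ n = 2) {x : Fin n → ℤ} {σ : Perm (Fin n)}
    (hσ : StrictMono (x ∘ σ)) :
    ket x = fun S => csign σ * if S = Finset.univ.image x then 1 else 0 := by
  rcases hn with rfl | rfl
  · obtain rfl : σ = 1 := Subsingleton.elim _ _
    funext S
    have e : ket x S = ketList [x 0] S := by simp [ket]
    rw [e, ketList_singleton, csign_one, one_mul]
    simp
  · have hu : ∀ σ : Perm (Fin 2), σ = 1 ∨ σ = swap 0 1 := by decide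
    have hi : Finset.univ.image x = {x 0, x 1} := by
      ext a
      simp [eq_comm]
    funext S
    have e : ket x S = ketList [x 0, x 1] S := by simp [ket]
    rw [e, ketList_pair, hi]
    have h01 := hσ (show (0 : Fin 2) < 1 by decide)
    rcases hu σ with rfl | rfl
    · have h : x 0 < x 1 := h01
      simp [h, h.ne, csign_one]
    · have h : x 1 < x 0 := by simpa using h01
      rw [csign_swap (by decide)]
      simp [h.ne', not_lt.2 h.le]

theorem exists_strictMono_comp {x : Fin n → ℤ} (hx : Function.Injective x) :
    ∃ σ : Perm (Fin n), StrictMono (x ∘ σ) :=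
  ⟨Tuple.sort x, (Tuple.monotone_sort x).strictMono_of_injective
    (hx.comp (Tuple.sort x).injective)⟩

theorem conj_csign {N : ℕ} (P : Perm (Fin N)) : conj (csign P) = csign P := by
  simp [csign]

theorem matrixElement_eq (hn : n = 1 ∨ n = 2) (ρ : FockOp) {x x' : Fin n → ℤ} {σ τ : Perm (Fin n)}
    (hσ : StrictMono (x ∘ σ)) (hτ : StrictMono (x' ∘ τ)) :
    matrixElement ρ x x' =
      csign σ * csign τ * ρ (Finset.univ.image x) (Finset.univ.image x') := by
  rw [matrixElement, ket_of_strictMono hn hσ, ket_of_strictMono hn hτ,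
    tsum_eq_single (Finset.univ.image x) fun S hS => by simp [hS],
    tsum_eq_single (Finset.univ.image x') fun T hT => by simp [hT]]
  simp only [if_true, mul_one, conj_csign]
  ring

theorem matrixElement_of_not_injective (hn : n = 1 ∨ n = 2) (ρ : FockOp) {x x' : Fin n → ℤ}
    (h : ¬ Function.Injective x ∨ ¬ Function.Injective x') : matrixElement ρ x x' = 0 := by
  rw [matrixElement]
  rcases h with h | h <;> simp [ket_of_not_injective hn h]

/-! ### Operators on the sector with `n` particles -/

/-- The Fock operator with the matrix elements `f` between the states of `n` particles at sorted
positions; its other matrix elements vanish. -/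
def toFock (f : (Fin n → ℤ) → (Fin n → ℤ) → ℂ) : FockOp := fun S T =>
  if h : S.card = n ∧ T.card = n then f (S.orderEmbOfFin h.1) (T.orderEmbOfFin h.2) else 0

theorem card_image_strictMono {s : Fin n → ℤ} (hs : StrictMono s) :
    (Finset.univ.image s).card = n := by
  rw [Finset.card_image_of_injective _ hs.injective, Finset.card_univ, Fintype.card_fin]

theorem toFock_image (f : (Fin n → ℤ) → (Fin n → ℤ) → ℂ) {s t : Fin n → ℤ} (hs : StrictMono s)
    (ht : StrictMono t) : toFock f (Finset.univ.image s) (Finset.univ.image t) = f s t := by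
  rw [toFock, dif_pos ⟨card_image_strictMono hs, card_image_strictMono ht⟩]
  rw [← Finset.orderEmbOfFin_unique (card_image_strictMono hs) (fun i => by simp) hs,
    ← Finset.orderEmbOfFin_unique (card_image_strictMono ht) (fun i => by simp) ht]

theorem toFock_of_card (f : (Fin n → ℤ) → (Fin n → ℤ) → ℂ) {S T : Finset ℤ}
    (h : ¬ (S.card = n ∧ T.card = n)) : toFock f S T = 0 := dif_neg h

theorem exists_strictMono_image {S : Finset ℤ} (h : S.card = n) :
    ∃ s : Fin n → ℤ, StrictMono s ∧ Finset.univ.image s = S := by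
  refine ⟨S.orderEmbOfFin h, (S.orderEmbOfFin h).strictMono, ?_⟩
  exact Finset.image_orderEmbOfFin_univ S h

theorem card_insert_erase {S : Finset ℤ} {x y : ℤ} (hx : x ∈ S) (hy : y ∉ S) :
    (insert y (S.erase x)).card = S.card := by
  rw [Finset.card_insert_of_notMem fun h => hy (Finset.mem_of_mem_erase h),
    Finset.card_erase_add_one hx]

theorem hopSum_congr {S : Finset ℤ} {f g : Finset ℤ → ℂ}
    (h : ∀ U : Finset ℤ, U.card = S.card → f U = g U) : hopSum S f = hopSum S g := by
  refine Finset.sum_congr rfl fun x hx => congrArg₂ _ ?_ ?_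
  all_goals
    split_ifs with h'
    · rfl
    · exact h _ (card_insert_erase hx h')

theorem norm_hopSum_le {S : Finset ℤ} {f : Finset ℤ → ℂ} {D : ℝ} (hD : 0 ≤ D)
    (h : ∀ U : Finset ℤ, U.card = S.card → ‖f U‖ ≤ D) : ‖hopSum S f‖ ≤ 2 * S.card * D := by
  refine (norm_sum_le_of_le _ (n := fun _ => 2 * D) fun x hx => ?_).trans (by simp; linarith)
  refine (norm_add_le _ _).trans ?_
  have key : ∀ y, ‖(if y ∉ S then f (insert y (S.erase x)) else 0)‖ ≤ D := fun y => by
    split_ifs with h'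
    · simpa using hD
    · exact h _ (card_insert_erase hx h')
  linarith [key (x + 1), key (x - 1)]

theorem strictMono_add_single {s : Fin n → ℤ} (hs : StrictMono s) (j : Fin n) {m : ℤ}
    (hm : m = 1 ∨ m = -1) (h : s j + m ∉ Finset.univ.image s) : StrictMono (s + Pi.single j m) := by
  have h' : ∀ i, s i ≠ s j + m := fun i hi => h (by rw [← hi]; simp)
  intro i k hik
  have h1 := hs hik
  have h2 := h' i
  have h3 := h' k
  simp only [Pi.add_apply]
  rcases eq_or_ne i j with rfl | hi
  · rw [Pi.single_eq_same, Pi.single_eq_of_ne hik.ne']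
    omega
  · rw [Pi.single_eq_of_ne hi]
    rcases eq_or_ne k j with rfl | hk
    · rw [Pi.single_eq_same]
      omega
    · rw [Pi.single_eq_of_ne hk]
      omega

theorem image_add_single {s : Fin n → ℤ} (hs : Function.Injective s) (j : Fin n) (m : ℤ) :
    Finset.univ.image (s + Pi.single j m)
      = insert (s j + m) ((Finset.univ.image s).erase (s j)) := by
  ext a
  simp only [Finset.mem_image, Finset.mem_univ, true_and, Finset.mem_insert, Finset.mem_erase]
  constructor
  · rintro ⟨i, rfl⟩
    rcases eq_or_ne i j with rfl | hi
    · simp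
    · refine .inr ⟨?_, i, ?_⟩
      · simpa [hi] using fun h => hi (hs h)
      · simp [hi]
  · rintro (rfl | ⟨h1, i, rfl⟩)
    · exact ⟨j, by simp⟩
    · have hi : i ≠ j := fun h => h1 (by rw [h])
      exact ⟨i, by simp [hi]⟩

/-- In terms of sorted positions, hopping onto an occupied site need not be excluded: it produces
coinciding positions, at which an antisymmetric function vanishes. -/
theorem hopSum_image {s : Fin n → ℤ} (hs : StrictMono s) {F : Finset ℤ → ℂ}
    {f : (Fin n → ℤ) → ℂ} (hF : ∀ u, StrictMono u → F (Finset.univ.image u) = f u)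
    (hf : ∀ u, ¬ Function.Injective u → f u = 0) :
    hopSum (Finset.univ.image s) F
      = ∑ j, (f (s + Pi.single j 1) + f (s - Pi.single j 1)) := by
  have key : ∀ (j : Fin n) (m : ℤ), m = 1 ∨ m = -1 →
      (if s j + m ∉ Finset.univ.image s then
        F (insert (s j + m) ((Finset.univ.image s).erase (s j))) else 0)
      = f (s + Pi.single j m) := by
    intro j m hm
    split_ifs with h
    · rw [hf]
      obtain ⟨i, -, hi⟩ := Finset.mem_image.1 h
      intro hinj
      have hij : i ≠ j := by rintro rfl; rcases hm with rfl | rfl <;> omega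
      refine hij (hinj ?_)
      simp [hij, hi]
    · rw [← image_add_single hs.injective, hF _ (strictMono_add_single hs j hm h)]
  rw [hopSum, Finset.sum_image fun _ _ _ _ h => hs.injective h]
  refine Finset.sum_congr rfl fun j _ => ?_
  rw [key j 1 (.inl rfl)]
  have := key j (-1) (.inr rfl)
  rw [Pi.single_neg, ← sub_eq_add_neg, ← sub_eq_add_neg] at this
  rw [this]

/-! ### The two halves of the positions -/

section Halves

variable {n : ℕ}

/-- The labels `1, …, 2n` as two copies of the labels `1, …, n`. -/
def halvesEquiv (n : ℕ) : Fin n ⊕ Fin n ≃ Fin (2 * n) :=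
  finSumFinEquiv.trans (finCongr (two_mul n).symm)

theorem val_halvesEquiv_inl (j : Fin n) : (halvesEquiv n (.inl j)).val = j.val := by
  simp [halvesEquiv]

theorem val_halvesEquiv_inr (j : Fin n) : (halvesEquiv n (.inr j)).val = n + j.val := by
  simp [halvesEquiv, add_comm]

/-- The positions with first half `s` and second half `t`. -/
def joinSites (s t : Fin n → ℤ) : Sites (2 * n) := Sum.elim s t ∘ (halvesEquiv n).symm

theorem joinSites_inl (s t : Fin n → ℤ) (j : Fin n) :
    joinSites s t (halvesEquiv n (.inl j)) = s j := by
  simp [joinSites]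

theorem joinSites_inr (s t : Fin n → ℤ) (j : Fin n) :
    joinSites s t (halvesEquiv n (.inr j)) = t j := by
  simp [joinSites]

theorem joinSites_halves (x : Sites (2 * n)) : joinSites (firstHalf x) (secondHalf x) = x := by
  funext i
  obtain ⟨k, rfl⟩ := (halvesEquiv n).surjective i
  rcases k with j | j
  · rw [joinSites_inl, firstHalf]
    exact congrArg x (Fin.ext (val_halvesEquiv_inl j).symm)
  · rw [joinSites_inr, secondHalf]
    exact congrArg x (Fin.ext (val_halvesEquiv_inr j).symm)

theorem sum_halves (f : Fin (2 * n) → ℂ) :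
    ∑ i, f i = ∑ j, f (halvesEquiv n (.inl j)) + ∑ j, f (halvesEquiv n (.inr j)) := by
  rw [← Equiv.sum_comp (halvesEquiv n), Fintype.sum_sum_type]

theorem joinSites_add_single_inl (s t : Fin n → ℤ) (j : Fin n) (m : ℤ) :
    joinSites s t + Pi.single (halvesEquiv n (.inl j)) m = joinSites (s + Pi.single j m) t := by
  funext i
  obtain ⟨k | k, rfl⟩ := (halvesEquiv n).surjective i
  · simp only [Pi.add_apply, joinSites_inl, Pi.single_apply, (halvesEquiv n).apply_eq_iff_eq,
      Sum.inl.injEq]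
  · simp only [Pi.add_apply, joinSites_inr, Pi.single_apply, (halvesEquiv n).apply_eq_iff_eq,
      reduceCtorEq, if_false, add_zero]

theorem joinSites_add_single_inr (s t : Fin n → ℤ) (j : Fin n) (m : ℤ) :
    joinSites s t + Pi.single (halvesEquiv n (.inr j)) m = joinSites s (t + Pi.single j m) := by
  funext i
  obtain ⟨k | k, rfl⟩ := (halvesEquiv n).surjective i
  · simp only [Pi.add_apply, joinSites_inl, Pi.single_apply, (halvesEquiv n).apply_eq_iff_eq,
      reduceCtorEq, if_false, add_zero]
  · simp only [Pi.add_apply, joinSites_inr, Pi.single_apply, (halvesEquiv n).apply_eq_iff_eq,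
      Sum.inr.injEq]

theorem halfDownHalfUp_inl (j : Fin n) :
    halfDownHalfUp n (halvesEquiv n (.inl j)) = Spin.down := by
  rw [halfDownHalfUp, val_halvesEquiv_inl, if_pos j.2]

theorem halfDownHalfUp_inr (j : Fin n) :
    halfDownHalfUp n (halvesEquiv n (.inr j)) = Spin.up := by
  rw [halfDownHalfUp, val_halvesEquiv_inr, if_neg (by omega)]

/-- Separate permutations of the two halves. -/
def halvesPerm (σ τ : Perm (Fin n)) : Perm (Fin (2 * n)) :=
  (halvesEquiv n).permCongr (Equiv.sumCongr σ τ)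

theorem csign_halvesPerm (σ τ : Perm (Fin n)) : csign (halvesPerm σ τ) = csign σ * csign τ := by
  rw [csign, halvesPerm, Perm.sign_permCongr]
  have : Perm.sign (Equiv.sumCongr σ τ : Perm (Fin n ⊕ Fin n)) = Perm.sign σ * Perm.sign τ :=
    Perm.sign_sumCongr σ τ
  rw [this, csign, csign]
  push_cast
  rfl

theorem joinSites_comp (s t : Fin n → ℤ) (σ τ : Perm (Fin n)) :
    joinSites (s ∘ σ) (t ∘ τ) = joinSites s t ∘ halvesPerm σ τ := by
  funext i
  obtain ⟨k | k, rfl⟩ := (halvesEquiv n).surjective i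
  · simp [joinSites, halvesPerm]
  · simp [joinSites, halvesPerm]

theorem halfDownHalfUp_comp (σ τ : Perm (Fin n)) :
    halfDownHalfUp n ∘ halvesPerm σ τ = halfDownHalfUp n := by
  funext i
  obtain ⟨k | k, rfl⟩ := (halvesEquiv n).surjective i
  · simp [halvesPerm, halfDownHalfUp_inl]
  · simp [halvesPerm, halfDownHalfUp_inr]

/-- Coinciding positions within the two halves do not occur, so that the interaction counts the
sites that the two halves share. -/
theorem sum_coincidence {s t : Fin n → ℤ} (hs : Function.Injective s) (ht : Function.Injective t) :
    (∑ j : Fin (2 * n), ∑ k : Fin (2 * n),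
      if j < k ∧ joinSites s t j = joinSites s t k then (1 : ℂ) else 0)
      = (Finset.univ.image s ∩ Finset.univ.image t).card := by
  have e1 : ∀ j k : Fin n, (halvesEquiv n (.inl j) < halvesEquiv n (.inr k)) ↔ True := fun j k => by
    rw [Fin.lt_def, val_halvesEquiv_inl, val_halvesEquiv_inr]
    simp
    omega
  have e2 : ∀ j k : Fin n, (halvesEquiv n (.inr j) < halvesEquiv n (.inl k)) ↔ False :=
    fun j k => by
    rw [Fin.lt_def, val_halvesEquiv_inl, val_halvesEquiv_inr]
    simp
    omega
  have e3 : ∀ j k : Fin n, ¬ (halvesEquiv n (.inl j) < halvesEquiv n (.inl k) ∧ s j = s k) := by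
    rintro j k ⟨h1, h2⟩
    rw [hs h2] at h1
    exact lt_irrefl _ h1
  have e4 : ∀ j k : Fin n, ¬ (halvesEquiv n (.inr j) < halvesEquiv n (.inr k) ∧ t j = t k) := by
    rintro j k ⟨h1, h2⟩
    rw [ht h2] at h1
    exact lt_irrefl _ h1
  simp only [sum_halves, joinSites_inl, joinSites_inr, e1, e2, e3, e4, true_and, false_and,
    if_false, Finset.sum_const_zero, zero_add, add_zero]
  have h1 : ∀ j, (∑ k, if s j = t k then (1 : ℂ) else 0)
      = if s j ∈ Finset.univ.image t then 1 else 0 := by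
    intro j
    split_ifs with h
    · obtain ⟨k, -, hk⟩ := Finset.mem_image.1 h
      rw [Finset.sum_eq_single k]
      · rw [if_pos hk.symm]
      · intro l _ hl
        exact if_neg fun h => hl (ht (h.symm.trans hk.symm))
      · simp
    · refine Finset.sum_eq_zero fun k _ => if_neg fun hk => h ?_
      rw [hk]
      simp
  simp only [h1]
  rw [← Finset.sum_image (s := Finset.univ) (g := s)
    (f := fun a => if a ∈ Finset.univ.image t then (1 : ℂ) else 0) fun _ _ _ _ h => hs h,
    Finset.sum_ite_mem]
  simp

end Halves

/-! ### The Green's function -/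

section Green

variable {n : ℕ} {γ : ℂ} {ρ : Fin (2 * n) → ℝ} {y : Fin n → ℤ}

theorem antisymm_contourWave (hρ : Nested γ ρ) (t : ℝ) : Antisymm (contourWave γ ρ y t) := by
  intro σ x a
  rw [contourWave, contourWave, ← torusMean_const_mul]
  refine torusMean_congr hρ.1 fun z hz => ?_
  rw [antisymm_betheFn (hρ.admissible hz)]
  ring

/-- The contour integral is bounded because it equals a bounded solution, which is
known to exist. -/
theorem exists_contourWave_bound_uniform (hn : n = 1 ∨ n = 2) (hρ : Nested γ ρ)
    (hy : StrictMono y) (τ : ℝ) :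
    ∃ C : ℝ, ∀ t : ℝ, |t| ≤ τ → ∀ x a, ‖contourWave γ ρ y t x a‖ ≤ C := by
  obtain ⟨ψ, hψ⟩ := exists_isSchrodingerSolution hn hρ hy
  obtain ⟨C, hC⟩ := hψ.bounded τ
  refine ⟨C, fun t ht x a => ?_⟩
  rw [← hψ.eq_contourWave hn hρ hy Set.ordConnected_univ (Set.mem_univ 0) (Set.mem_univ t) x a]
  exact hC t (Set.mem_univ t) ht x a

/-- The staggered sign `∏_j (-1)^(t_j - y_j)`. -/
def stagger (y t : Fin n → ℤ) : ℂ := ∏ j, (-1 : ℂ) ^ (t j - y j)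

theorem norm_stagger (t : Fin n → ℤ) : ‖stagger y t‖ = 1 := by
  simp [stagger, norm_prod, norm_zpow]

theorem stagger_self : stagger y y = 1 := by simp [stagger]

theorem stagger_comp (t : Fin n → ℤ) (τ : Perm (Fin n)) : stagger y (t ∘ τ) = stagger y t := by
  have h0 : (-1 : ℂ) ≠ 0 := by norm_num
  simp only [stagger, zpow_sub₀ h0, Finset.prod_div_distrib, Function.comp_apply]
  rw [Equiv.prod_comp τ fun j => (-1 : ℂ) ^ t j]

theorem stagger_add_single (t : Fin n → ℤ) (j : Fin n) {m : ℤ} (hm : m = 1 ∨ m = -1) :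
    stagger y (t + Pi.single j m) = -stagger y t := by
  have h0 : (-1 : ℂ) ≠ 0 := by norm_num
  rw [stagger, stagger, ← Finset.mul_prod_erase _ _ (Finset.mem_univ j),
    ← Finset.mul_prod_erase Finset.univ (fun i => (-1 : ℂ) ^ (t i - y i)) (Finset.mem_univ j),
    ← neg_mul]
  congr 1
  · rw [Pi.add_apply, Pi.single_eq_same]
    rcases hm with rfl | rfl
    · rw [show t j + 1 - y j = t j - y j + 1 by ring, zpow_add_one₀ h0]
      ring
    · rw [show t j + -1 - y j = t j - y j - 1 by ring, zpow_sub_one₀ h0]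
      norm_num
  · refine Finset.prod_congr rfl fun i hi => ?_
    rw [Pi.add_apply, Pi.single_eq_of_ne (Finset.ne_of_mem_erase hi), add_zero]

/-- The Green's function of the dephasing chain, in terms of the contour integral. -/
def greenFn (γ : ℂ) (ρ : Fin (2 * n) → ℝ) (y : Fin n → ℤ) (t : ℝ) (s s' : Fin n → ℤ) : ℂ :=
  stagger y s' * contourWave γ ρ y t (joinSites s s') (halfDownHalfUp n)

theorem greenFn_comp (hρ : Nested γ ρ) (t : ℝ) (s s' : Fin n → ℤ) (σ τ : Perm (Fin n)) :
    greenFn γ ρ y t (s ∘ σ) (s' ∘ τ) = csign σ * csign τ * greenFn γ ρ y t s s' := by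
  have h := antisymm_contourWave (y := y) hρ t (halvesPerm σ τ) (joinSites s s') (halfDownHalfUp n)
  rw [← joinSites_comp, halfDownHalfUp_comp, csign_halvesPerm] at h
  rw [greenFn, greenFn, h, stagger_comp]
  ring

theorem greenFn_eq_zero_left (hρ : Nested γ ρ) (t : ℝ) {s s' : Fin n → ℤ}
    (h : ¬ Function.Injective s) : greenFn γ ρ y t s s' = 0 := by
  simp only [Function.Injective, not_forall] at h
  obtain ⟨i, j, hij, hne⟩ := h
  rw [greenFn, (antisymm_contourWave hρ t).eq_zero (i := halvesEquiv n (.inl i))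
    (j := halvesEquiv n (.inl j)) (by simpa using hne) (by simpa only [joinSites_inl] using hij)
    (by rw [halfDownHalfUp_inl, halfDownHalfUp_inl]), mul_zero]

theorem greenFn_eq_zero_right (hρ : Nested γ ρ) (t : ℝ) {s s' : Fin n → ℤ}
    (h : ¬ Function.Injective s') : greenFn γ ρ y t s s' = 0 := by
  simp only [Function.Injective, not_forall] at h
  obtain ⟨i, j, hij, hne⟩ := h
  rw [greenFn, (antisymm_contourWave hρ t).eq_zero (i := halvesEquiv n (.inr i))
    (j := halvesEquiv n (.inr j)) (by simpa using hne) (by simpa only [joinSites_inr] using hij)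
    (by rw [halfDownHalfUp_inr, halfDownHalfUp_inr]), mul_zero]

theorem hubbardH_joinSites (f : Wave (2 * n)) {s s' : Fin n → ℤ} (hs : Function.Injective s)
    (hs' : Function.Injective s') (a : Spins (2 * n)) :
    hubbardH n γ f (joinSites s s') a =
      -(∑ j, (f (joinSites (s + Pi.single j 1) s') a + f (joinSites (s - Pi.single j 1) s') a)
        + ∑ j, (f (joinSites s (s' + Pi.single j 1)) a + f (joinSites s (s' - Pi.single j 1)) a))
      + 4 * Complex.I * γ * ((Finset.univ.image s ∩ Finset.univ.image s').card - n) *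
        f (joinSites s s') a := by
  have hl : ∀ j, joinSites s s' - Pi.single (halvesEquiv n (.inl j)) 1
      = joinSites (s - Pi.single j 1) s' := fun j => by
    rw [sub_eq_add_neg, sub_eq_add_neg, ← Pi.single_neg, ← Pi.single_neg, joinSites_add_single_inl]
  have hr : ∀ j, joinSites s s' - Pi.single (halvesEquiv n (.inr j)) 1
      = joinSites s (s' - Pi.single j 1) := fun j => by
    rw [sub_eq_add_neg, sub_eq_add_neg, ← Pi.single_neg, ← Pi.single_neg, joinSites_add_single_inr]
  rw [hubbardH, sum_coincidence hs hs', sum_halves]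
  simp only [joinSites_add_single_inl, joinSites_add_single_inr, hl, hr]
  ring

/-- The commutator has opposite signs for the hopping of rows and of columns, the Hubbard
Hamiltonian has equal signs. The staggered sign in the columns makes up for this. -/
theorem liouvillian_toFock_greenFn {g : ℝ} (hg : 0 ≤ g) (hγ : γ = (g : ℂ)) (hρ : Nested γ ρ)
    (t : ℝ) {s s' : Fin n → ℤ} (hs : StrictMono s) (hs' : StrictMono s') :
    liouvillian g (toFock (greenFn γ ρ y t)) (Finset.univ.image s) (Finset.univ.image s') =
      stagger y s' * (-Complex.I *
        hubbardH n γ (contourWave γ ρ y t) (joinSites s s') (halfDownHalfUp n)) := by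
  rw [liouvillian_apply hg, hopSum_image hs (f := fun u => greenFn γ ρ y t u s')
      (fun u hu => toFock_image _ hu hs') (fun u hu => greenFn_eq_zero_left hρ t hu),
    hopSum_image hs' (f := fun u => greenFn γ ρ y t s u) (fun u hu => toFock_image _ hs hu)
      (fun u hu => greenFn_eq_zero_right hρ t hu),
    toFock_image _ hs hs', card_image_strictMono hs, card_image_strictMono hs',
    hubbardH_joinSites _ hs.injective hs'.injective, ← hγ]
  have e1 : ∀ j, stagger y (s' + Pi.single j 1) = -stagger y s' := fun j =>
    stagger_add_single s' j (.inl rfl)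
  have e2 : ∀ j, stagger y (s' - Pi.single j 1) = -stagger y s' := fun j => by
    rw [sub_eq_add_neg, ← Pi.single_neg]
    exact stagger_add_single s' j (.inr rfl)
  simp only [greenFn, e1, e2, ← mul_add, neg_mul, ← neg_add, Finset.sum_neg_distrib,
    ← Finset.mul_sum]
  linear_combination (4 * γ * stagger y s' * ((Finset.univ.image s ∩ Finset.univ.image s').card - n)
    * contourWave γ ρ y t (joinSites s s') (halfDownHalfUp n)) * Complex.I_sq

/-- The Liouvillian conserves the particle numbers of rows and columns. -/
theorem liouvillian_eq_zero {g : ℝ} (hg : 0 ≤ g) {σ : FockOp} {S T : Finset ℤ}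
    (h : ∀ U V : Finset ℤ, U.card = S.card → V.card = T.card → σ U V = 0) :
    liouvillian g σ S T = 0 := by
  have h0 : ∀ S : Finset ℤ, hopSum S (fun _ => 0) = 0 := fun S => by simp [hopSum]
  rw [liouvillian_apply hg, hopSum_congr fun U hU => h U T hU rfl,
    hopSum_congr fun U hU => h S U rfl hU, h0, h0, h S T rfl rfl]
  simp

theorem hasDerivAt_toFock_greenFn {g : ℝ} (hg : 0 ≤ g) (hγ : γ = (g : ℂ)) (hρ : Nested γ ρ)
    (t : ℝ) (S T : Finset ℤ) :
    HasDerivAt (fun t => toFock (greenFn γ ρ y t) S T)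
      (liouvillian g (toFock (greenFn γ ρ y t)) S T) t := by
  by_cases h : S.card = n ∧ T.card = n
  · obtain ⟨s, hs, rfl⟩ := exists_strictMono_image h.1
    obtain ⟨s', hs', rfl⟩ := exists_strictMono_image h.2
    rw [liouvillian_toFock_greenFn hg hγ hρ t hs hs']
    simp only [toFock_image _ hs hs']
    exact (hasDerivAt_contourWave hρ t _ _).const_mul _
  · rw [liouvillian_eq_zero hg fun U V hU hV => toFock_of_card _ (by rwa [hU, hV])]
    simp only [toFock_of_card _ h]
    exact hasDerivAt_const t 0

theorem eq_of_range_subset {s : Fin n → ℤ} (hs : StrictMono s) (hy : StrictMono y)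
    (h : ∀ j, s j ∈ Set.range y) : s = y := by
  have hsub : Finset.univ.image s ⊆ Finset.univ.image y := by
    intro a ha
    obtain ⟨j, -, rfl⟩ := Finset.mem_image.1 ha
    obtain ⟨k, hk⟩ := h j
    rw [← hk]
    simp
  have heq := Finset.eq_of_subset_of_card_le hsub (by
    rw [card_image_strictMono hs, card_image_strictMono hy])
  have h1 := Finset.orderEmbOfFin_unique (card_image_strictMono hy)
    (f := s) (fun i => by rw [← heq]; simp) hs
  have h2 := Finset.orderEmbOfFin_unique (card_image_strictMono hy) (f := y) (fun i => by simp) hy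
  exact h1.trans h2.symm

theorem exists_pair (i : Fin (2 * n)) : ∃ j : Fin n, i = pairFst j ∨ i = pairSnd j := by
  have h := i.2
  refine ⟨⟨i.val / 2, by omega⟩, ?_⟩
  rcases Nat.mod_two_eq_zero_or_one i.val with h | h
  · left; ext; simp [pairFst]; omega
  · right; ext; simp [pairSnd]; omega

/-- A permutation that interlaces the two halves. -/
theorem exists_interlacing (hn : n = 1 ∨ n = 2) (hy : StrictMono y) :
    ∃ Q : Perm (Fin (2 * n)), Monotone (joinSites y y ∘ Q) ∧
      doublonState y Q (joinSites y y) (halfDownHalfUp n) = 1 := by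
  rcases hn with rfl | rfl
  · have a0 : joinSites y y (0 : Fin 2) = y 0 := joinSites_inl y y (0 : Fin 1)
    have a1 : joinSites y y (1 : Fin 2) = y 0 := joinSites_inr y y (0 : Fin 1)
    have e0 : pairFst (0 : Fin 1) = (0 : Fin 2) := rfl
    have e1 : pairSnd (0 : Fin 1) = (1 : Fin 2) := rfl
    refine ⟨1, ?_, ?_⟩
    · refine Fin.monotone_iff_le_succ (n := 1) |>.2 fun i => ?_
      fin_cases i
      exact (a0.trans a1.symm).le
    · rw [doublonState, Fin.prod_univ_one, e0, e1, csign_one]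
      simp only [Perm.one_apply, a0, a1]
      simp [singletCoeff, halfDownHalfUp]
  · have a0 : joinSites y y (0 : Fin 4) = y 0 := joinSites_inl y y (0 : Fin 2)
    have a1 : joinSites y y (1 : Fin 4) = y 1 := joinSites_inl y y (1 : Fin 2)
    have a2 : joinSites y y (2 : Fin 4) = y 0 := joinSites_inr y y (0 : Fin 2)
    have a3 : joinSites y y (3 : Fin 4) = y 1 := joinSites_inr y y (1 : Fin 2)
    have e0 : pairFst (0 : Fin 2) = (0 : Fin 4) := rfl
    have e1 : pairSnd (0 : Fin 2) = (1 : Fin 4) := rfl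
    have e2 : pairFst (1 : Fin 2) = (2 : Fin 4) := rfl
    have e3 : pairSnd (1 : Fin 2) = (3 : Fin 4) := rfl
    have q0 : swap (1 : Fin 4) 2 0 = 0 := by decide
    have q1 : swap (1 : Fin 4) 2 1 = 2 := by decide
    have q2 : swap (1 : Fin 4) 2 2 = 1 := by decide
    have q3 : swap (1 : Fin 4) 2 3 = 3 := by decide
    have h01 : y 0 < y 1 := hy (by decide)
    refine ⟨swap (1 : Fin 4) 2, ?_, ?_⟩
    · refine Fin.monotone_iff_le_succ (n := 3) |>.2 fun i => ?_
      fin_cases i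
      · change joinSites y y (swap (1 : Fin 4) 2 0) ≤ joinSites y y (swap (1 : Fin 4) 2 1)
        rw [q0, q1, a0, a2]
      · change joinSites y y (swap (1 : Fin 4) 2 1) ≤ joinSites y y (swap (1 : Fin 4) 2 2)
        rw [q1, q2, a2, a1]
        exact h01.le
      · change joinSites y y (swap (1 : Fin 4) 2 2) ≤ joinSites y y (swap (1 : Fin 4) 2 3)
        rw [q2, q3, a1, a3]
    · have s : csign (swap (1 : Fin 4) 2) = -1 := csign_swap (by decide)
      rw [doublonState, Fin.prod_univ_two, e0, e1, e2, e3, q0, q1, q2, q3, a0, a1, a2, a3]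
      refine (congrArg₂ (· * ·) (congrArg₂ (· * ·) s rfl) rfl).trans ?_
      simp [singletCoeff, halfDownHalfUp]

theorem greenFn_zero (hn : n = 1 ∨ n = 2) (hρ : Nested γ ρ) (hy : StrictMono y)
    {s s' : Fin n → ℤ} (hs : StrictMono s) (hs' : StrictMono s') :
    greenFn γ ρ y 0 s s' = if s = y ∧ s' = y then 1 else 0 := by
  split_ifs with h
  · obtain ⟨h1, h2⟩ := h
    obtain ⟨Q, hQ, h⟩ := exists_interlacing hn hy
    rw [h1, h2, greenFn, contourWave_zero hn hρ hy hQ, h, stagger_self, one_mul]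
  · rw [greenFn, contourWave_zero hn hρ hy (Tuple.monotone_sort (joinSites s s')), mul_eq_zero]
    right
    by_contra hne
    have hprod := right_ne_zero_of_mul hne
    rw [Finset.prod_ne_zero_iff] at hprod
    have hmem : ∀ i, joinSites s s' i ∈ Set.range y := by
      intro i
      obtain ⟨k, rfl⟩ := (Tuple.sort (joinSites s s')).surjective i
      obtain ⟨j, hj⟩ := exists_pair k
      have h1 := left_ne_zero_of_mul (hprod j (Finset.mem_univ j))
      have h2 := left_ne_zero_of_mul h1
      have h3 := right_ne_zero_of_mul h1
      rcases hj with rfl | rfl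
      · exact ⟨j, by by_contra hh; exact h2 (if_neg fun h => hh h.symm)⟩
      · exact ⟨j, by by_contra hh; exact h3 (if_neg fun h => hh h.symm)⟩
    refine h ⟨eq_of_range_subset hs hy fun j => ?_, eq_of_range_subset hs' hy fun j => ?_⟩
    · simpa only [joinSites_inl] using hmem (halvesEquiv n (.inl j))
    · simpa only [joinSites_inr] using hmem (halvesEquiv n (.inr j))

theorem toFock_greenFn_zero (hn : n = 1 ∨ n = 2) (hρ : Nested γ ρ) (hy : StrictMono y)
    (S T : Finset ℤ) : toFock (greenFn γ ρ y 0) S T = ket y S * conj (ket y T) := by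
  have hk : ket y = fun S => if S = Finset.univ.image y then 1 else 0 := by
    have := ket_of_strictMono hn (x := y) (σ := 1) hy
    simpa [csign_one] using this
  have hinj : ∀ {s : Fin n → ℤ}, StrictMono s →
      (Finset.univ.image s = Finset.univ.image y ↔ s = y) := fun {s} hs =>
    ⟨fun h => eq_of_range_subset hs hy fun j => by
      have : s j ∈ Finset.univ.image y := by rw [← h]; simp
      simpa using this, fun h => by rw [h]⟩
  rw [hk]
  by_cases h : S.card = n ∧ T.card = n
  · obtain ⟨s, hs, rfl⟩ := exists_strictMono_image h.1
    obtain ⟨s', hs', rfl⟩ := exists_strictMono_image h.2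
    rw [toFock_image _ hs hs', greenFn_zero hn hρ hy hs hs']
    simp only [hinj hs, hinj hs']
    by_cases h1 : s = y <;> by_cases h2 : s' = y <;> simp [h1, h2]
  · rw [toFock_of_card _ h]
    have : ¬ (S = Finset.univ.image y ∧ T = Finset.univ.image y) := by
      rintro ⟨rfl, rfl⟩
      exact h ⟨card_image_strictMono hy, card_image_strictMono hy⟩
    by_cases h1 : S = Finset.univ.image y <;> by_cases h2 : T = Finset.univ.image y <;>
      simp_all

theorem exists_toFock_greenFn_bound (hn : n = 1 ∨ n = 2) (hρ : Nested γ ρ) (hy : StrictMono y)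
    (τ : ℝ) : ∃ C : ℝ, 0 ≤ C ∧ ∀ t : ℝ, |t| ≤ τ → ∀ S T, ‖toFock (greenFn γ ρ y t) S T‖ ≤ C := by
  obtain ⟨C, hC⟩ := exists_contourWave_bound_uniform hn hρ hy τ
  refine ⟨|C|, abs_nonneg _, fun t ht S T => ?_⟩
  rw [toFock]
  split_ifs with h
  · rw [greenFn, norm_mul, norm_stagger, one_mul]
    exact (hC t ht _ _).trans (le_abs_self C)
  · simp

theorem isMasterSolution_toFock_greenFn (hn : n = 1 ∨ n = 2) {g : ℝ} (hg : 0 ≤ g)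
    (hγ : γ = (g : ℂ)) (hρ : Nested γ ρ) (hy : StrictMono y) :
    IsMasterSolution g y Set.univ fun t => toFock (greenFn γ ρ y t) where
  equation t _ S T := (hasDerivAt_toFock_greenFn hg hγ hρ t S T).hasDerivWithinAt
  initial S T := toFock_greenFn_zero hn hρ hy S T
  bounded τ := by
    obtain ⟨C, -, hC⟩ := exists_toFock_greenFn_bound hn hρ hy τ
    exact ⟨C, fun t _ ht => hC t ht⟩

theorem norm_liouvillian_le {g : ℝ} (hg : 0 ≤ g) {σ : FockOp} {S T : Finset ℤ} {D : ℝ}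
    (h : ∀ U V : Finset ℤ, U.card = S.card → V.card = T.card → ‖σ U V‖ ≤ D) :
    ‖liouvillian g σ S T‖ ≤ ((2 + 4 * g) * (S.card + T.card)) * D := by
  have hD : 0 ≤ D := (norm_nonneg _).trans (h S T rfl rfl)
  have h1 := norm_hopSum_le hD (S := S) (f := fun U => σ U T) fun U hU => h U T hU rfl
  have h2 := norm_hopSum_le hD (S := T) (f := fun U => σ S U) fun U hU => h S U rfl hU
  have h3 : ‖((S ∩ T).card : ℂ) - ((S.card : ℂ) + T.card) / 2‖ ≤ S.card + T.card := by
    have e : ((S ∩ T).card : ℂ) - ((S.card : ℂ) + T.card) / 2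
        = (((S ∩ T).card - ((S.card : ℝ) + T.card) / 2 : ℝ) : ℂ) := by push_cast; ring
    rw [e, Complex.norm_real, Real.norm_eq_abs, abs_le]
    have c1 : ((S ∩ T).card : ℝ) ≤ S.card := by
      exact_mod_cast Finset.card_le_card Finset.inter_subset_left
    have c0 : (0 : ℝ) ≤ (S ∩ T).card := by positivity
    have c2 : (0 : ℝ) ≤ S.card := by positivity
    have c3 : (0 : ℝ) ≤ T.card := by positivity
    constructor <;> linarith
  have h4 : ‖((S ∩ T).card : ℂ) - ((S.card : ℂ) + T.card) / 2‖ * ‖σ S T‖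
      ≤ (S.card + T.card) * D := mul_le_mul h3 (h S T rfl rfl) (norm_nonneg _) (by positivity)
  rw [liouvillian_apply hg]
  refine (norm_add_le _ _).trans ?_
  have e4 : ‖(4 * g : ℂ)‖ = 4 * g := by simp [abs_of_nonneg hg]
  rw [norm_mul, norm_neg, Complex.norm_I, one_mul, norm_mul, norm_mul, e4, mul_assoc]
  have h5 := norm_add_le (-(hopSum S fun U => σ U T)) (hopSum T fun U => σ S U)
  rw [norm_neg] at h5
  nlinarith [mul_le_mul_of_nonneg_left h4 hg]

theorem liouvillian_sub {g : ℝ} (hg : 0 ≤ g) (σ σ' : FockOp) (S T : Finset ℤ) :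
    liouvillian g (fun U V => σ U V - σ' U V) S T = liouvillian g σ S T - liouvillian g σ' S T := by
  have h : ∀ (S : Finset ℤ) (f f' : Finset ℤ → ℂ),
      hopSum S (fun U => f U - f' U) = hopSum S f - hopSum S f' := by
    intro S f f'
    rw [hopSum, hopSum, hopSum, ← Finset.sum_sub_distrib]
    refine Finset.sum_congr rfl fun x _ => ?_
    split_ifs <;> ring
  rw [liouvillian_apply hg, liouvillian_apply hg, liouvillian_apply hg, h, h]
  ring

theorem liouvillian_congr {g : ℝ} (hg : 0 ≤ g) {σ σ' : FockOp} {S T : Finset ℤ}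
    (h : ∀ U V : Finset ℤ, U.card = S.card → V.card = T.card → σ U V = σ' U V) :
    liouvillian g σ S T = liouvillian g σ' S T := by
  rw [← sub_eq_zero, ← liouvillian_sub hg]
  exact liouvillian_eq_zero hg fun U V hU hV => sub_eq_zero.2 (h U V hU hV)

/-- Uniqueness of the bounded solution in the sector of `n` particles, on which the Liouvillian is
bounded. -/
theorem IsMasterSolution.eq_greenFn (hn : n = 1 ∨ n = 2) {g : ℝ} (hg : 0 ≤ g)
    (hγ : γ = (g : ℂ)) (hρ : Nested γ ρ) (hy : StrictMono y) {J : Set ℝ} (hJ : J.OrdConnected)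
    (h0 : (0 : ℝ) ∈ J) {σ : ℝ → FockOp} (hσ : IsMasterSolution g y J σ) {t : ℝ} (ht : t ∈ J)
    {S T : Finset ℤ} (hS : S.card = n) (hT : T.card = n) :
    σ t S T = toFock (greenFn γ ρ y t) S T := by
  classical
  let W : Finset ℤ × Finset ℤ → ℝ := fun i => if i.1.card = n ∧ i.2.card = n then 1 else 0
  have key := evolution_unique (ι := Finset ℤ × Finset ℤ) (W := W)
    (fun i => by simp only [W]; split_ifs <;> norm_num)
    (L := (2 + 4 * g) * (n + n))
    (G := fun f i => liouvillian g (fun U V => f (U, V)) i.1 i.2) ?_ (by positivity)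
    hJ h0 (u := fun t i => if i.1.card = n ∧ i.2.card = n then
      σ t i.1 i.2 - toFock (greenFn γ ρ y t) i.1 i.2 else 0) ?_ ?_ ?_ t ht (S, T)
  · simpa [hS, hT, sub_eq_zero] using key
  · intro f C hC hf i
    by_cases h : i.1.card = n ∧ i.2.card = n
    · have := norm_liouvillian_le hg (σ := fun U V => f (U, V)) (S := i.1) (T := i.2) (D := C)
        fun U V hU hV => (hf (U, V)).trans_eq (by simp [W, hU, hV, h.1, h.2])
      rw [h.1, h.2] at this
      simpa [W, h.1, h.2] using this
    · have : liouvillian g (fun U V => f (U, V)) i.1 i.2 = 0 :=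
        liouvillian_eq_zero hg fun U V hU hV => by
          have hUV : ¬ (U.card = n ∧ V.card = n) := by rwa [hU, hV]
          have h1 := hf (U, V)
          simp only [W, if_neg hUV, mul_zero] at h1
          exact norm_le_zero_iff.1 h1
      simp [this, W, h]
  · intro s hs i
    by_cases h : i.1.card = n ∧ i.2.card = n
    · simp only [if_pos h]
      refine ((hσ.equation s hs i.1 i.2).sub
        (hasDerivAt_toFock_greenFn (y := y) hg hγ hρ s i.1 i.2).hasDerivWithinAt).congr_deriv ?_
      rw [← liouvillian_sub hg]
      refine liouvillian_congr hg fun U V hU hV => ?_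
      rw [if_pos (by rwa [hU, hV])]
    · simp only [if_neg h]
      rw [liouvillian_eq_zero hg fun U V hU hV => if_neg (by rwa [hU, hV])]
      exact hasDerivWithinAt_const s J 0
  · intro i
    simp only [hσ.initial, toFock_greenFn_zero hn hρ hy, sub_self, ite_self]
  · intro τ
    obtain ⟨C₁, h1⟩ := hσ.bounded τ
    obtain ⟨C₂, -, h2⟩ := exists_toFock_greenFn_bound hn hρ hy τ
    refine ⟨C₁ + C₂, fun s hs hsτ i => ?_⟩
    by_cases h : i.1.card = n ∧ i.2.card = n
    · simp only [W, if_pos h, mul_one]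
      exact (norm_sub_le _ _).trans (add_le_add (h1 s hs hsτ _ _) (h2 s hsτ _ _))
    · simp [W, h]

theorem IsMasterSolution.matrixElement_eq (hn : n = 1 ∨ n = 2) {g : ℝ} (hg : 0 ≤ g)
    (hγ : γ = (g : ℂ)) (hρ : Nested γ ρ) (hy : StrictMono y) {J : Set ℝ} (hJ : J.OrdConnected)
    (h0 : (0 : ℝ) ∈ J) {σ : ℝ → FockOp} (hσ : IsMasterSolution g y J σ) {t : ℝ} (ht : t ∈ J)
    (s s' : Fin n → ℤ) : matrixElement (σ t) s s' = greenFn γ ρ y t s s' := by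
  by_cases h1 : Function.Injective s
  · by_cases h2 : Function.Injective s'
    · obtain ⟨α, hα⟩ := exists_strictMono_comp h1
      obtain ⟨β, hβ⟩ := exists_strictMono_comp h2
      have i1 : Finset.univ.image s = Finset.univ.image (s ∘ α) := by
        rw [← Finset.image_image, Finset.image_univ_equiv]
      have i2 : Finset.univ.image s' = Finset.univ.image (s' ∘ β) := by
        rw [← Finset.image_image, Finset.image_univ_equiv]
      rw [DephasingChain.matrixElement_eq hn _ hα hβ, i1, i2,
        hσ.eq_greenFn hn hg hγ hρ hy hJ h0 ht (card_image_strictMono hα) (card_image_strictMono hβ),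
        toFock_image _ hα hβ, greenFn_comp hρ]
      linear_combination (greenFn γ ρ y t s s') * (csign β * csign β * csign_mul_self α
        + csign_mul_self β)
    · rw [matrixElement_of_not_injective hn _ (.inr h2), greenFn_eq_zero_right hρ t h2]
  · rw [matrixElement_of_not_injective hn _ (.inl h1), greenFn_eq_zero_left hρ t h1]

end Green

end DephasingChain

end

theorem theorem1 (n : ℕ) (hn : n = 1 ∨ n = 2) (γ : ℂ) :
    ∃ r₀ : ℝ, 0 < r₀ ∧ r₀ ≤ 1 ∧ ∀ r : ℝ, 0 < r → r < r₀ →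
      -- the contours are nested as required, and the Bethe vectors are well defined on them
      DephasingChain.PolesOutside n γ r ∧
      (∀ z : Fin (2 * n) → ℂ, (∀ j, ‖z j‖ = DephasingChain.radius n r j) →
        ∃! A, DephasingChain.IsScatteringFamily γ z A) ∧
      ∀ y : Fin n → ℤ, StrictMono y →
        -- the Schrödinger equation has a solution, and every solution is the contour integral
        (∃ ψ, DephasingChain.IsSchrodingerSolution γ y Set.univ ψ) ∧
        (∀ (J : Set ℝ) (ψ : ℝ → DephasingChain.Wave (2 * n)), J.OrdConnected → (0 : ℝ) ∈ J →
          DephasingChain.IsSchrodingerSolution γ y J ψ →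
          ∀ t ∈ J, ∀ (x : DephasingChain.Sites (2 * n)) (a : DephasingChain.Spins (2 * n))
            (Q : Equiv.Perm (Fin (2 * n))), Monotone (x ∘ Q) →
            TorusIntegrable (DephasingChain.contourIntegrand γ y t Q x a) 0
              (DephasingChain.radius n r) ∧
            ψ t x a = DephasingChain.contourFormula γ r y t Q x a) ∧
        -- consequently the contour integral gives the Green's function of the dephasing chain
        (∀ g : ℝ, 0 ≤ g → γ = (g : ℂ) →
          (∃ ρ, DephasingChain.IsMasterSolution g y Set.univ ρ) ∧
          (∀ (J : Set ℝ) (ρ : ℝ → DephasingChain.FockOp), J.OrdConnected → (0 : ℝ) ∈ J →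
            DephasingChain.IsMasterSolution g y J ρ →
            ∀ t ∈ J, ∀ (x : DephasingChain.Sites (2 * n)) (Q : Equiv.Perm (Fin (2 * n))),
              Monotone (x ∘ Q) →
              DephasingChain.matrixElement (ρ t) (DephasingChain.firstHalf x)
                  (DephasingChain.secondHalf x) =
                (∏ j : Fin n, (-1 : ℂ) ^ (DephasingChain.secondHalf x j - y j)) *
                  DephasingChain.contourFormula γ r y t Q x
                    (DephasingChain.halfDownHalfUp n))) := by
  have hpos : 0 < (4 * ‖γ‖ + 4)⁻¹ := by positivity
  refine ⟨(4 * ‖γ‖ + 4)⁻¹, hpos, inv_le_one_of_one_le₀ (by linarith [norm_nonneg γ]),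
    fun r h0 h1 => ?_⟩
  have hρ := DephasingChain.nested_radius (n := n) h0 h1
  refine ⟨DephasingChain.polesOutside h0 h1,
    fun z hz => DephasingChain.existsUnique_scatteringFamily (hρ.admissible hz),
    fun y hy => ⟨DephasingChain.exists_isSchrodingerSolution hn hρ hy,
      fun J ψ hJ hJ0 hψ t ht x a Q hQ =>
        ⟨DephasingChain.torusIntegrable_contourIntegrand hρ y t Q x a, ?_⟩,
      fun g hg hγ => ⟨⟨_, DephasingChain.isMasterSolution_toFock_greenFn hn hg hγ hρ hy⟩,
        fun J ρ hJ hJ0 hσ t ht x Q hQ => ?_⟩⟩⟩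
  · rw [hψ.eq_contourWave hn hρ hy hJ hJ0 ht,
      DephasingChain.contourFormula_eq_contourWave h0 hρ t hQ]
  · rw [hσ.matrixElement_eq hn hg hγ hρ hy hJ hJ0 ht,
      DephasingChain.contourFormula_eq_contourWave h0 hρ t hQ, DephasingChain.greenFn,
      DephasingChain.joinSites_halves]
    rfl
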